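/- **Setting.** Let $d\ge 0$ and let $\Lambda=\bigcup_{i=1}^m (t_i+\mathbb Z^d)\subset\mathbb R^d$, $m\ge1$, be a standard periodic set. Let $\mathcal S^d$ be the space of real symmetric $d\times d$ matrices, $\langle A,B\rangle=\operatorname{trace}(AB)$, $Q[x]=x^tQx$. The rational closure $\tilde{\mathcal S}^d_{\ge0}$ is the set of all $Q\in\mathcal S^d$ for which there is $U\in\mathsf{GL}_d(\mathbb Z)$ with $U^tQU=\begin{pmatrix}0&0\\0&Q'\end{pmatrix}$, $Q'$ positive definite (of some size $0\le d'\le d$). A *polyhedral subdivision* of a set $X$ is a family of nonempty polyhedra with union $X$, containing all nonempty faces of its members, in which any two members that meet intersect in a common face. A *polyhedral subdivision of $\mathbb R^d$ with vertex-set $\Lambda$* is a locally finite polyhedral subdivision $\mathcal D$ of $\mathbb R^d$ such that $P=\operatorname{conv}(\Lambda\cap P)$ for every $P\in\mathcal D$; write $\operatorname{vert}P=\Lambda\cap P$. For $Q\in\tilde{\mathcal S}^d_{\ge0}$ the Delone subdivision $\operatorname{Del}(Q)$ is the set of all nonempty sets $P=\operatorname{conv}\{v\in\Lambda: Q[c-v]=r^2\}$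 with $c\in\mathbb R^d$, $r\in\mathbb R$ such that $Q[c-v]\ge r^2$ for all $v\in\Lambda$. The secondary cone of $\mathcal D$ is $\mathbf\Delta(\mathcal D)=\{Q\in\tilde{\mathcal S}^d_{\ge0}:\operatorname{Del}(Q)=\mathcal D\}$. We say that $\mathcal D$ is a coarsening of $\mathcal D'$ if every polyhedron of $\mathcal D'$ is contained in a polyhedron of $\mathcal D$. For an affinely independent set $V\subset\mathbb R^d$ with $d+1$ elements and $w\in\mathbb R^d$ put $N_{V,w}=ww^t-\sum_{v\in V}\alpha_v\,vv^t$, where $w=\sum_{v\in V}\alpha_v v$ and $\sum_{v\in V}\alpha_v=1$. **Theorem.** **I.** Let $\mathcal D$ be a polyhedral subdivision of $\mathbb R^d$ with vertex-set $\Lambda$. Then the topological closure $\overline{\mathbf\Delta(\mathcal D)}$ is contained in $\tilde{\mathcal S}^d_{\ge0}$ and, if $\mathbf\Delta(\mathcal D)$ is nonempty, it is a polyhedral cone (a finite intersection of closed linear half spaces). Choices as in (a) and (b) below exist, and for every such choice $\mathbf\Delta(\mathcal D)$ is the set of all $Q\in\tilde{\mathcal S}^d_{\ge0}$ satisfying (a)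 for every $d$-dimensional $P\in\mathcal D$, the equalities $\langle N_{V,w},Q\rangle=0$ for all $w\in\operatorname{vert}P$, where $V\subseteq\operatorname{vert}P$ is one (arbitrarily chosen) affinely independent set of $d+1$ vertices; (b) for every $(d-1)$-dimensional $F\in\mathcal D$, the inequality $\langle N_{V\cup\{w\},w'},Q\rangle>0$, where $V\subseteq\operatorname{vert}F$ is one (arbitrarily chosen) affinely independent set of $d$ vertices, and $w\in\operatorname{vert}P\setminus F$, $w'\in\operatorname{vert}P'\setminus F$ are (arbitrarily chosen) vertices of the two adjacent $d$-dimensional polyhedra $P,P'\in\mathcal D$ with $F=P\cap P'$. **II.** Every $\operatorname{Del}(Q)$, $Q\in\tilde{\mathcal S}^d_{\ge0}$, is a polyhedral subdivision of $\mathbb R^d$ with vertex-set $\Lambda$. The map $\mathcal D\mapsto\overline{\mathbf\Delta(\mathcal D)}$ is a bijection from the set of these Delone subdivisions onto the set of closures of their secondary cones, and for Delone subdivisions $\mathcal D,\mathcal D'$ of $\Lambda$ we have: $\mathcal D$ is a coarsening of $\mathcal D'$ if and only if $\overline{\mathbf\Delta(\mathcal D)}\subseteq\overline{\mathbf\Delta(\mathcal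 D')}$. The closures of all secondary cones of Delone subdivisions of $\Lambda$ form a polyhedral subdivision of $\tilde{\mathcal S}^d_{\ge0}$. -/

import Mathlib

open Set Topology Matrix

namespace Secondary

section General

variable {E : Type*} [AddCommGroup E] [Module ℝ E] [TopologicalSpace E]

/-- A polyhedron: a finite intersection of closed half spaces. -/
def IsPolyhedron (P : Set E) : Prop :=
  ∃ (n : ℕ) (f : Fin n → E →L[ℝ] ℝ) (b : Fin n → ℝ), P = {x | ∀ i, f i x ≤ b i}

/-- A polyhedral cone: a finite intersection of closed linear half spaces. -/
def IsPolyhedralCone (C : Set E) : Prop :=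
  ∃ (n : ℕ) (f : Fin n → E →L[ℝ] ℝ), C = {x | ∀ i, 0 ≤ f i x}

/-- A polyhedral subdivision of `X`: a family of nonempty polyhedra with union `X` which contains
every nonempty face of its members and is face-to-face, i.e. any two members that meet do so in
a common face. Faces are the sets on which a linear functional attains its maximum (`IsExposed`);
this includes the polyhedron itself. -/
structure IsPolyhedralSubdivision (X : Set E) (𝒟 : Set (Set E)) : Prop where
  isPolyhedron : ∀ P ∈ 𝒟, IsPolyhedron P
  nonempty : ∀ P ∈ 𝒟, P.Nonempty
  face_mem : ∀ P ∈ 𝒟, ∀ F : Set E, F.Nonempty → IsExposed ℝ P F → F ∈ 𝒟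
  inter_face : ∀ P ∈ 𝒟, ∀ P' ∈ 𝒟, (P ∩ P').Nonempty →
    IsExposed ℝ P (P ∩ P') ∧ IsExposed ℝ P' (P ∩ P')
  sUnion_eq : ⋃₀ 𝒟 = X

/-- The dimension of a nonempty set: the dimension of its affine hull. -/
noncomputable def dim (P : Set E) : ℕ := Module.finrank ℝ (vectorSpan ℝ P)

/-- `𝒟` is a coarsening of `𝒟'`: every polyhedron of `𝒟'` lies in a polyhedron of `𝒟`. -/
def IsCoarsening (𝒟 𝒟' : Set (Set E)) : Prop := ∀ P' ∈ 𝒟', ∃ P ∈ 𝒟, P' ⊆ P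

end General

variable {d : ℕ}

/-- Standard periodic sets: nonempty finite unions of translates of `ℤ^d`. -/
def IsStandardPeriodic (Λ : Set (Fin d → ℝ)) : Prop :=
  ∃ T : Finset (Fin d → ℝ), T.Nonempty ∧
    Λ = {x | ∃ t ∈ T, ∃ z : Fin d → ℤ, x = t + fun i => (z i : ℝ)}

/-- A polyhedral subdivision of `ℝ^d` with vertex-set `Λ`: it is locally finite, and each of its
polyhedra is the convex hull of the points of `Λ` that it contains. -/
structure IsSubdivisionWithVertices (Λ : Set (Fin d → ℝ)) (𝒟 : Set (Set (Fin d → ℝ))) :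
    Prop extends IsPolyhedralSubdivision Set.univ 𝒟 where
  locallyFinite : LocallyFinite (fun P : 𝒟 => (P : Set (Fin d → ℝ)))
  eq_convexHull : ∀ P ∈ 𝒟, P = convexHull ℝ (Λ ∩ P)

/-- The value `Q[x] = xᵗ Q x`. -/
def qval (Q : Matrix (Fin d) (Fin d) ℝ) (x : Fin d → ℝ) : ℝ := x ⬝ᵥ (Q *ᵥ x)

/-- The inner product `⟨A, B⟩ = trace (A B)`. -/
def pairing (A B : Matrix (Fin d) (Fin d) ℝ) : ℝ := (A * B).trace

/-- The rational closure of the cone of positive definite forms: all `Q` for which there is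
`U ∈ GL_d(ℤ)` such that `Uᵗ Q U` is block diagonal with blocks `0` (of size `k`, consisting of
the first `k` indices) and a positive definite matrix. -/
def rationalClosure (d : ℕ) : Set (Matrix (Fin d) (Fin d) ℝ) :=
  {Q | ∃ (U : Matrix.GeneralLinearGroup (Fin d) ℤ) (R : Matrix (Fin d) (Fin d) ℝ) (k : ℕ),
    R = ((U : Matrix (Fin d) (Fin d) ℤ).map (Int.cast : ℤ → ℝ))ᵀ * Q *
      (U : Matrix (Fin d) (Fin d) ℤ).map (Int.cast : ℤ → ℝ) ∧
    (∀ i j : Fin d, ((i : ℕ) < k ∨ (j : ℕ) < k) → R i j = 0) ∧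
    (R.submatrix (Subtype.val : {i : Fin d // k ≤ (i : ℕ)} → Fin d)
      (Subtype.val : {i : Fin d // k ≤ (i : ℕ)} → Fin d)).PosDef}

/-- `P` is a (nonempty) Delone polyhedron of `Q` and `Λ`. -/
def IsDelonePolyhedron (Λ : Set (Fin d → ℝ)) (Q : Matrix (Fin d) (Fin d) ℝ)
    (P : Set (Fin d → ℝ)) : Prop :=
  P.Nonempty ∧ ∃ (c : Fin d → ℝ) (r : ℝ), (∀ v ∈ Λ, r ^ 2 ≤ qval Q (c - v)) ∧
    P = convexHull ℝ {v | v ∈ Λ ∧ qval Q (c - v) = r ^ 2}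

/-- The Delone subdivision `Del(Q)`. -/
def Del (Λ : Set (Fin d → ℝ)) (Q : Matrix (Fin d) (Fin d) ℝ) : Set (Set (Fin d → ℝ)) :=
  {P | IsDelonePolyhedron Λ Q P}

/-- The secondary cone of `𝒟`. -/
def secondaryCone (Λ : Set (Fin d → ℝ)) (𝒟 : Set (Set (Fin d → ℝ))) :
    Set (Matrix (Fin d) (Fin d) ℝ) :=
  {Q | Q ∈ rationalClosure d ∧ Del Λ Q = 𝒟}

/-- The Delone subdivisions of `ℝ^d` with vertex-set `Λ`. -/
def deloneSubdivisions (Λ : Set (Fin d → ℝ)) : Set (Set (Set (Fin d → ℝ))) :=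
  {𝒟 | ∃ Q ∈ rationalClosure d, Del Λ Q = 𝒟}

open Classical in
/-- Coefficients `α` with `w = ∑ α_v v` and `1 = ∑ α_v` (sums over `v ∈ V`). They exist and are
unique on `V` if `V` is an affinely independent set of `d + 1` points, the only case in which they
are used. -/
noncomputable def affineCoeff (V : Finset (Fin d → ℝ)) (w : Fin d → ℝ) : (Fin d → ℝ) → ℝ :=
  if h : ∃ α : (Fin d → ℝ) → ℝ, ∑ v ∈ V, α v = 1 ∧ ∑ v ∈ V, α v • v = w then h.choose else 0

/-- The form `N_{V,w} = w wᵗ - ∑ α_v v vᵗ`. -/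
noncomputable def NForm (V : Finset (Fin d → ℝ)) (w : Fin d → ℝ) : Matrix (Fin d) (Fin d) ℝ :=
  vecMulVec w w - ∑ v ∈ V, affineCoeff V w v • vecMulVec v v

/-- `V` is a set of `n` affinely independent points of `S`. -/
def IsIndependentIn (n : ℕ) (V : Finset (Fin d → ℝ)) (S : Set (Fin d → ℝ)) : Prop :=
  (V : Set (Fin d → ℝ)) ⊆ S ∧ V.card = n ∧
    AffineIndependent ℝ (fun v : V => (v : Fin d → ℝ))

/-- An admissible choice, for every `d`-dimensional `P ∈ 𝒟`, of `d + 1` affinely independent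
vertices of `P`, and for every `(d - 1)`-dimensional `F ∈ 𝒟`, of `d` affinely independent vertices
of `F`, of an ordering `P, P'` of the adjacent `d`-dimensional polyhedra, and of vertices `w`
of `P` and `w'` of `P'` outside `F`. (Values on other sets are irrelevant.) -/
structure Choice (Λ : Set (Fin d → ℝ)) (𝒟 : Set (Set (Fin d → ℝ))) where
  cellV : Set (Fin d → ℝ) → Finset (Fin d → ℝ)
  cellV_spec : ∀ P ∈ 𝒟, dim P = d → IsIndependentIn (d + 1) (cellV P) (Λ ∩ P)
  facetV : Set (Fin d → ℝ) → Finset (Fin d → ℝ)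
  facetV_spec : ∀ F ∈ 𝒟, dim F + 1 = d → IsIndependentIn d (facetV F) (Λ ∩ F)
  left : Set (Fin d → ℝ) → Set (Fin d → ℝ)
  right : Set (Fin d → ℝ) → Set (Fin d → ℝ)
  adjacent : ∀ F ∈ 𝒟, dim F + 1 = d → left F ∈ 𝒟 ∧ right F ∈ 𝒟 ∧
    dim (left F) = d ∧ dim (right F) = d ∧ F = left F ∩ right F
  w : Set (Fin d → ℝ) → (Fin d → ℝ)
  w_spec : ∀ F ∈ 𝒟, dim F + 1 = d → w F ∈ (Λ ∩ left F) \ F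
  w' : Set (Fin d → ℝ) → (Fin d → ℝ)
  w'_spec : ∀ F ∈ 𝒟, dim F + 1 = d → w' F ∈ (Λ ∩ right F) \ F

variable {Λ : Set (Fin d → ℝ)} {𝒟 : Set (Set (Fin d → ℝ))}

/-- The linear equalities, one family for each `d`-dimensional polyhedron. -/
def Choice.Equalities (χ : Choice Λ 𝒟) (Q : Matrix (Fin d) (Fin d) ℝ) : Prop :=
  ∀ P ∈ 𝒟, dim P = d → ∀ w ∈ Λ ∩ P, pairing (NForm (χ.cellV P) w) Q = 0

/-- The strict linear inequalities, one for each `(d - 1)`-dimensional polyhedron. -/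
def Choice.Inequalities (χ : Choice Λ 𝒟) (Q : Matrix (Fin d) (Fin d) ℝ) : Prop :=
  ∀ F ∈ 𝒟, dim F + 1 = d → 0 < pairing (NForm (insert (χ.w F) (χ.facetV F)) (χ.w' F)) Q

end Secondary

/-!
For a symmetric form `Q`, the affine functions `ℓ` that lie below `Q[·]` on `Λ` cut out the *cells*
`conv {v ∈ Λ | ℓ v = Q[v]}`, the projections of the faces of the convex hull of the lifted points
`(v, Q[v])`. If `Q` lies in the rational closure, then completing the square shows that the nonempty
cells are the Delone polyhedra (`isDelonePolyhedron_iff`). For this, `ℓ` has to be constant along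
the kernel of `Q`, which follows from periodicity since the kernel is spanned by integral vectors.
Modulo this kernel and its integral points, only finitely many points of `Λ` matter, so that a small
perturbation of `ℓ` stays below `Q[·]`; this gives the faces of cells and, with local finiteness,
shows that `Del(Q)` is a polyhedral subdivision (`isSubdivisionWithVertices_del`). Conversely, a
symmetric form with a full-dimensional cell lies in the rational closure: it is nonnegative on
integral vectors, and by Dirichlet approximation its kernel is spanned by integral vectors
(`mem_rationalClosure_of_cell`).

Given a subdivision `𝒟`, the equalities say that `Q[·]` is interpolated by an affine function `ℓ_P`
on the vertices of each full-dimensional cell `P`, and the inequalities say that across each facet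
`F = P ∩ P'` the value of `ℓ_P'` at a vertex of `P'` outside `F` exceeds the value of `ℓ_P`. This
local convexity implies global convexity (`affine_le_of_local`, `affine_lt_of_local`): one moves
along a generic segment, which meets only facets, and the slope of the piecewise affine function
increases at each crossing. Hence every `ℓ_P` lies below `Q[·]` with contact set `Λ ∩ P`, so that
`Del(Q) = 𝒟` (`secondaryCone_eq`).

With weak instead of strict inequalities one obtains the *support cone* of `𝒟`, which consists of
the forms whose Delone subdivisions are coarsenings of `𝒟` (`mem_supportCone_iff`). For a Delone
subdivision it is the closure of the secondary cone (`closure_secondaryCone`), because adding a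
small multiple of a form in the secondary cone makes the inequalities strict. By periodicity finitely
many inequalities suffice (`exists_description`). The smallest face of the support cone of `𝒟` that
contains `Q` is the support cone of `Del(Q)` (`mem_supportCone_del_iff`), and this one fact yields
that faces and intersections of support cones are support cones, as seen at a relative interior
point `Q`.
-/

namespace Secondary

/-! ### Quadratic forms -/

section Forms

variable {d : ℕ} {Q : Matrix (Fin d) (Fin d) ℝ}

lemma dotProduct_mulVec_symm (hQ : Qᵀ = Q) (x y : Fin d → ℝ) :
    x ⬝ᵥ (Q *ᵥ y) = y ⬝ᵥ (Q *ᵥ x) := by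
  rw [dotProduct_mulVec, ← mulVec_transpose, hQ, dotProduct_comm]

lemma qval_add (hQ : Qᵀ = Q) (x y : Fin d → ℝ) :
    qval Q (x + y) = qval Q x + 2 * (x ⬝ᵥ (Q *ᵥ y)) + qval Q y := by
  simp only [qval, mulVec_add, dotProduct_add, add_dotProduct]
  rw [dotProduct_mulVec_symm hQ y x]; ring

lemma qval_smul (s : ℝ) (x : Fin d → ℝ) : qval Q (s • x) = s ^ 2 * qval Q x := by
  simp only [qval, mulVec_smul, dotProduct_smul, smul_dotProduct, smul_eq_mul]; ring

lemma qval_neg (x : Fin d → ℝ) : qval Q (-x) = qval Q x := by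
  have := qval_smul (Q := Q) (-1) x
  simpa using this

lemma qval_sub (hQ : Qᵀ = Q) (x y : Fin d → ℝ) :
    qval Q (x - y) = qval Q x - 2 * (x ⬝ᵥ (Q *ᵥ y)) + qval Q y := by
  rw [sub_eq_add_neg, qval_add hQ, qval_neg, mulVec_neg, dotProduct_neg]; ring

lemma qval_matrix_add (Q R : Matrix (Fin d) (Fin d) ℝ) (x : Fin d → ℝ) :
    qval (Q + R) x = qval Q x + qval R x := by
  simp [qval, add_mulVec]

lemma qval_matrix_smul (s : ℝ) (Q : Matrix (Fin d) (Fin d) ℝ) (x : Fin d → ℝ) :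
    qval (s • Q) x = s * qval Q x := by
  simp [qval, smul_mulVec]

lemma continuous_qval (Q : Matrix (Fin d) (Fin d) ℝ) : Continuous (qval Q) := by
  unfold qval; fun_prop

/-- For a positive semidefinite form, the isotropic vectors are exactly the kernel vectors. -/
lemma mulVec_eq_zero_of_qval_eq_zero (hQ : Qᵀ = Q) (hpos : ∀ x, 0 ≤ qval Q x)
    {x : Fin d → ℝ} (hx : qval Q x = 0) : Q *ᵥ x = 0 := by
  have key : ∀ y : Fin d → ℝ, y ⬝ᵥ (Q *ᵥ x) = 0 := by
    intro y
    by_contra hne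
    have h1 := hpos (y + (-(qval Q y + 1) / (2 * (y ⬝ᵥ (Q *ᵥ x)))) • x)
    rw [qval_add hQ, qval_smul, hx, mulVec_smul, dotProduct_smul, smul_eq_mul] at h1
    have h2 : 2 * (-(qval Q y + 1) / (2 * (y ⬝ᵥ (Q *ᵥ x))) * (y ⬝ᵥ (Q *ᵥ x)))
        = -(qval Q y + 1) := by
      field_simp
    rw [h2] at h1
    linarith
  exact dotProduct_self_eq_zero.1 (key _)

lemma qval_eq_zero_of_mulVec {x : Fin d → ℝ} (hx : Q *ᵥ x = 0) : qval Q x = 0 := by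
  simp [qval, hx]

lemma qval_add_of_mulVec (hQ : Qᵀ = Q) {x y : Fin d → ℝ} (hy : Q *ᵥ y = 0) :
    qval Q (x + y) = qval Q x := by
  rw [qval_add hQ, hy, qval_eq_zero_of_mulVec hy]; simp

lemma qval_add_le (hQ : Qᵀ = Q) (hpos : ∀ x, 0 ≤ qval Q x) (x y : Fin d → ℝ) :
    qval Q (x + y) ≤ 2 * qval Q x + 2 * qval Q y := by
  have := hpos (x - y)
  rw [qval_sub hQ] at this
  rw [qval_add hQ]; linarith

/-- A convex quadratic form bounded by `M` on a set is bounded by `M` on its convex hull. -/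
lemma qval_le_of_mem_convexHull (hQ : Qᵀ = Q) (hpos : ∀ x, 0 ≤ qval Q x) {S : Set (Fin d → ℝ)}
    {c : Fin d → ℝ} {M : ℝ} (hS : ∀ v ∈ S, qval Q (v - c) ≤ M) {x : Fin d → ℝ}
    (hx : x ∈ convexHull ℝ S) : qval Q (x - c) ≤ M := by
  refine convexHull_min (t := {x | qval Q (x - c) ≤ M}) hS ?_ hx
  intro y hy z hz a b ha hb hab
  simp only [mem_ofPred_eq] at hy hz ⊢
  have e : a • y + b • z - c = a • (y - c) + b • (z - c) := by
    rw [smul_sub, smul_sub]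
    have : c = a • c + b • c := by rw [← add_smul, hab, one_smul]
    nth_rewrite 1 [this]; abel
  have h1 := hpos ((y - c) - (z - c))
  rw [qval_sub hQ] at h1
  rw [e, qval_add hQ, qval_smul, qval_smul, mulVec_smul, dotProduct_smul, smul_dotProduct,
    smul_eq_mul, smul_eq_mul]
  have hb' : b = 1 - a := by linarith
  subst hb'
  nlinarith [mul_nonneg ha hb, mul_nonneg (mul_nonneg ha hb) h1]

end Forms

/-! ### Affine functions -/

section Affine

variable {E : Type*} [AddCommGroup E] [Module ℝ E]

lemma affine_apply (ℓ : E →ᵃ[ℝ] ℝ) (x : E) : ℓ x = ℓ.linear x + ℓ 0 := by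
  have := congrFun ℓ.decomp x
  simpa using this

lemma affine_add_apply (ℓ : E →ᵃ[ℝ] ℝ) (x y : E) : ℓ (x + y) = ℓ x + ℓ.linear y := by
  rw [affine_apply ℓ (x + y), affine_apply ℓ x, map_add]; ring

lemma affine_sum (ℓ : E →ᵃ[ℝ] ℝ) {ι : Type*} (s : Finset ι) (α : ι → ℝ) (z : ι → E)
    (h : ∑ i ∈ s, α i = 1) : ℓ (∑ i ∈ s, α i • z i) = ∑ i ∈ s, α i * ℓ (z i) := by
  rw [affine_apply, map_sum]
  have : ∀ i ∈ s, α i * ℓ (z i) = ℓ.linear (α i • z i) + α i * ℓ 0 := by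
    intro i _
    rw [affine_apply ℓ (z i), map_smul, smul_eq_mul]; ring
  rw [Finset.sum_congr rfl this, Finset.sum_add_distrib, ← Finset.sum_mul, h, one_mul]

lemma affine_comb (ℓ : E →ᵃ[ℝ] ℝ) (x y : E) {a b : ℝ} (h : a + b = 1) :
    ℓ (a • x + b • y) = a * ℓ x + b * ℓ y := by
  rw [affine_apply, affine_apply ℓ x, affine_apply ℓ y, map_add, map_smul, map_smul,
    smul_eq_mul, smul_eq_mul]
  have : ℓ 0 = a * ℓ 0 + b * ℓ 0 := by rw [← add_mul, h, one_mul]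
  linarith

lemma affine_smul_add_smul (ℓ : E →ᵃ[ℝ] ℝ) (x y : E) (t : ℝ) :
    ℓ (x + t • (y - x)) = (1 - t) * ℓ x + t * ℓ y := by
  rw [affine_add_apply, map_smul, map_sub, smul_eq_mul, affine_apply ℓ x, affine_apply ℓ y]; ring

lemma affine_le_of_mem_convexHull {ℓ ℓ' : E →ᵃ[ℝ] ℝ} {S : Set E} (h : ∀ v ∈ S, ℓ v ≤ ℓ' v)
    {x : E} (hx : x ∈ convexHull ℝ S) : ℓ x ≤ ℓ' x := by
  refine convexHull_min (t := {x | ℓ x ≤ ℓ' x}) h ?_ hx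
  intro y hy z hz a b ha hb hab
  simp only [mem_ofPred_eq] at hy hz ⊢
  rw [affine_comb _ _ _ hab, affine_comb _ _ _ hab]
  gcongr

/-- If `ℓ ≤ ℓ'` on `S`, then a point of `conv S` at which they agree lies in the convex hull of
the points of `S` at which they agree. -/
lemma mem_convexHull_of_affine_eq {ℓ ℓ' : E →ᵃ[ℝ] ℝ} {S : Set E} (h : ∀ v ∈ S, ℓ v ≤ ℓ' v)
    {x : E} (hx : x ∈ convexHull ℝ S) (hxe : ℓ x = ℓ' x) :
    x ∈ convexHull ℝ {v | v ∈ S ∧ ℓ v = ℓ' v} := by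
  rw [_root_.convexHull_eq] at hx
  obtain ⟨ι, t, w, z, hw0, hw1, hz, hzx⟩ := hx
  rw [Finset.centerMass_eq_of_sum_1 _ _ hw1] at hzx
  have h0 : ∑ i ∈ t, w i * (ℓ' (z i) - ℓ (z i)) = 0 := by
    simp only [mul_sub, Finset.sum_sub_distrib]
    rw [← affine_sum ℓ' t w z hw1, ← affine_sum ℓ t w z hw1, hzx, hxe, sub_self]
  rw [Finset.sum_eq_zero_iff_of_nonneg
    (fun i hi => mul_nonneg (hw0 i hi) (sub_nonneg.2 (h _ (hz i hi))))] at h0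
  have hx' : x = (t.filter fun i => w i ≠ 0).centerMass w z := by
    rw [Finset.centerMass_filter_ne_zero, Finset.centerMass_eq_of_sum_1 _ _ hw1, hzx]
  rw [hx']
  refine Finset.centerMass_mem_convexHull _ (fun i hi => hw0 i (Finset.mem_filter.1 hi).1) ?_ ?_
  · rw [Finset.sum_filter_ne_zero, hw1]; exact one_pos
  · intro i hi
    obtain ⟨hi, hne⟩ := Finset.mem_filter.1 hi
    refine ⟨hz i hi, ?_⟩
    rcases mul_eq_zero.1 (h0 i hi) with h1 | h1
    · exact absurd h1 hne
    · linarith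

variable [FiniteDimensional ℝ E]

/-- A nonempty convex set has a relatively interior point: from it, one can move a little in
every direction of the affine hull. -/
lemma exists_relint {C : Set E} (hC : Convex ℝ C) (hne : C.Nonempty) :
    ∃ x ∈ C, ∀ h ∈ vectorSpan ℝ C, ∃ ε > 0, ∀ s : ℝ, |s| ≤ ε → x + s • h ∈ C := by
  classical
  obtain ⟨t, htC, hspan, hind⟩ := exists_affineIndependent ℝ E C
  have hfin : t.Finite := finite_set_of_fin_dim_affineIndependent ℝ hind
  obtain ⟨T, rfl⟩ := hfin.exists_finset_coe
  have hTne : T.Nonempty := by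
    rw [← Finset.coe_nonempty, ← affineSpan_nonempty ℝ, hspan, affineSpan_nonempty]
    exact hne
  have hn : (0 : ℝ) < T.card := by exact_mod_cast hTne.card_pos
  set x : E := ∑ u ∈ T, (1 / (T.card : ℝ)) • u with hx
  have hxC : x ∈ C := by
    refine hC.sum_mem (fun _ _ => by positivity) ?_ (fun u hu => htC hu)
    simp [hn.ne']
  let K : Submodule ℝ E :=
    { carrier := {h | ∃ ε > 0, ∀ s : ℝ, |s| ≤ ε → x + s • h ∈ C}
      zero_mem' := ⟨1, one_pos, fun s _ => by simpa using hxC⟩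
      add_mem' := by
        rintro h k ⟨ε, hε, hh⟩ ⟨η, hη, hk⟩
        refine ⟨min ε η / 2, by positivity, fun s hs => ?_⟩
        have h2 : |2 * s| ≤ min ε η := by rw [abs_mul, abs_two]; linarith
        have := hC (hh (2 * s) (h2.trans (min_le_left _ _)))
          (hk (2 * s) (h2.trans (min_le_right _ _))) (a := 1 / 2) (b := 1 / 2) (by norm_num)
          (by norm_num) (by norm_num)
        convert this using 1
        module
      smul_mem' := by
        rintro c h ⟨ε, hε, hh⟩
        refine ⟨ε / (|c| + 1), by positivity, fun s hs => ?_⟩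
        rw [smul_smul]
        refine hh _ ?_
        rw [abs_mul]
        calc |s| * |c| ≤ ε / (|c| + 1) * (|c| + 1) := by gcongr; linarith
          _ = ε := by field_simp }
  refine ⟨x, hxC, ?_⟩
  have hK : vectorSpan ℝ C ≤ K := by
    obtain ⟨p, hp⟩ := hTne
    rw [← direction_affineSpan, ← hspan, direction_affineSpan,
      vectorSpan_eq_span_vsub_set_right ℝ (Finset.mem_coe.2 hp), Submodule.span_le]
    rintro _ ⟨v, hv, rfl⟩
    refine ⟨1 / T.card, by positivity, fun s hs => ?_⟩
    have e : x + s • (v -ᵥ p) = ∑ u ∈ T,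
        (1 / (T.card : ℝ) + ((if u = v then s else 0) - (if u = p then s else 0))) • u := by
      simp only [add_smul, sub_smul, Finset.sum_add_distrib, Finset.sum_sub_distrib, ite_smul,
        zero_smul, Finset.sum_ite_eq', hp, Finset.mem_coe.1 hv, if_true, vsub_eq_sub, smul_sub, hx]
    simp only []
    rw [e]
    refine hC.sum_mem (fun u _ => ?_) ?_ (fun u hu => htC hu)
    · have := abs_le.1 hs
      split_ifs <;> first | (simp; done) | linarith
    · simp [Finset.sum_add_distrib, hp, Finset.mem_coe.1 hv, hn.ne']
  exact fun h hh => hK hh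

end Affine

section Interpolation

variable {d : ℕ}

lemma affineSpan_eq_top_of_card {V : Finset (Fin d → ℝ)} (hc : V.card = d + 1)
    (hV : AffineIndependent ℝ (fun v : V => (v : Fin d → ℝ))) :
    affineSpan ℝ (V : Set (Fin d → ℝ)) = ⊤ := by
  have := hV.affineSpan_eq_top_iff_card_eq_finrank_add_one
  simp only [Fintype.card_coe, Module.finrank_fin_fun] at this
  have h2 := this.2 hc
  simpa using h2

/-- Affine interpolation on `d + 1` affinely independent points. -/
lemma exists_affine_interpolation {V : Finset (Fin d → ℝ)} (hc : V.card = d + 1)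
    (hV : AffineIndependent ℝ (fun v : V => (v : Fin d → ℝ))) (g : (Fin d → ℝ) → ℝ) :
    ∃ ℓ : (Fin d → ℝ) →ᵃ[ℝ] ℝ, ∀ v ∈ V, ℓ v = g v := by
  have htop := affineSpan_eq_top_of_card hc hV
  let b : AffineBasis V ℝ (Fin d → ℝ) := ⟨fun v => v, hV, by simpa using htop⟩
  refine ⟨∑ v : V, g v • b.coord v, fun v hv => ?_⟩
  have h1 : ∀ u : V, (g u • b.coord u) v = if u = ⟨v, hv⟩ then g v else 0 := by
    intro u
    have : b.coord u (b ⟨v, hv⟩) = if u = ⟨v, hv⟩ then (1 : ℝ) else 0 := b.coord_apply u ⟨v, hv⟩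
    change g u * b.coord u (b ⟨v, hv⟩) = _
    rw [this]
    split_ifs with h
    · subst h; simp
    · simp
  have h2 : (∑ u : V, g u • b.coord u) v = ∑ u : V, (g u • b.coord u) v := by
    have : ∀ s : Finset V, (∑ u ∈ s, g u • b.coord u) v = ∑ u ∈ s, (g u • b.coord u) v := by
      intro s
      induction s using Finset.cons_induction with
      | empty => simp
      | cons a s ha ih => rw [Finset.sum_cons, Finset.sum_cons, ← ih]; rfl
    exact this _
  rw [h2, Finset.sum_congr rfl (fun u _ => h1 u)]
  simp

lemma pairing_eq (V : Finset (Fin d → ℝ)) (w : Fin d → ℝ) (Q : Matrix (Fin d) (Fin d) ℝ) :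
    pairing (NForm V w) Q = qval Q w - ∑ v ∈ V, affineCoeff V w v * qval Q v := by
  have h : ∀ v : Fin d → ℝ, (vecMulVec v v * Q).trace = qval Q v := by
    intro v
    rw [vecMulVec_mul, trace_vecMulVec, qval, dotProduct_mulVec, dotProduct_comm]
  simp only [pairing, NForm, sub_mul, trace_sub, Finset.sum_mul, trace_sum, smul_mul, trace_smul,
    h, smul_eq_mul]

/-- `⟨N_{V,w}, Q⟩` measures by how much `Q[w]` exceeds the affine interpolation of `Q[·]`
on `V`. -/
lemma pairing_eq_sub {V : Finset (Fin d → ℝ)} (hc : V.card = d + 1)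
    (hV : AffineIndependent ℝ (fun v : V => (v : Fin d → ℝ))) {Q : Matrix (Fin d) (Fin d) ℝ}
    {ℓ : (Fin d → ℝ) →ᵃ[ℝ] ℝ} (hℓ : ∀ v ∈ V, ℓ v = qval Q v) (w : Fin d → ℝ) :
    pairing (NForm V w) Q = qval Q w - ℓ w := by
  have htop := affineSpan_eq_top_of_card hc hV
  have hex : ∃ α : (Fin d → ℝ) → ℝ, ∑ v ∈ V, α v = 1 ∧ ∑ v ∈ V, α v • v = w := by
    let b : AffineBasis V ℝ (Fin d → ℝ) := ⟨fun v => v, hV, by simpa using htop⟩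
    classical
    refine ⟨fun v => if hv : v ∈ V then b.coord ⟨v, hv⟩ w else 0, ?_, ?_⟩
    · rw [← Finset.sum_coe_sort V, ← b.sum_coord_apply_eq_one w]
      exact Finset.sum_congr rfl fun v _ => by simp
    · rw [← Finset.sum_coe_sort V]
      conv_rhs => rw [← b.linear_combination_coord_eq_self w]
      exact Finset.sum_congr rfl fun v _ => by simp; rfl
  have hα : affineCoeff V w = hex.choose := by
    unfold affineCoeff; rw [dif_pos hex]
  obtain ⟨h1, h2⟩ := hex.choose_spec
  rw [pairing_eq, hα]
  conv_rhs => rw [← h2]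
  rw [affine_sum _ _ _ _ h1, h2]
  congr 1
  exact Finset.sum_congr rfl fun v hv => by rw [hℓ v hv]

end Interpolation

/-! ### Polyhedra, faces and dimension -/

section Dimension

variable {E : Type*} [AddCommGroup E] [Module ℝ E]

/-- An affine function that is constant on `S` is constant along the directions of `S`. -/
lemma linear_eq_zero_of_mem_vectorSpan {S : Set E} {a : E →ᵃ[ℝ] ℝ} {m : ℝ}
    (ha : ∀ x ∈ S, a x = m) {h : E} (hh : h ∈ vectorSpan ℝ S) : a.linear h = 0 := by
  have : vectorSpan ℝ S ≤ LinearMap.ker a.linear := by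
    rw [vectorSpan, Submodule.span_le]
    rintro _ ⟨x, hx, y, hy, rfl⟩
    have h1 := affine_add_apply a y (x - y)
    rw [add_sub_cancel, ha x hx, ha y hy] at h1
    change a.linear (x - y) = 0
    linarith
  exact this hh

variable [FiniteDimensional ℝ E]

lemma dim_mono {S S' : Set E} (h : S ⊆ S') : dim S ≤ dim S' :=
  Submodule.finrank_mono (vectorSpan_mono ℝ h)

lemma vectorSpan_eq_of_dim_le {S S' : Set E} (h : S ⊆ S') (hd : dim S' ≤ dim S) :
    vectorSpan ℝ S = vectorSpan ℝ S' :=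
  Submodule.eq_of_le_of_finrank_le (vectorSpan_mono ℝ h) hd

lemma dim_lt_of_affine {S S' : Set E} (h : S ⊆ S') (hne : S.Nonempty) {a : E →ᵃ[ℝ] ℝ}
    (ha : ∀ x ∈ S, a x = 0) {p : E} (hp : p ∈ S') (hap : a p ≠ 0) : dim S < dim S' := by
  refine Submodule.finrank_lt_finrank_of_lt (lt_of_le_of_ne (vectorSpan_mono ℝ h) ?_)
  intro heq
  obtain ⟨s, hs⟩ := hne
  have h1 : p - s ∈ vectorSpan ℝ S := by
    rw [heq]; exact vsub_mem_vectorSpan ℝ hp (h hs)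
  have h2 := linear_eq_zero_of_mem_vectorSpan ha h1
  have h3 := affine_add_apply a s (p - s)
  rw [add_sub_cancel, ha s hs, h2] at h3
  exact hap (by linarith)

end Dimension

section Faces

variable {E : Type*} [AddCommGroup E] [Module ℝ E] [TopologicalSpace E]

lemma IsPolyhedron.isClosed {P : Set E} (hP : IsPolyhedron P) : IsClosed P := by
  obtain ⟨n, f, b, rfl⟩ := hP
  simp only [ofPred_forall]
  exact isClosed_iInter fun i => isClosed_le (f i).continuous continuous_const

lemma IsPolyhedron.convex {P : Set E} (hP : IsPolyhedron P) : Convex ℝ P := by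
  obtain ⟨n, f, b, rfl⟩ := hP
  simp only [ofPred_forall]
  exact convex_iInter fun i => convex_halfSpace_le (f i).isLinear _

/-- A face containing a relatively interior point of `P` is `P`. -/
lemma eq_of_isExposed_of_relint {P F : Set E} (hF : IsExposed ℝ P F) {x : E} (hx : x ∈ P)
    (hrel : ∀ h ∈ vectorSpan ℝ P, ∃ ε > 0, ∀ s : ℝ, |s| ≤ ε → x + s • h ∈ P) (hxF : x ∈ F) :
    F = P := by
  obtain ⟨l, rfl⟩ := hF ⟨x, hxF⟩
  refine Subset.antisymm (fun x hx => hx.1) fun y hy => ⟨hy, fun z hz => ?_⟩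
  obtain ⟨ε, hε, h⟩ := hrel (x - y) (vsub_mem_vectorSpan ℝ hx hy)
  have h1 := hxF.2 _ (h ε (abs_of_pos hε).le)
  rw [map_add, map_smul, map_sub, smul_eq_mul] at h1
  have h2 : l x ≤ l y := by nlinarith
  exact (hxF.2 z hz).trans h2

/-- A face containing an interior point of `P` is `P`. -/
lemma eq_of_isExposed_of_interior [IsTopologicalAddGroup E] [ContinuousSMul ℝ E]
    {P F : Set E} (hF : IsExposed ℝ P F) {x : E} (hx : x ∈ interior P) (hxF : x ∈ F) :
    F = P := by
  refine eq_of_isExposed_of_relint hF (interior_subset hx) (fun h _ => ?_) hxF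
  have hc : Continuous fun s : ℝ => x + s • h := by fun_prop
  have h0 : (fun s : ℝ => x + s • h) ⁻¹' P ∈ 𝓝 (0 : ℝ) :=
    hc.continuousAt (by simpa using mem_interior_iff_mem_nhds.1 hx)
  obtain ⟨ε, hε, hsub⟩ := Metric.mem_nhds_iff.1 h0
  refine ⟨ε / 2, by positivity, fun s hs => hsub ?_⟩
  rw [Metric.mem_ball, Real.dist_eq, sub_zero]; linarith

variable [FiniteDimensional ℝ E]

/-- A face of the same dimension as `P` is `P`. -/
lemma eq_of_isExposed_of_dim_le {P F : Set E} (hF : IsExposed ℝ P F) (hne : F.Nonempty)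
    (hd : dim P ≤ dim F) : F = P := by
  obtain ⟨l, rfl⟩ := hF hne
  refine Subset.antisymm (fun x hx => hx.1) fun x hx => ⟨hx, fun y hy => ?_⟩
  obtain ⟨f, hf⟩ := hne
  have hspan := vectorSpan_eq_of_dim_le (S := {x | x ∈ P ∧ ∀ y ∈ P, l y ≤ l x}) (S' := P)
    (fun x hx => hx.1) hd
  have h1 : x - f ∈ vectorSpan ℝ {x | x ∈ P ∧ ∀ y ∈ P, l y ≤ l x} := by
    rw [hspan]; exact vsub_mem_vectorSpan ℝ hx hf.1
  have h2 := linear_eq_zero_of_mem_vectorSpan (a := l.toLinearMap.toAffineMap) (m := l f)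
    (fun z hz => le_antisymm (hf.2 z hz.1) (hz.2 f hf.1)) h1
  have h3 : l x = l f := by
    have : l (x - f) = 0 := h2
    rw [map_sub] at this; linarith
  rw [h3]; exact hf.2 y hy

end Faces

section Top

variable {d : ℕ}

lemma dim_le (S : Set (Fin d → ℝ)) : dim S ≤ d := by
  have := Submodule.finrank_le (vectorSpan ℝ S)
  simpa [dim] using this

lemma vectorSpan_eq_top_of_dim {S : Set (Fin d → ℝ)} (h : dim S = d) : vectorSpan ℝ S = ⊤ :=
  Submodule.eq_top_of_finrank_eq (by simpa [dim] using h)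

lemma affineSpan_eq_top_of_dim {S : Set (Fin d → ℝ)} (hne : S.Nonempty) (h : dim S = d) :
    affineSpan ℝ S = ⊤ := by
  rw [AffineSubspace.affineSpan_eq_top_iff_vectorSpan_eq_top_of_nonempty _ _ _ hne]
  exact vectorSpan_eq_top_of_dim h

lemma interior_nonempty_of_dim {S : Set (Fin d → ℝ)} (hc : Convex ℝ S) (hne : S.Nonempty)
    (h : dim S = d) : (interior S).Nonempty :=
  hc.interior_nonempty_iff_affineSpan_eq_top.2 (affineSpan_eq_top_of_dim hne h)

lemma affineSpan_ne_top_of_dim_lt {S : Set (Fin d → ℝ)} (h : dim S < d) :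
    affineSpan ℝ S ≠ ⊤ := by
  intro htop
  have : vectorSpan ℝ S = ⊤ := by
    rw [← direction_affineSpan, htop, AffineSubspace.direction_top]
  rw [dim, this] at h
  simp at h

lemma dim_eq_of_interior {S : Set (Fin d → ℝ)} (h : (interior S).Nonempty) : dim S = d := by
  by_contra hne
  have hlt : dim S < d := lt_of_le_of_ne (dim_le S) hne
  refine affineSpan_ne_top_of_dim_lt hlt ?_
  exact top_le_iff.1 ((isOpen_interior.affineSpan_eq_top h).ge.trans
    (affineSpan_mono ℝ interior_subset))

/-- An open set is not covered by countably many proper affine subspaces. -/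
lemma exists_notMem_affineSubspaces {ι : Type*} [Countable ι]
    (A : ι → AffineSubspace ℝ (Fin d → ℝ)) (hA : ∀ i, A i ≠ ⊤) {U : Set (Fin d → ℝ)}
    (hU : (interior U).Nonempty) : ∃ y ∈ U, ∀ i, y ∉ A i := by
  by_contra! hcon
  have h1 : MeasureTheory.volume U = 0 := by
    refine MeasureTheory.measure_mono_null (t := ⋃ i, (A i : Set (Fin d → ℝ))) ?_ ?_
    · intro y hy
      obtain ⟨i, hi⟩ := hcon y hy
      exact mem_iUnion.2 ⟨i, hi⟩
    · rw [MeasureTheory.measure_iUnion_null_iff]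
      exact fun i => MeasureTheory.Measure.addHaar_affineSubspace _ _ (hA i)
  have h2 := (isOpen_interior.measure_pos MeasureTheory.volume hU).trans_le
    (MeasureTheory.measure_mono interior_subset)
  exact h2.ne' h1

end Top

/-! ### Locally finite polyhedral subdivisions -/

section Subdivision

variable {d : ℕ} {𝒟 : Set (Set (Fin d → ℝ))}

lemma exists_mem_cell (h𝒟 : IsPolyhedralSubdivision univ 𝒟) (x : Fin d → ℝ) :
    ∃ P ∈ 𝒟, x ∈ P := by
  have : x ∈ ⋃₀ 𝒟 := by rw [h𝒟.sUnion_eq]; trivial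
  exact this

/-- Near `x` there are only cells through `x`. -/
lemma exists_nhds_forall_cell (h𝒟 : IsPolyhedralSubdivision univ 𝒟)
    (hlf : LocallyFinite (fun P : 𝒟 => (P : Set (Fin d → ℝ)))) (x : Fin d → ℝ) :
    ∃ U ∈ 𝓝 x, ∀ P ∈ 𝒟, ∀ y ∈ U, y ∈ P → x ∈ P := by
  refine ⟨_, hlf.iInter_compl_mem_nhds (fun P => (h𝒟.isPolyhedron P P.2).isClosed) x, ?_⟩
  intro P hP y hy hyP
  by_contra hx
  exact (mem_iInter₂.1 hy ⟨P, hP⟩ hx) hyP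

/-- The full-dimensional cells cover the space. -/
lemma exists_top_cell (h𝒟 : IsPolyhedralSubdivision univ 𝒟)
    (hlf : LocallyFinite (fun P : 𝒟 => (P : Set (Fin d → ℝ)))) (x : Fin d → ℝ) :
    ∃ P ∈ 𝒟, dim P = d ∧ x ∈ P := by
  obtain ⟨U, hU, h⟩ := exists_nhds_forall_cell h𝒟 hlf x
  have hcount : Countable 𝒟 :=
    countable_univ_iff.1 (hlf.countable_univ fun P => h𝒟.nonempty P P.2)
  have hcount' : Countable {P : 𝒟 // dim (P : Set (Fin d → ℝ)) < d} := inferInstance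
  obtain ⟨y, hyU, hy⟩ := exists_notMem_affineSubspaces
    (fun P : {P : 𝒟 // dim (P : Set (Fin d → ℝ)) < d} =>
      affineSpan ℝ (P.1 : Set (Fin d → ℝ)))
    (fun P => affineSpan_ne_top_of_dim_lt P.2) ⟨x, mem_interior_iff_mem_nhds.2 hU⟩
  obtain ⟨P, hP, hyP⟩ := exists_mem_cell h𝒟 y
  refine ⟨P, hP, ?_, h P hP y hyU hyP⟩
  by_contra hne
  exact hy ⟨⟨P, hP⟩, lt_of_le_of_ne (dim_le P) hne⟩ (subset_affineSpan ℝ _ hyP)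

lemma top_cell_eq (h𝒟 : IsPolyhedralSubdivision univ 𝒟) {P R : Set (Fin d → ℝ)} (hP : P ∈ 𝒟)
    (hR : R ∈ 𝒟) (hne : (P ∩ R).Nonempty) (hd : dim (P ∩ R) = d) : P = R := by
  obtain ⟨h1, h2⟩ := h𝒟.inter_face P hP R hR hne
  rw [← eq_of_isExposed_of_dim_le h1 hne (by rw [hd]; exact dim_le P)]
  exact eq_of_isExposed_of_dim_le h2 hne (by rw [hd]; exact dim_le R)

lemma subset_of_interior_mem (h𝒟 : IsPolyhedralSubdivision univ 𝒟) {P R : Set (Fin d → ℝ)}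
    (hP : P ∈ 𝒟) (hR : R ∈ 𝒟) {x : Fin d → ℝ} (hx : x ∈ interior P) (hxR : x ∈ R) : P = R := by
  have hne : (P ∩ R).Nonempty := ⟨x, interior_subset hx, hxR⟩
  obtain ⟨h1, h2⟩ := h𝒟.inter_face P hP R hR hne
  have h3 := eq_of_isExposed_of_interior h1 hx ⟨interior_subset hx, hxR⟩
  refine top_cell_eq h𝒟 hP hR hne ?_
  rw [h3]; exact dim_eq_of_interior ⟨x, hx⟩

/-- Segments in general position towards a given point `y` avoid all cells of codimension at
least two, except possibly at `y`. -/
lemma exists_generic_segment (h𝒟 : IsPolyhedralSubdivision univ 𝒟)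
    (hlf : LocallyFinite (fun P : 𝒟 => (P : Set (Fin d → ℝ)))) {P : Set (Fin d → ℝ)}
    (hP : P ∈ 𝒟) (hPd : dim P = d) (y : Fin d → ℝ) :
    ∃ x ∈ interior P, ∀ t : ℝ, t < 1 → ∀ G ∈ 𝒟, x + t • (y - x) ∈ G → d ≤ dim G + 1 := by
  have hcount : Countable 𝒟 :=
    countable_univ_iff.1 (hlf.countable_univ fun P => h𝒟.nonempty P P.2)
  have hcount' : Countable {P : 𝒟 // dim (P : Set (Fin d → ℝ)) + 1 < d} := inferInstance
  obtain ⟨x, hx, hxA⟩ := exists_notMem_affineSubspaces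
    (fun G : {P : 𝒟 // dim (P : Set (Fin d → ℝ)) + 1 < d} =>
      affineSpan ℝ (insert y (G.1 : Set (Fin d → ℝ))))
    (fun G => affineSpan_ne_top_of_dim_lt
      (lt_of_le_of_lt (finrank_vectorSpan_insert_le_set ℝ _ _) G.2))
    (U := interior P) (by
      rw [interior_interior]
      exact interior_nonempty_of_dim (h𝒟.isPolyhedron P hP).convex (h𝒟.nonempty P hP) hPd)
  refine ⟨x, hx, fun t ht G hG hxG => ?_⟩
  by_contra! hlt
  refine hxA ⟨⟨G, hG⟩, hlt⟩ ?_
  have h1 : AffineMap.lineMap y (x + t • (y - x)) (1 / (1 - t)) ∈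
      affineSpan ℝ (insert y G) :=
    AffineMap.lineMap_mem _ (subset_affineSpan ℝ _ (mem_insert _ _))
      (subset_affineSpan ℝ _ (mem_insert_of_mem _ hxG))
  convert h1 using 1
  rw [AffineMap.lineMap_apply, vsub_eq_sub, vadd_eq_add]
  have h2 : (1 - t) ≠ 0 := by linarith
  have h3 : x + t • (y - x) - y = (1 - t) • (x - y) := by module
  rw [h3, smul_smul, one_div, inv_mul_cancel₀ h2]
  simp

lemma dim_inter_add_one (h𝒟 : IsPolyhedralSubdivision univ 𝒟) {R R' : Set (Fin d → ℝ)}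
    (hR : R ∈ 𝒟) (hR' : R' ∈ 𝒟) (hne : R ≠ R') {x : Fin d → ℝ} (hx : x ∈ R) (hx' : x ∈ R')
    (hgen : ∀ G ∈ 𝒟, x ∈ G → d ≤ dim G + 1) : dim (R ∩ R') + 1 = d := by
  have hn : (R ∩ R').Nonempty := ⟨x, hx, hx'⟩
  have h1 := hgen _ (h𝒟.face_mem R hR _ hn (h𝒟.inter_face R hR R' hR' hn).1) ⟨hx, hx'⟩
  have h2 := dim_le (R ∩ R')
  have h3 : dim (R ∩ R') ≠ d := fun h => hne (top_cell_eq h𝒟 hR hR' hn h)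
  omega

/-- Local convexity implies global convexity: if a family of affine functions, one for each
full-dimensional cell, is such that across each facet the function of the cell on either side
dominates the other one there, then the function of every cell dominates all others on that
cell. -/
theorem affine_le_of_local (h𝒟 : IsPolyhedralSubdivision univ 𝒟)
    (hlf : LocallyFinite (fun P : 𝒟 => (P : Set (Fin d → ℝ))))
    (ℓ : Set (Fin d → ℝ) → ((Fin d → ℝ) →ᵃ[ℝ] ℝ))
    (hadj : ∀ R ∈ 𝒟, ∀ R' ∈ 𝒟, dim R = d → dim R' = d → (R ∩ R').Nonempty →
      dim (R ∩ R') + 1 = d → ∀ x ∈ R', ℓ R x ≤ ℓ R' x)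
    {P P' : Set (Fin d → ℝ)} (hP : P ∈ 𝒟) (hPd : dim P = d) (hP' : P' ∈ 𝒟) (hPd' : dim P' = d)
    {y : Fin d → ℝ} (hy : y ∈ P') : ℓ P y ≤ ℓ P' y := by
  -- By density it suffices to treat interior points `y` of `P'`.
  suffices hint : ∀ y ∈ interior P', ℓ P y ≤ ℓ P' y by
    have hcl : IsClosed {y | ℓ P y ≤ ℓ P' y} :=
      isClosed_le (ℓ P).continuous_of_finiteDimensional (ℓ P').continuous_of_finiteDimensional
    have hc := (h𝒟.isPolyhedron P' hP').convex
    have := closure_minimal hint hcl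
    rw [hc.closure_interior_eq_closure_of_nonempty_interior
      (interior_nonempty_of_dim hc (h𝒟.nonempty P' hP') hPd')] at this
    exact this (subset_closure hy)
  clear hy y
  intro y hy
  by_contra! hlt
  obtain ⟨x, hx, hgen⟩ := exists_generic_segment h𝒟 hlf hP hPd y
  set γ : ℝ → (Fin d → ℝ) := fun t => x + t • (y - x) with hγ
  have hγc : Continuous γ := by fun_prop
  have hγ0 : γ 0 = x := by simp [hγ]
  have hγ1 : γ 1 = y := by simp [hγ]
  choose C hC hCd hCm using fun t => exists_top_cell h𝒟 hlf (γ t)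
  have hcomp : ∀ t ≤ 1, ∀ R ∈ 𝒟, ∀ R' ∈ 𝒟, dim R = d → dim R' = d → γ t ∈ R → γ t ∈ R' →
      ∀ z ∈ R', ℓ R z ≤ ℓ R' z := by
    intro t ht R hR R' hR' hRd hRd' h1 h2 z hz
    rcases eq_or_ne R R' with rfl | hne
    · exact le_rfl
    rcases ht.lt_or_eq with ht | rfl
    · exact hadj R hR R' hR' hRd hRd' ⟨_, h1, h2⟩
        (dim_inter_add_one h𝒟 hR hR' hne h1 h2 (hgen t ht)) z hz
    · rw [hγ1] at h1 h2
      exact absurd ((subset_of_interior_mem h𝒟 hP' hR hy h1).symm.trans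
        (subset_of_interior_mem h𝒟 hP' hR' hy h2)) hne
  have hval : ∀ t ≤ 1, ∀ R ∈ 𝒟, dim R = d → γ t ∈ R → ℓ (C t) (γ t) = ℓ R (γ t) := by
    intro t ht R hR hRd h1
    exact le_antisymm (hcomp t ht _ (hC t) R hR (hCd t) hRd (hCm t) h1 _ h1)
      (hcomp t ht R hR _ (hC t) hRd (hCd t) h1 (hCm t) _ (hCm t))
  set s := ℓ P y - ℓ P' y with hs
  have hs0 : 0 < s := by rw [hs]; linarith
  -- The piecewise affine function along the segment, normalized to vanish at both ends.
  set k : ℝ → ℝ := fun t => ℓ (C t) (γ t) - ℓ P (γ t) + s * t with hk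
  have hcontA : ∀ R : Set (Fin d → ℝ), Continuous fun t => ℓ R (γ t) - ℓ P (γ t) + s * t :=
    fun R => (((ℓ R).continuous_of_finiteDimensional.comp hγc).sub
      ((ℓ P).continuous_of_finiteDimensional.comp hγc)).add (by fun_prop)
  have hkc : ContinuousOn k (Icc 0 1) := by
    let f : {R : 𝒟 // dim (R : Set (Fin d → ℝ)) = d} → Set ℝ :=
      fun R => γ ⁻¹' (R.1 : Set (Fin d → ℝ)) ∩ Icc 0 1
    have hflf : LocallyFinite f := by
      have h1 := (hlf.comp_injective (g := fun R : {R : 𝒟 // dim (R : Set (Fin d → ℝ)) = d} => R.1)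
        Subtype.val_injective).preimage_continuous hγc
      exact h1.subset fun R => inter_subset_left
    have hcov : Icc (0 : ℝ) 1 ⊆ ⋃ R, f R := fun t ht =>
      mem_iUnion.2 ⟨⟨⟨C t, hC t⟩, hCd t⟩, hCm t, ht⟩
    refine (hflf.continuousOn_iUnion (fun R => ?_) fun R => ?_).mono hcov
    · exact ((h𝒟.isPolyhedron R.1 R.1.2).isClosed.preimage hγc).inter isClosed_Icc
    · refine (hcontA R.1).continuousOn.congr fun t ht => ?_
      simp only [hk]
      rw [hval t ht.2.2 R.1 R.1.2 R.2 ht.1]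
  obtain ⟨tm, htm, hmax⟩ := isCompact_Icc.exists_isMaxOn ⟨0, by simp⟩ hkc
  have hclosed : IsClosed (Icc (0 : ℝ) 1 ∩ k ⁻¹' {k tm}) :=
    hkc.preimage_isClosed_of_isClosed isClosed_Icc isClosed_singleton
  have hcpt : IsCompact (Icc (0 : ℝ) 1 ∩ k ⁻¹' {k tm}) :=
    isCompact_Icc.of_isClosed_subset hclosed inter_subset_left
  obtain ⟨t0, ⟨ht0, hkt0⟩, hleast⟩ := hcpt.exists_isLeast ⟨tm, htm, rfl⟩
  have hkt0' : k t0 = k tm := hkt0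
  have hk0 : k 0 = 0 := by
    simp only [hk]
    rw [hval 0 zero_le_one P hP hPd (by rw [hγ0]; exact interior_subset hx)]; ring
  have hk1 : k 1 = 0 := by
    simp only [hk]
    rw [hval 1 le_rfl P' hP' hPd' (by rw [hγ1]; exact interior_subset hy), hγ1, hs]; ring
  have hkpos : 0 < k tm := by
    have h0 : γ ⁻¹' P ∈ 𝓝 (0 : ℝ) :=
      hγc.continuousAt (by rw [hγ0]; exact mem_interior_iff_mem_nhds.1 hx)
    obtain ⟨ε, hε, hsub⟩ := Metric.mem_nhds_iff.1 h0
    have hr : 0 < min (ε / 2) 1 := by positivity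
    have hr1 : min (ε / 2) 1 ≤ 1 := min_le_right _ _
    have h1 : γ (min (ε / 2) 1) ∈ P := hsub (by
      rw [Metric.mem_ball, Real.dist_eq, sub_zero, abs_of_pos hr]
      exact (min_le_left _ _).trans_lt (by linarith))
    have h2 : k (min (ε / 2) 1) ≤ k tm := hmax ⟨hr.le, hr1⟩
    refine lt_of_lt_of_le ?_ h2
    simp only [hk]
    rw [hval _ hr1 P hP hPd h1, sub_self, zero_add]
    positivity
  have ht0pos : 0 < t0 := lt_of_le_of_ne ht0.1 fun h => by
    rw [← h, hk0] at hkt0'; linarith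
  have ht0lt : t0 < 1 := lt_of_le_of_ne ht0.2 fun h => by
    rw [h, hk1] at hkt0'; linarith
  -- Near the first maximum, `k` is bounded below by an affine function touching it.
  obtain ⟨U, hU, hUc⟩ := exists_nhds_forall_cell h𝒟 hlf (γ t0)
  obtain ⟨ε, hε, hsub⟩ := Metric.mem_nhds_iff.1 (hγc.continuousAt (x := t0) hU)
  have hlow : ∀ t ∈ Icc (0 : ℝ) 1, |t - t0| < ε →
      ℓ (C t0) (γ t) - ℓ P (γ t) + s * t ≤ k t := by
    intro t ht htt
    have h1 : γ t0 ∈ C t := hUc _ (hC t) (γ t) (hsub (by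
      rw [Metric.mem_ball, Real.dist_eq]; exact htt)) (hCm t)
    have := hcomp t0 ht0.2 _ (hC t0) _ (hC t) (hCd t0) (hCd t) (hCm t0) h1 _ (hCm t)
    simp only [hk]; linarith
  set δ := min (ε / 2) (min t0 (1 - t0)) with hδ
  have hδ0 : 0 < δ := by
    have : 0 < 1 - t0 := by linarith
    positivity
  have hδ1 : δ ≤ t0 := (min_le_right _ _).trans (min_le_left _ _)
  have hδ2 : δ ≤ 1 - t0 := (min_le_right _ _).trans (min_le_right _ _)
  have hδ3 : δ < ε := (min_le_left _ _).trans_lt (by linarith)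
  have hI1 : t0 + δ ∈ Icc (0 : ℝ) 1 := ⟨by linarith, by linarith⟩
  have hI2 : t0 - δ ∈ Icc (0 : ℝ) 1 := ⟨by linarith, by linarith⟩
  have h1 := hlow (t0 + δ) hI1 (by rw [add_sub_cancel_left, abs_of_pos hδ0]; exact hδ3)
  have h2 := hlow (t0 - δ) hI2 (by
    rw [sub_sub_cancel_left, abs_neg, abs_of_pos hδ0]; exact hδ3)
  have h3 : k (t0 + δ) ≤ k tm := hmax hI1
  have h4 : k (t0 - δ) < k tm := lt_of_le_of_ne (hmax hI2) fun h => by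
    have := hleast ⟨hI2, h⟩
    linarith
  have h5 : k t0 = ℓ (C t0) (γ t0) - ℓ P (γ t0) + s * t0 := rfl
  have hlin : ∀ R : Set (Fin d → ℝ), ∀ t, ℓ R (γ t) = (1 - t) * ℓ R x + t * ℓ R y :=
    fun R t => affine_smul_add_smul _ _ _ _
  simp only [hlin] at h1 h2 h5
  nlinarith

/-- The strict version of `affine_le_of_local`. -/
theorem affine_lt_of_local (h𝒟 : IsPolyhedralSubdivision univ 𝒟)
    (hlf : LocallyFinite (fun P : 𝒟 => (P : Set (Fin d → ℝ))))
    (ℓ : Set (Fin d → ℝ) → ((Fin d → ℝ) →ᵃ[ℝ] ℝ))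
    (hadj : ∀ R ∈ 𝒟, ∀ R' ∈ 𝒟, dim R = d → dim R' = d → (R ∩ R').Nonempty →
      dim (R ∩ R') + 1 = d → ∀ x ∈ R', ℓ R x ≤ ℓ R' x)
    (hstrict : ∀ R ∈ 𝒟, ∀ R' ∈ 𝒟, dim R = d → dim R' = d → (R ∩ R').Nonempty →
      dim (R ∩ R') + 1 = d → ∀ x ∈ R', x ∉ R → ℓ R x < ℓ R' x)
    {P P' : Set (Fin d → ℝ)} (hP : P ∈ 𝒟) (hPd : dim P = d) (hP' : P' ∈ 𝒟) (hPd' : dim P' = d)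
    {y : Fin d → ℝ} (hy : y ∈ P') (hyP : y ∉ P) : ℓ P y < ℓ P' y := by
  obtain ⟨x, hx, hgen⟩ := exists_generic_segment h𝒟 hlf hP hPd y
  set γ : ℝ → (Fin d → ℝ) := fun t => x + t • (y - x) with hγ
  have hγc : Continuous γ := by fun_prop
  have hγ0 : γ 0 = x := by simp [hγ]
  have hγ1 : γ 1 = y := by simp [hγ]
  -- The point at which the segment leaves `P`.
  have hcpt : IsCompact (Icc (0 : ℝ) 1 ∩ γ ⁻¹' P) := isCompact_Icc.inter_right
    ((h𝒟.isPolyhedron P hP).isClosed.preimage hγc)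
  obtain ⟨t0, ⟨ht0, hγt0⟩, hgr⟩ := hcpt.exists_isGreatest
    ⟨0, by simp, by rw [mem_preimage, hγ0]; exact interior_subset hx⟩
  have ht0lt : t0 < 1 := lt_of_le_of_ne ht0.2 fun h => hyP (by
    rw [← hγ1, ← h]; exact hγt0)
  obtain ⟨U, hU, hUc⟩ := exists_nhds_forall_cell h𝒟 hlf (γ t0)
  obtain ⟨ε, hε, hsub⟩ := Metric.mem_nhds_iff.1 (hγc.continuousAt (x := t0) hU)
  set δ := min (ε / 2) ((1 - t0) / 2) with hδ
  have hδ0 : 0 < δ := by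
    have : 0 < 1 - t0 := by linarith
    positivity
  have hδ2 : δ ≤ (1 - t0) / 2 := min_le_right _ _
  have hδ3 : δ < ε := (min_le_left _ _).trans_lt (by linarith)
  obtain ⟨R, hR, hRd, hRm⟩ := exists_top_cell h𝒟 hlf (γ (t0 + δ))
  have hRt0 : γ t0 ∈ R := hUc R hR _ (hsub (by
    rw [Metric.mem_ball, Real.dist_eq, add_sub_cancel_left, abs_of_pos hδ0]; exact hδ3)) hRm
  have hnP : γ (t0 + δ) ∉ P := fun h => by
    have := hgr ⟨⟨by linarith [ht0.1], by linarith⟩, h⟩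
    linarith
  have hne : P ≠ R := fun h => hnP (h ▸ hRm)
  have hdim := dim_inter_add_one h𝒟 hP hR hne hγt0 hRt0 (hgen t0 ht0lt)
  have h1 := hstrict P hP R hR hPd hRd ⟨_, hγt0, hRt0⟩ hdim _ hRm hnP
  have h2 := affine_le_of_local h𝒟 hlf ℓ hadj hR hRd hP hPd (interior_subset hx)
  have h3 := affine_le_of_local h𝒟 hlf ℓ hadj hR hRd hP' hPd' hy
  have hlin : ∀ R : Set (Fin d → ℝ), ∀ t, ℓ R (γ t) = (1 - t) * ℓ R x + t * ℓ R y :=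
    fun R t => affine_smul_add_smul _ _ _ _
  rw [hlin, hlin] at h1
  have hT0 : 0 < t0 + δ := by linarith [ht0.1]
  have hT1 : 0 < 1 - (t0 + δ) := by linarith
  refine lt_of_lt_of_le ?_ h3
  by_contra! hcon
  nlinarith [mul_le_mul_of_nonneg_left hcon hT0.le, mul_le_mul_of_nonneg_left h2 hT1.le]

end Subdivision

/-! ### Facets and the two cells adjacent to them -/

section Facets

variable {d : ℕ} {𝒟 : Set (Set (Fin d → ℝ))}

lemma subset_of_relint_mem (h𝒟 : IsPolyhedralSubdivision univ 𝒟) {F R : Set (Fin d → ℝ)}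
    (hF : F ∈ 𝒟) (hR : R ∈ 𝒟) {x : Fin d → ℝ} (hx : x ∈ F)
    (hrel : ∀ h ∈ vectorSpan ℝ F, ∃ ε > 0, ∀ s : ℝ, |s| ≤ ε → x + s • h ∈ F) (hxR : x ∈ R) :
    F ⊆ R := by
  have h1 := (h𝒟.inter_face F hF R hR ⟨x, hx, hxR⟩).1
  have h2 := eq_of_isExposed_of_relint h1 hx hrel ⟨hx, hxR⟩
  rw [← h2]; exact inter_subset_right

lemma isExposed_of_subset (h𝒟 : IsPolyhedralSubdivision univ 𝒟) {F R : Set (Fin d → ℝ)}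
    (hF : F ∈ 𝒟) (hR : R ∈ 𝒟) (h : F ⊆ R) : IsExposed ℝ R F := by
  have hne : (R ∩ F).Nonempty := by
    rw [inter_eq_right.2 h]; exact h𝒟.nonempty F hF
  have := (h𝒟.inter_face R hR F hF hne).1
  rwa [inter_eq_right.2 h] at this

/-- The directions of a facet form the kernel of every nonconstant affine function that is
constant on the facet. -/
lemma ker_eq_vectorSpan {F : Set (Fin d → ℝ)} (hd : dim F + 1 = d)
    {a : (Fin d → ℝ) →ᵃ[ℝ] ℝ} {m : ℝ} (ha : ∀ x ∈ F, a x = m) (hne : a.linear ≠ 0) :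
    LinearMap.ker a.linear = vectorSpan ℝ F := by
  refine (Submodule.eq_of_le_of_finrank_le
    (fun h hh => linear_eq_zero_of_mem_vectorSpan ha hh) ?_).symm
  have h1 := LinearMap.finrank_range_add_finrank_ker a.linear
  rw [LinearMap.range_eq_top.2 (LinearMap.surjective hne)] at h1
  simp only [finrank_top, Module.finrank_self, Module.finrank_fin_fun] at h1
  unfold dim at hd
  omega

lemma linear_ne_zero {a : (Fin d → ℝ) →ᵃ[ℝ] ℝ} {x y : Fin d → ℝ} (h : a x ≠ a y) :
    a.linear ≠ 0 := by
  intro h0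
  apply h
  rw [affine_apply a x, affine_apply a y, h0]; simp

/-- A facet `F` of a full-dimensional cell `R` lies in a supporting hyperplane of `R`. -/
lemma exists_supporting (h𝒟 : IsPolyhedralSubdivision univ 𝒟) {F R : Set (Fin d → ℝ)}
    (hF : F ∈ 𝒟) (hR : R ∈ 𝒟) (h : F ⊆ R) :
    ∃ a : (Fin d → ℝ) →ᵃ[ℝ] ℝ, (∀ x ∈ F, a x = 0) ∧ (∀ x ∈ R, x ∉ F → a x < 0) := by
  have hne := h𝒟.nonempty F hF
  obtain ⟨l, hl⟩ := isExposed_of_subset h𝒟 hF hR h hne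
  obtain ⟨f, hf⟩ := hne
  have hfR : f ∈ R ∧ ∀ y ∈ R, l y ≤ l f := by rw [hl] at hf; exact hf
  refine ⟨l.toLinearMap.toAffineMap - AffineMap.const ℝ _ (l f), fun x hx => ?_,
    fun x hx hxF => ?_⟩
  · have hx' : x ∈ R ∧ ∀ y ∈ R, l y ≤ l x := by rw [hl] at hx; exact hx
    simpa [sub_eq_zero] using le_antisymm (hfR.2 x hx'.1) (hx'.2 f hfR.1)
  · have h1 : l x < l f := by
      refine lt_of_le_of_ne (hfR.2 x hx) fun he => hxF ?_
      rw [hl]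
      exact ⟨hx, fun y hy => he ▸ hfR.2 y hy⟩
    simpa using h1

lemma exists_mem_notMem {F R : Set (Fin d → ℝ)} (hFd : dim F + 1 = d) (hRd : dim R = d) :
    ∃ p ∈ R, p ∉ F := by
  by_contra! hcon
  have := dim_mono (show R ⊆ F from hcon)
  omega

/-- A nonconstant affine function vanishing on a facet `F` has constant nonzero sign on the rest
of a full-dimensional cell containing `F`. -/
lemma mul_pos_of_facet (h𝒟 : IsPolyhedralSubdivision univ 𝒟) {F R : Set (Fin d → ℝ)}
    (hF : F ∈ 𝒟) (hR : R ∈ 𝒟) (hFd : dim F + 1 = d) (h : F ⊆ R)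
    {a : (Fin d → ℝ) →ᵃ[ℝ] ℝ} (ha : ∀ x ∈ F, a x = 0) (hne : a.linear ≠ 0)
    {p q : Fin d → ℝ} (hp : p ∈ R) (hpF : p ∉ F) (hq : q ∈ R) (hqF : q ∉ F) :
    0 < a p * a q := by
  obtain ⟨b, hb, hbR⟩ := exists_supporting h𝒟 hF hR h
  obtain ⟨f, hf⟩ := h𝒟.nonempty F hF
  have hbne : b.linear ≠ 0 := linear_ne_zero (x := p) (y := f) (by
    rw [hb f hf]; exact (hbR p hp hpF).ne)
  have hval : ∀ c : (Fin d → ℝ) →ᵃ[ℝ] ℝ, (∀ x ∈ F, c x = 0) → ∀ x, c x = c.linear (x - f) := by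
    intro c hc x
    have := affine_add_apply c f (x - f)
    rw [add_sub_cancel, hc f hf] at this
    linarith
  have hker : LinearMap.ker b.linear = LinearMap.ker a.linear := by
    rw [ker_eq_vectorSpan hFd ha hne, ker_eq_vectorSpan hFd hb hbne]
  have hbp : b.linear (p - f) < 0 := by rw [← hval b hb]; exact hbR p hp hpF
  have hbq : b.linear (q - f) < 0 := by rw [← hval b hb]; exact hbR q hq hqF
  have hap : a.linear (p - f) ≠ 0 := fun h0 => by
    have : p - f ∈ LinearMap.ker b.linear := by rw [hker]; exact h0
    exact hbp.ne this
  -- `q - f` and a multiple of `p - f` differ by a direction of `F`.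
  have hcomb : (q - f) - (b.linear (q - f) / b.linear (p - f)) • (p - f) ∈
      LinearMap.ker a.linear := by
    rw [← hker, LinearMap.mem_ker, map_sub, map_smul, smul_eq_mul, div_mul_cancel₀ _ hbp.ne,
      sub_self]
  rw [LinearMap.mem_ker, map_sub, map_smul, smul_eq_mul, sub_eq_zero] at hcomb
  rw [hval a ha p, hval a ha q, hcomb]
  have h1 : 0 < b.linear (q - f) / b.linear (p - f) := div_pos_of_neg_of_neg hbq hbp
  have h2 := mul_self_pos.2 hap
  nlinarith [mul_pos h1 h2]

/-- Two full-dimensional cells with a common facet that lie on the same side of it coincide. -/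
lemma eq_of_same_side (h𝒟 : IsPolyhedralSubdivision univ 𝒟) {F R R' : Set (Fin d → ℝ)}
    (hF : F ∈ 𝒟) (hR : R ∈ 𝒟) (hR' : R' ∈ 𝒟) (hFd : dim F + 1 = d) (h : F ⊆ R) (h' : F ⊆ R')
    {a : (Fin d → ℝ) →ᵃ[ℝ] ℝ} (ha : ∀ x ∈ F, a x = 0)
    {p p' : Fin d → ℝ} (hp : p ∈ R) (hp' : p' ∈ R') (hpp : 0 < a p * a p') : R = R' := by
  obtain ⟨x, hx, hrel⟩ := exists_relint (h𝒟.isPolyhedron F hF).convex (h𝒟.nonempty F hF)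
  have hval : ∀ z, a z = a.linear (z - x) := by
    intro z
    have := affine_add_apply a x (z - x)
    rw [add_sub_cancel, ha x hx] at this
    linarith
  have hap' : a p' ≠ 0 := right_ne_zero_of_mul hpp.ne'
  have hap : a p ≠ 0 := left_ne_zero_of_mul hpp.ne'
  have hne : a.linear ≠ 0 := linear_ne_zero (x := p) (y := x) (by rw [ha x hx]; exact hap)
  set lam := a p / a p' with hlam
  have hlam0 : 0 < lam := by
    rw [hlam, show a p / a p' = (a p * a p') / (a p') ^ 2 by field_simp]
    positivity
  have hk : (p - x) - lam • (p' - x) ∈ vectorSpan ℝ F := by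
    rw [← ker_eq_vectorSpan hFd ha hne, LinearMap.mem_ker, map_sub, map_smul, smul_eq_mul,
      ← hval, ← hval, hlam, div_mul_cancel₀ _ hap', sub_self]
  obtain ⟨ε, hε, hF'⟩ := hrel _ hk
  -- A point near `x` in direction `p` lies in both cells.
  set η := min (min 1 (ε / 2)) (1 / (2 * lam)) with hη
  have hη0 : 0 < η := by positivity
  have hη1 : η ≤ 1 := (min_le_left _ _).trans (min_le_left _ _)
  have hη2 : η ≤ ε / 2 := (min_le_left _ _).trans (min_le_right _ _)
  have hη3 : η * lam ≤ 1 / 2 := by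
    calc η * lam ≤ 1 / (2 * lam) * lam := by gcongr; exact min_le_right _ _
      _ = 1 / 2 := by field_simp
  have hden : 0 < 1 - η * lam := by linarith
  have hqR : x + η • (p - x) ∈ R :=
    (h𝒟.isPolyhedron R hR).convex.add_smul_sub_mem (h hx) hp ⟨hη0.le, hη1⟩
  have hqR' : x + η • (p - x) ∈ R' := by
    have h1 : x + (η / (1 - η * lam)) • ((p - x) - lam • (p' - x)) ∈ R' := by
      refine h' (hF' _ ?_)
      rw [abs_of_pos (by positivity), div_le_iff₀ hden]
      nlinarith
    have h2 := (h𝒟.isPolyhedron R' hR').convex h1 hp' (a := 1 - η * lam) (b := η * lam)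
      hden.le (by positivity) (by ring)
    convert h2 using 1
    rw [smul_add, smul_smul, mul_div_cancel₀ _ hden.ne']
    module
  have hsub : F ⊆ R ∩ R' := subset_inter h h'
  have haq : a (x + η • (p - x)) ≠ 0 := by
    rw [affine_add_apply, ha x hx, map_smul, ← hval, smul_eq_mul, zero_add]
    exact mul_ne_zero hη0.ne' hap
  have hlt := dim_lt_of_affine hsub ⟨x, hx⟩ ha ⟨hqR, hqR'⟩ haq
  have hle := dim_le (R ∩ R')
  exact top_cell_eq h𝒟 hR hR' ⟨x, hsub hx⟩ (by omega)

/-- Two distinct full-dimensional cells with a common facet lie on different sides of it. -/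
lemma mul_neg_of_facet (h𝒟 : IsPolyhedralSubdivision univ 𝒟) {F R R' : Set (Fin d → ℝ)}
    (hF : F ∈ 𝒟) (hR : R ∈ 𝒟) (hR' : R' ∈ 𝒟) (hFd : dim F + 1 = d)
    (hne : R ≠ R') (h : F ⊆ R) (h' : F ⊆ R')
    {a : (Fin d → ℝ) →ᵃ[ℝ] ℝ} (ha : ∀ x ∈ F, a x = 0) (hane : a.linear ≠ 0)
    {p p' : Fin d → ℝ} (hp : p ∈ R) (hpF : p ∉ F) (hp' : p' ∈ R') (hpF' : p' ∉ F) :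
    a p * a p' < 0 := by
  have h1 := mul_pos_of_facet h𝒟 hF hR hFd h ha hane hp hpF hp hpF
  have h2 := mul_pos_of_facet h𝒟 hF hR' hFd h' ha hane hp' hpF' hp' hpF'
  by_contra! hcon
  rcases hcon.lt_or_eq with h3 | h3
  · exact hne (eq_of_same_side h𝒟 hF hR hR' hFd h h' ha hp hp' h3)
  · rcases mul_eq_zero.1 h3.symm with h4 | h4 <;> simp [h4] at h1 h2

/-- Every facet is the intersection of two full-dimensional cells. -/
lemma exists_adjacent (h𝒟 : IsPolyhedralSubdivision univ 𝒟)
    (hlf : LocallyFinite (fun P : 𝒟 => (P : Set (Fin d → ℝ)))) {F : Set (Fin d → ℝ)}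
    (hF : F ∈ 𝒟) (hFd : dim F + 1 = d) :
    ∃ R ∈ 𝒟, ∃ R' ∈ 𝒟, dim R = d ∧ dim R' = d ∧ F = R ∩ R' := by
  obtain ⟨x, hx, hrel⟩ := exists_relint (h𝒟.isPolyhedron F hF).convex (h𝒟.nonempty F hF)
  obtain ⟨R, hR, hRd, hxR⟩ := exists_top_cell h𝒟 hlf x
  have hFR := subset_of_relint_mem h𝒟 hF hR hx hrel hxR
  obtain ⟨a, ha, haR⟩ := exists_supporting h𝒟 hF hR hFR
  obtain ⟨p, hp, hpF⟩ := exists_mem_notMem hFd hRd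
  have hap := haR p hp hpF
  have hne : a.linear ≠ 0 := linear_ne_zero (x := p) (y := x) (by rw [ha x hx]; exact hap.ne)
  obtain ⟨U, hU, hUc⟩ := exists_nhds_forall_cell h𝒟 hlf x
  -- A point close to `x` on the other side of the facet.
  have hc : Continuous fun t : ℝ => x + t • (x - p) := by fun_prop
  have h0 : (fun t : ℝ => x + t • (x - p)) ⁻¹' U ∈ 𝓝 (0 : ℝ) :=
    hc.continuousAt (by simpa using hU)
  obtain ⟨ε, hε, hsub⟩ := Metric.mem_nhds_iff.1 h0
  have hzU : x + (ε / 2) • (x - p) ∈ U := hsub (by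
    rw [Metric.mem_ball, Real.dist_eq, sub_zero, abs_of_pos (by positivity)]; linarith)
  obtain ⟨R', hR', hRd', hzR'⟩ := exists_top_cell h𝒟 hlf (x + (ε / 2) • (x - p))
  have hxR' := hUc R' hR' _ hzU hzR'
  have hFR' := subset_of_relint_mem h𝒟 hF hR' hx hrel hxR'
  have haz : 0 < a (x + (ε / 2) • (x - p)) := by
    have h1 := affine_add_apply a x (p - x)
    rw [add_sub_cancel, ha x hx, zero_add] at h1
    rw [affine_add_apply, ha x hx, map_smul, ← neg_sub, map_neg, ← h1, smul_eq_mul, zero_add]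
    nlinarith
  have hzF : x + (ε / 2) • (x - p) ∉ F := fun h => haz.ne' (ha _ h)
  refine ⟨R, hR, R', hR', hRd, hRd', Subset.antisymm (subset_inter hFR hFR') ?_⟩
  rintro y ⟨hyR, hyR'⟩
  by_contra hyF
  have h1 := haR y hyR hyF
  have h2 := mul_pos_of_facet h𝒟 hF hR' hFd hFR' ha hne hyR' hyF hzR' hzF
  nlinarith

/-- A full-dimensional cell containing a facet is one of the two adjacent to it. -/
lemma eq_or_eq_of_facet_subset (h𝒟 : IsPolyhedralSubdivision univ 𝒟)
    {F R R' S : Set (Fin d → ℝ)} (hF : F ∈ 𝒟) (hR : R ∈ 𝒟) (hR' : R' ∈ 𝒟) (hS : S ∈ 𝒟)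
    (hFd : dim F + 1 = d) (hRd : dim R = d) (hRd' : dim R' = d) (hSd : dim S = d)
    (hRR' : F = R ∩ R') (hFS : F ⊆ S) : S = R ∨ S = R' := by
  by_contra! hcon
  have hFR : F ⊆ R := hRR' ▸ inter_subset_left
  have hFR' : F ⊆ R' := hRR' ▸ inter_subset_right
  have hne : R ≠ R' := by
    rintro rfl
    rw [inter_self] at hRR'
    rw [hRR'] at hFd; omega
  obtain ⟨a, ha, haR⟩ := exists_supporting h𝒟 hF hR hFR
  obtain ⟨p, hp, hpF⟩ := exists_mem_notMem hFd hRd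
  obtain ⟨p', hp', hpF'⟩ := exists_mem_notMem hFd hRd'
  obtain ⟨q, hq, hqF⟩ := exists_mem_notMem hFd hSd
  obtain ⟨f, hf⟩ := h𝒟.nonempty F hF
  have hane : a.linear ≠ 0 := linear_ne_zero (x := p) (y := f) (by
    rw [ha f hf]; exact (haR p hp hpF).ne)
  have h1 := mul_neg_of_facet h𝒟 hF hR hR' hFd hne hFR hFR' ha hane hp hpF hp' hpF'
  have h2 := mul_neg_of_facet h𝒟 hF hS hR hFd hcon.1 hFS hFR ha hane hq hqF hp hpF
  have h3 := mul_neg_of_facet h𝒟 hF hS hR' hFd hcon.2 hFS hFR' ha hane hq hqF hp' hpF'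
  nlinarith [mul_pos_of_neg_of_neg h1 h2, sq_nonneg (a p)]

end Facets

/-! ### Existence of admissible choices -/

section Choices

variable {d : ℕ} {Λ : Set (Fin d → ℝ)} {𝒟 : Set (Set (Fin d → ℝ))}

lemma exists_isIndependentIn {P S : Set (Fin d → ℝ)} (hP : P = convexHull ℝ S)
    (hne : P.Nonempty) : ∃ V : Finset (Fin d → ℝ), IsIndependentIn (dim P + 1) V S := by
  obtain ⟨t, htS, hspan, hind⟩ := exists_affineIndependent ℝ (Fin d → ℝ) S
  obtain ⟨T, rfl⟩ := (finite_set_of_fin_dim_affineIndependent ℝ hind).exists_finset_coe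
  refine ⟨T, htS, ?_, hind⟩
  have hTne : Nonempty T := by
    rw [hP, convexHull_nonempty_iff, ← affineSpan_nonempty ℝ, ← hspan, affineSpan_nonempty] at hne
    exact hne.to_subtype
  have hind' : AffineIndependent ℝ (fun v : T => (v : Fin d → ℝ)) := hind
  have h1 := hind'.finrank_vectorSpan_add_one
  rw [Fintype.card_coe] at h1
  rw [← h1, dim, hP]
  rw [Subtype.range_coe_subtype, ← direction_affineSpan ℝ (convexHull ℝ S), affineSpan_convexHull,
    ← hspan, direction_affineSpan]
  rfl

/-- Adding a point off the hyperplane of a facet to independent points of the facet. -/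
lemma IsIndependentIn.insert_of_affine [DecidableEq (Fin d → ℝ)] {V : Finset (Fin d → ℝ)}
    {F S S' : Set (Fin d → ℝ)} (hd : 0 < d) (hV : IsIndependentIn d V (S ∩ F)) (hSS' : S ∩ F ⊆ S')
    {a : (Fin d → ℝ) →ᵃ[ℝ] ℝ} (ha : ∀ x ∈ F, a x = 0) {w : Fin d → ℝ} (hw : w ∈ S')
    (haw : a w ≠ 0) : IsIndependentIn (d + 1) (insert w V) S' := by
  obtain ⟨hVS, hc, hind⟩ := hV
  have hwV : w ∉ V := fun h => haw (ha w (hVS h).2)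
  have hc' : (insert w V).card = d + 1 := by rw [Finset.card_insert_of_notMem hwV, hc]
  refine ⟨?_, hc', ?_⟩
  · rw [Finset.coe_insert]
    exact insert_subset hw (hVS.trans hSS')
  · rw [affineIndependent_iff_le_finrank_vectorSpan ℝ _ (n := d) (by rw [Fintype.card_coe, hc'])]
    rw [Subtype.range_coe_subtype]
    change d ≤ dim ((insert w V : Finset (Fin d → ℝ)) : Set (Fin d → ℝ))
    have h1 : dim (V : Set (Fin d → ℝ)) + 1 = d := by
      have hVne : Nonempty V := by
        have : V.Nonempty := Finset.card_pos.1 (by omega)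
        exact this.to_subtype
      have h1 := hind.finrank_vectorSpan_add_one
      rw [Fintype.card_coe, hc, Subtype.range_coe_subtype] at h1
      exact h1
    have h2 : dim (V : Set (Fin d → ℝ)) < dim ((insert w V : Finset _) : Set (Fin d → ℝ)) := by
      refine dim_lt_of_affine (by simp) ?_ (fun x hx => ha x (hVS hx).2) (p := w) (by simp) haw
      exact Finset.coe_nonempty.2 (Finset.card_pos.1 (by omega))
    omega

/-- The vertices of a cell that is not contained in `F` do not all lie in `F`. -/
lemma exists_vertex_notMem {F R : Set (Fin d → ℝ)} (hR : R = convexHull ℝ (Λ ∩ R))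
    (hFc : Convex ℝ F) (hFd : dim F + 1 = d) (hRd : dim R = d) : ∃ w, w ∈ (Λ ∩ R) \ F := by
  by_contra! hcon
  have h1 : Λ ∩ R ⊆ F := fun w hw => by
    by_contra h
    exact hcon w ⟨hw, h⟩
  have h2 : R ⊆ F := by rw [hR]; exact convexHull_min h1 hFc
  have := dim_mono h2
  omega

theorem nonempty_choice (h𝒟 : IsSubdivisionWithVertices Λ 𝒟) : Nonempty (Choice Λ 𝒟) := by
  classical
  have h𝒟' := h𝒟.toIsPolyhedralSubdivision
  have h1 : ∀ P : Set (Fin d → ℝ), ∃ V : Finset (Fin d → ℝ), P ∈ 𝒟 →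
      IsIndependentIn (dim P + 1) V (Λ ∩ P) := by
    intro P
    by_cases hP : P ∈ 𝒟
    · obtain ⟨V, hV⟩ := exists_isIndependentIn (h𝒟.eq_convexHull P hP) (h𝒟'.nonempty P hP)
      exact ⟨V, fun _ => hV⟩
    · exact ⟨∅, fun h => absurd h hP⟩
  choose V hV using h1
  have h2 : ∀ F : Set (Fin d → ℝ), ∃ (R R' : Set (Fin d → ℝ)) (w w' : Fin d → ℝ), F ∈ 𝒟 →
      dim F + 1 = d → (R ∈ 𝒟 ∧ R' ∈ 𝒟 ∧ dim R = d ∧ dim R' = d ∧ F = R ∩ R') ∧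
        w ∈ (Λ ∩ R) \ F ∧ w' ∈ (Λ ∩ R') \ F := by
    intro F
    by_cases hF : F ∈ 𝒟 ∧ dim F + 1 = d
    · obtain ⟨hF, hFd⟩ := hF
      obtain ⟨R, hR, R', hR', hRd, hRd', hFR⟩ := exists_adjacent h𝒟' h𝒟.locallyFinite hF hFd
      have hFc := (h𝒟'.isPolyhedron F hF).convex
      obtain ⟨w, hw⟩ := exists_vertex_notMem (h𝒟.eq_convexHull R hR) hFc hFd hRd
      obtain ⟨w', hw'⟩ := exists_vertex_notMem (h𝒟.eq_convexHull R' hR') hFc hFd hRd'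
      exact ⟨R, R', w, w', fun _ _ => ⟨⟨hR, hR', hRd, hRd', hFR⟩, hw, hw'⟩⟩
    · exact ⟨∅, ∅, 0, 0, fun h h' => absurd ⟨h, h'⟩ hF⟩
  choose L R w w' hLR using h2
  exact ⟨{
    cellV := V
    cellV_spec := fun P hP hd => by have := hV P hP; rwa [hd] at this
    facetV := V
    facetV_spec := fun P hP hd => by have := hV P hP; rwa [hd] at this
    left := L
    right := R
    adjacent := fun F hF hd => (hLR F hF hd).1
    w := w
    w_spec := fun F hF hd => (hLR F hF hd).2.1
    w' := w'
    w'_spec := fun F hF hd => (hLR F hF hd).2.2 }⟩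

end Choices

/-! ### The rational closure -/

section RationalClosure

variable {d : ℕ}

/-- The integral vectors of the kernel of `Q`. -/
def integralKernel (Q : Matrix (Fin d) (Fin d) ℝ) : Set (Fin d → ℝ) :=
  {u | Q *ᵥ u = 0 ∧ ∃ z : Fin d → ℤ, u = fun i => (z i : ℝ)}

/-- A coordinate-free description of the rational closure: positive semidefinite symmetric
matrices whose kernel is spanned by integral vectors. -/
structure IsRationalForm (Q : Matrix (Fin d) (Fin d) ℝ) : Prop where
  symm : Qᵀ = Q
  nonneg : ∀ x, 0 ≤ qval Q x
  ker_le : ∀ x, Q *ᵥ x = 0 → x ∈ Submodule.span ℝ (integralKernel Q)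

lemma qval_mulVec (Q M : Matrix (Fin d) (Fin d) ℝ) (y : Fin d → ℝ) :
    qval Q (M *ᵥ y) = y ⬝ᵥ ((Mᵀ * Q * M) *ᵥ y) := by
  rw [qval, ← mulVec_mulVec, ← mulVec_mulVec, dotProduct_mulVec y, vecMul_transpose]

lemma exists_pos_le_of_posDef {ι : Type*} [Fintype ι] {A : Matrix ι ι ℝ} (hA : A.PosDef) :
    ∃ lam > 0, ∀ (x : ι → ℝ) (i : ι), lam * x i ^ 2 ≤ x ⬝ᵥ (A *ᵥ x) := by
  rcases isEmpty_or_nonempty ι with h | h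
  · exact ⟨1, one_pos, fun x i => isEmptyElim i⟩
  have hc : Continuous fun x : ι → ℝ => x ⬝ᵥ (A *ᵥ x) := by fun_prop
  obtain ⟨y, hy, hmin⟩ := (isCompact_sphere (0 : ι → ℝ) 1).exists_isMinOn
    (NormedSpace.sphere_nonempty.2 zero_le_one) hc.continuousOn
  have hy1 : ‖y‖ = 1 := by simpa using hy
  have hy0 : y ≠ 0 := by rintro rfl; simp at hy1
  have hpos : 0 < y ⬝ᵥ (A *ᵥ y) := by simpa using hA.dotProduct_mulVec_pos hy0
  refine ⟨_, hpos, fun x i => ?_⟩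
  rcases eq_or_ne x 0 with rfl | hx
  · simp
  have hn : 0 < ‖x‖ := norm_pos_iff.2 hx
  have h1 : ‖x‖⁻¹ • x ∈ Metric.sphere (0 : ι → ℝ) 1 := by
    simp [norm_smul, hn.ne']
  have h2 : y ⬝ᵥ (A *ᵥ y) ≤ (‖x‖⁻¹ • x) ⬝ᵥ (A *ᵥ (‖x‖⁻¹ • x)) := hmin h1
  rw [mulVec_smul, dotProduct_smul, smul_dotProduct, smul_eq_mul, smul_eq_mul] at h2
  have h3 : x i ^ 2 ≤ ‖x‖ ^ 2 := by
    rw [← sq_abs]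
    exact pow_le_pow_left₀ (abs_nonneg _) (norm_le_pi_norm x i) 2
  calc (y ⬝ᵥ (A *ᵥ y)) * x i ^ 2 ≤ (‖x‖⁻¹ * (‖x‖⁻¹ * (x ⬝ᵥ (A *ᵥ x)))) * ‖x‖ ^ 2 := by
        gcongr
        exact hpos.le.trans h2
    _ = x ⬝ᵥ (A *ᵥ x) := by field_simp

lemma exists_coordinates {Q : Matrix (Fin d) (Fin d) ℝ} (hQ : Q ∈ rationalClosure d) :
    ∃ (U Ui : Matrix (Fin d) (Fin d) ℤ) (k : ℕ),
      U.map (Int.cast : ℤ → ℝ) * Ui.map (Int.cast : ℤ → ℝ) = 1 ∧ Qᵀ = Q ∧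
      (∀ y, (∀ j : Fin d, k ≤ (j : ℕ) → y j = 0) →
        Q *ᵥ (U.map (Int.cast : ℤ → ℝ) *ᵥ y) = 0) ∧
      ∃ lam > 0, ∀ (y : Fin d → ℝ) (j : Fin d), k ≤ (j : ℕ) →
        lam * y j ^ 2 ≤ qval Q (U.map (Int.cast : ℤ → ℝ) *ᵥ y) := by
  obtain ⟨U, R, k, hR, h0, hpd⟩ := hQ
  set M := (U : Matrix (Fin d) (Fin d) ℤ).map (Int.cast : ℤ → ℝ) with hM
  set Mi := ((U⁻¹ : GeneralLinearGroup (Fin d) ℤ) : Matrix (Fin d) (Fin d) ℤ).map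
    (Int.cast : ℤ → ℝ) with hMi
  have hMM : M * Mi = 1 := by
    have h1 : (U : Matrix (Fin d) (Fin d) ℤ) *
        ((U⁻¹ : GeneralLinearGroup (Fin d) ℤ) : Matrix (Fin d) (Fin d) ℤ) = 1 := by
      rw [← Units.val_mul, mul_inv_cancel]; rfl
    have h2 := congrArg (fun A : Matrix (Fin d) (Fin d) ℤ => A.map (Int.castRingHom ℝ)) h1
    simp only [Matrix.map_mul] at h2
    rw [Matrix.map_one _ (map_zero _) (map_one _)] at h2
    exact h2
  have hMM' : Mi * M = 1 := mul_eq_one_comm.1 hMM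
  have hRsymm : Rᵀ = R := by
    ext i j
    rw [transpose_apply]
    by_cases h : (i : ℕ) < k ∨ (j : ℕ) < k
    · rw [h0 i j h, h0 j i h.symm]
    · push Not at h
      have := hpd.1.apply ⟨i, h.1⟩ ⟨j, h.2⟩
      simpa using this
  have hQR : Q = Miᵀ * R * Mi := by
    rw [hR]
    calc Q = (M * Mi)ᵀ * Q * (M * Mi) := by rw [hMM]; simp
      _ = _ := by rw [transpose_mul]; simp only [Matrix.mul_assoc]
  have hRy : ∀ y, (∀ j : Fin d, k ≤ (j : ℕ) → y j = 0) → R *ᵥ y = 0 := by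
    intro y hy
    ext i
    change ∑ j, R i j * y j = 0
    refine Finset.sum_eq_zero fun j _ => ?_
    by_cases hj : k ≤ (j : ℕ)
    · rw [hy j hj, mul_zero]
    · rw [h0 i j (Or.inr (not_le.1 hj)), zero_mul]
  have hqv : ∀ y, qval Q (M *ᵥ y) = y ⬝ᵥ (R *ᵥ y) := by
    intro y
    rw [hR, qval_mulVec]
  obtain ⟨lam, hlam, hle⟩ := exists_pos_le_of_posDef hpd
  refine ⟨U, _, k, hMM, ?_, fun y hy => ?_, lam, hlam, fun y j hj => ?_⟩
  · rw [hQR]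
    simp only [transpose_mul, transpose_transpose, hRsymm, Matrix.mul_assoc]
  · rw [← hM, hQR, mulVec_mulVec, Matrix.mul_assoc, hMM', mul_one, ← mulVec_mulVec, hRy y hy,
      mulVec_zero]
  · rw [← hM, hqv]
    refine (hle (fun i => y i) ⟨j, hj⟩).trans_eq ?_
    simp only [dotProduct, mulVec, submatrix_apply]
    have key : ∀ f : Fin d → ℝ, (∀ i : Fin d, ¬ k ≤ (i : ℕ) → f i = 0) →
        ∑ i : {i : Fin d // k ≤ (i : ℕ)}, f i = ∑ i, f i := by
      intro f hf
      rw [← Fintype.sum_subtype_add_sum_subtype (fun i : Fin d => k ≤ (i : ℕ)) f,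
        Finset.sum_eq_zero (s := (Finset.univ : Finset {i : Fin d // ¬ k ≤ (i : ℕ)}))
          (fun i _ => hf i i.2), add_zero]
    rw [← key (fun i => y i * ∑ j, R i j * y j)]
    · refine Finset.sum_congr rfl fun i _ => ?_
      rw [key (fun j => R i j * y j)]
      intro j hj
      rw [h0 i j (Or.inr (not_le.1 hj)), zero_mul]
    · intro i hi
      rw [Finset.sum_eq_zero, mul_zero]
      intro j _
      rw [h0 i j (Or.inl (not_le.1 hi)), zero_mul]

lemma isRationalForm_of_mem {Q : Matrix (Fin d) (Fin d) ℝ} (hQ : Q ∈ rationalClosure d) :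
    IsRationalForm Q := by
  obtain ⟨U, Ui, k, hMM, hsymm, hker, lam, hlam, hle⟩ := exists_coordinates hQ
  set M := U.map (Int.cast : ℤ → ℝ) with hM
  set Mi := Ui.map (Int.cast : ℤ → ℝ) with hMi
  have hx : ∀ x, M *ᵥ (Mi *ᵥ x) = x := fun x => by rw [mulVec_mulVec, hMM, one_mulVec]
  refine ⟨hsymm, fun x => ?_, fun x hx0 => ?_⟩
  · rw [← hx x]
    by_cases h : ∃ j : Fin d, k ≤ (j : ℕ)
    · obtain ⟨j, hj⟩ := h
      exact le_trans (by positivity) (hle (Mi *ᵥ x) j hj)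
    · push Not at h
      rw [qval_eq_zero_of_mulVec (hker _ fun j hj => absurd (h j) (not_lt.2 hj))]
  · have h0 : ∀ j : Fin d, k ≤ (j : ℕ) → (Mi *ᵥ x) j = 0 := by
      intro j hj
      have h1 := hle (Mi *ᵥ x) j hj
      rw [hx x, qval_eq_zero_of_mulVec hx0] at h1
      by_contra hne
      have : 0 < (Mi *ᵥ x) j ^ 2 := by positivity
      nlinarith
    rw [← hx x, mulVec_eq_sum]
    refine Submodule.sum_mem _ fun j _ => ?_
    by_cases hj : k ≤ (j : ℕ)
    · rw [h0 j hj]; simp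
    · rw [op_smul_eq_smul]
      refine Submodule.smul_mem _ _ (Submodule.subset_span ⟨?_, fun i => U i j, ?_⟩)
      · have h1 := hker (Pi.single j 1) (fun i hi => by
          rw [Pi.single_eq_of_ne]
          rintro rfl; exact hj hi)
        rw [mulVec_single_one] at h1
        exact h1
      · ext i; simp [hM]

/-- Modulo integral kernel vectors, the region `Q[v - c] ≤ R` is bounded. -/
lemma exists_bounded_representative {Q : Matrix (Fin d) (Fin d) ℝ} (hQ : Q ∈ rationalClosure d)
    (c : Fin d → ℝ) (R : ℝ) :
    ∃ B : ℝ, ∀ v, qval Q (v - c) ≤ R → ∃ u ∈ integralKernel Q, ∀ i, |(v - u) i| ≤ B := by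
  obtain ⟨U, Ui, k, hMM, hsymm, hker, lam, hlam, hle⟩ := exists_coordinates hQ
  set M := U.map (Int.cast : ℤ → ℝ) with hM
  set Mi := Ui.map (Int.cast : ℤ → ℝ) with hMi
  have hx : ∀ x, M *ᵥ (Mi *ᵥ x) = x := fun x => by rw [mulVec_mulVec, hMM, one_mulVec]
  set B1 : ℝ := R / lam + 1 + ∑ j, |(Mi *ᵥ c) j| with hB1
  have hB1' : ∀ v, qval Q (v - c) ≤ R → ∀ j : Fin d, k ≤ (j : ℕ) →
      |(Mi *ᵥ v) j| ≤ |B1| := by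
    intro v hv j hj
    refine le_trans ?_ (le_abs_self _)
    have h1 := hle (Mi *ᵥ (v - c)) j hj
    rw [hx] at h1
    have h2 : (Mi *ᵥ (v - c)) j = (Mi *ᵥ v) j - (Mi *ᵥ c) j := by rw [mulVec_sub]; rfl
    have h3 : ((Mi *ᵥ (v - c)) j) ^ 2 ≤ R / lam := by
      rw [le_div_iff₀ hlam]; linarith
    have h4 : |(Mi *ᵥ (v - c)) j| ≤ R / lam + 1 := by
      nlinarith [sq_abs ((Mi *ᵥ (v - c)) j), sq_nonneg (|(Mi *ᵥ (v - c)) j| - 1),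
        abs_nonneg ((Mi *ᵥ (v - c)) j)]
    have h5 : |(Mi *ᵥ c) j| ≤ ∑ j, |(Mi *ᵥ c) j| :=
      Finset.single_le_sum (f := fun j => |(Mi *ᵥ c) j|) (fun i _ => abs_nonneg _)
        (Finset.mem_univ j)
    have h6 : (Mi *ᵥ v) j = (Mi *ᵥ (v - c)) j + (Mi *ᵥ c) j := by rw [h2]; ring
    rw [h6, hB1]
    exact (abs_add_le _ _).trans (add_le_add h4 h5)
  refine ⟨∑ i, ∑ j, |M i j| * (|B1| + 1), fun v hv => ?_⟩
  set y := Mi *ᵥ v with hy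
  set z : Fin d → ℤ := fun j => if k ≤ (j : ℕ) then 0 else ⌊y j⌋ with hz
  refine ⟨M *ᵥ (fun j => (z j : ℝ)), ⟨?_, U *ᵥ z, ?_⟩, fun i => ?_⟩
  · exact hker _ fun j hj => by simp [hz, hj]
  · ext i
    simp [hM, mulVec, dotProduct]
  · have h1 : v - M *ᵥ (fun j => (z j : ℝ)) = M *ᵥ (y - fun j => (z j : ℝ)) := by
      rw [mulVec_sub, hy, hx]
    have h2 : ∀ j, |y j - z j| ≤ |B1| + 1 := by
      intro j
      by_cases hj : k ≤ (j : ℕ)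
      · have := hB1' v hv j hj
        simp only [hz, hj, if_true, Int.cast_zero, sub_zero]
        linarith
      · simp only [hz, hj, if_false]
        change |Int.fract (y j)| ≤ _
        rw [abs_of_nonneg (Int.fract_nonneg _)]
        have := Int.fract_lt_one (y j)
        linarith [abs_nonneg B1]
    rw [h1]
    refine le_trans ?_ (Finset.single_le_sum (f := fun i => ∑ j, |M i j| * (|B1| + 1))
      (fun i _ => by positivity) (Finset.mem_univ i))
    change |∑ j, M i j * (y j - z j)| ≤ _
    refine (Finset.abs_sum_le_sum_abs _ _).trans (Finset.sum_le_sum fun j _ => ?_)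
    rw [abs_mul]
    exact mul_le_mul_of_nonneg_left (h2 j) (abs_nonneg _)

/-- Positive semidefinite forms whose kernel is spanned by integral vectors lie in the rational
closure: by the Smith normal form, an integral basis can be chosen whose first members
span the kernel. -/
lemma mem_rationalClosure_of_isRationalForm {Q : Matrix (Fin d) (Fin d) ℝ}
    (hQ : IsRationalForm Q) : Q ∈ rationalClosure d := by
  let cast : (Fin d → ℤ) →ₗ[ℤ] (Fin d → ℝ) :=
    { toFun := fun z i => (z i : ℝ)
      map_add' := fun x y => by ext; simp
      map_smul' := fun c x => by ext; simp }
  let N : Submodule ℤ (Fin d → ℤ) :=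
    { carrier := {z | Q *ᵥ cast z = 0}
      zero_mem' := by simp
      add_mem' := fun {x y} hx hy => by
        have hx' : Q *ᵥ cast x = 0 := hx
        have hy' : Q *ᵥ cast y = 0 := hy
        change Q *ᵥ cast (x + y) = 0
        rw [map_add, mulVec_add, hx', hy', add_zero]
      smul_mem' := fun c x hx => by
        have hx' : Q *ᵥ cast x = 0 := hx
        change Q *ᵥ cast (c • x) = 0
        rw [map_smul, mulVec_smul, hx', smul_zero] }
  obtain ⟨n, snf⟩ := N.smithNormalForm (Pi.basisFun ℤ (Fin d))
  have hn : n ≤ d := by simpa using Fintype.card_le_of_embedding snf.f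
  obtain ⟨e, he⟩ := Equiv.Perm.exists_extending_pair (Fin.castLE hn) snf.f
    (Fin.castLE_injective hn) snf.f.injective
  have hrange : ∀ j : Fin d, n ≤ (j : ℕ) → e j ∉ Set.range snf.f := by
    rintro j hj ⟨i, hi⟩
    rw [← he i] at hi
    have := e.injective hi
    rw [← this] at hj
    simp at hj
    omega
  set b : Module.Basis (Fin d) ℤ (Fin d → ℤ) := snf.bM.reindex e.symm with hb
  have hbj : ∀ j, b j = snf.bM (e j) := fun j => by simp [hb]
  set b0 := Pi.basisFun ℤ (Fin d) with hb0
  let U : GeneralLinearGroup (Fin d) ℤ :=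
    ⟨b0.toMatrix b, b.toMatrix b0, b0.toMatrix_mul_toMatrix_flip b, b.toMatrix_mul_toMatrix_flip b0⟩
  set M := (U : Matrix (Fin d) (Fin d) ℤ).map (Int.cast : ℤ → ℝ) with hM
  set Mi := (b.toMatrix b0).map (Int.cast : ℤ → ℝ) with hMi
  have hMiM : Mi * M = 1 := by
    have h1 : b.toMatrix b0 * b0.toMatrix b = 1 := b.toMatrix_mul_toMatrix_flip b0
    have h2 := congrArg (fun A : Matrix (Fin d) (Fin d) ℤ => A.map (Int.castRingHom ℝ)) h1
    simp only [Matrix.map_mul] at h2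
    rw [Matrix.map_one _ (map_zero _) (map_one _)] at h2
    exact h2
  have hcol : ∀ j, M *ᵥ Pi.single j 1 = cast (b j) := by
    intro j
    rw [mulVec_single_one]
    ext i
    simp [hM, U, cast, Module.Basis.toMatrix_apply, hb0]
  have hlow : ∀ j : Fin d, (j : ℕ) < n → Q *ᵥ (M *ᵥ Pi.single j 1) = 0 := by
    intro j hj
    rw [hcol, hbj]
    have h1 : j = Fin.castLE hn ⟨j, hj⟩ := by ext; simp
    rw [h1, he]
    have h2 := snf.snf ⟨j, hj⟩
    have h3 : Q *ᵥ cast (snf.bN ⟨j, hj⟩ : Fin d → ℤ) = 0 := (snf.bN ⟨j, hj⟩).2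
    rw [h2, map_smul, mulVec_smul] at h3
    refine (smul_eq_zero.1 h3).resolve_left fun ha => ?_
    rw [ha, zero_smul] at h2
    exact snf.bN.ne_zero _ (Subtype.ext h2)
  -- Kernel vectors have no components along the remaining basis vectors.
  have hhigh : ∀ x, Q *ᵥ x = 0 → ∀ j : Fin d, n ≤ (j : ℕ) → (Mi *ᵥ x) j = 0 := by
    intro x hx j hj
    have h1 := hQ.ker_le x hx
    induction h1 using Submodule.span_induction with
    | mem u hu =>
      obtain ⟨hu0, z, rfl⟩ := hu
      have h2 := snf.repr_eq_zero_of_notMem_range (⟨z, hu0⟩ : N) (hrange j hj)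
      have h3 : (b.toMatrix b0 *ᵥ z) j = b.repr z j := by
        have := congrFun (b0.toMatrix_mulVec_repr b z) j
        rw [← this]
        congr 1
      have h4 : (Mi *ᵥ fun i => (z i : ℝ)) j = (((b.toMatrix b0 *ᵥ z) j : ℤ) : ℝ) := by
        simp [hMi, mulVec, dotProduct]
      rw [h4, h3, hb, Module.Basis.repr_reindex]
      simp only [Finsupp.mapDomain_equiv_apply, Equiv.symm_symm]
      exact_mod_cast h2
    | zero => simp
    | add u v hu hv ihu ihv =>
      rw [mulVec_add, Pi.add_apply]
      have h0 : ∀ w ∈ Submodule.span ℝ (integralKernel Q), Q *ᵥ w = 0 := by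
        intro w hw
        have : Submodule.span ℝ (integralKernel Q) ≤ LinearMap.ker (Matrix.mulVecLin Q) :=
          Submodule.span_le.2 fun u hu => hu.1
        exact this hw
      rw [ihu (h0 u hu), ihv (h0 v hv), add_zero]
    | smul a u hu ih =>
      have h0 : Q *ᵥ u = 0 := by
        have : Submodule.span ℝ (integralKernel Q) ≤ LinearMap.ker (Matrix.mulVecLin Q) :=
          Submodule.span_le.2 fun u hu => hu.1
        exact this hu
      rw [mulVec_smul, Pi.smul_apply, ih h0, smul_zero]
  have hRsymm : (Mᵀ * Q * M)ᵀ = Mᵀ * Q * M := by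
    simp only [transpose_mul, transpose_transpose, hQ.symm, Matrix.mul_assoc]
  have hcol0 : ∀ i j : Fin d, (j : ℕ) < n → (Mᵀ * Q * M) i j = 0 := by
    intro i j hj
    have h1 : (Mᵀ * Q * M) *ᵥ Pi.single j 1 = 0 := by
      rw [← mulVec_mulVec, ← mulVec_mulVec, hlow j hj, mulVec_zero]
    have h2 := congrFun h1 i
    rw [mulVec_single_one] at h2
    exact h2
  refine ⟨U, Mᵀ * Q * M, n, rfl, ?_, ?_⟩
  · rintro i j (hi | hj)
    · rw [← hRsymm, transpose_apply]; exact hcol0 j i hi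
    · exact hcol0 i j hj
  · refine PosDef.of_dotProduct_mulVec_pos ?_ fun x hx => ?_
    · rw [IsHermitian, conjTranspose_submatrix, conjTranspose_eq_transpose_of_trivial, hRsymm]
    · -- Extend `x` by zero.
      set y : Fin d → ℝ := fun i => if h : n ≤ (i : ℕ) then x ⟨i, h⟩ else 0 with hy
      have hyx : ∀ i : {i : Fin d // n ≤ (i : ℕ)}, y i = x i := fun i => by simp [hy, i.2]
      have key : ∀ f : Fin d → ℝ, (∀ i : Fin d, ¬ n ≤ (i : ℕ) → f i = 0) →
          ∑ i : {i : Fin d // n ≤ (i : ℕ)}, f i = ∑ i, f i := by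
        intro f hf
        rw [← Fintype.sum_subtype_add_sum_subtype (fun i : Fin d => n ≤ (i : ℕ)) f,
          Finset.sum_eq_zero (s := (Finset.univ : Finset {i : Fin d // ¬ n ≤ (i : ℕ)}))
            (fun i _ => hf i i.2), add_zero]
      have hval : star x ⬝ᵥ ((Mᵀ * Q * M).submatrix
          (Subtype.val : {i : Fin d // n ≤ (i : ℕ)} → Fin d)
          (Subtype.val : {i : Fin d // n ≤ (i : ℕ)} → Fin d) *ᵥ x) =
          y ⬝ᵥ ((Mᵀ * Q * M) *ᵥ y) := by
        simp only [dotProduct, mulVec, submatrix_apply, star_trivial]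
        rw [← key (fun i => y i * ∑ j, (Mᵀ * Q * M) i j * y j)]
        · refine Finset.sum_congr rfl fun i _ => ?_
          rw [hyx, ← key (fun j => (Mᵀ * Q * M) i j * y j)]
          · simp only [hyx]
          · intro j hj; simp [hy, hj]
        · intro i hi; simp [hy, hi]
      rw [hval, ← qval_mulVec]
      refine lt_of_le_of_ne (hQ.nonneg _) fun h0 => hx ?_
      have h1 := mulVec_eq_zero_of_qval_eq_zero hQ.symm hQ.nonneg h0.symm
      ext i
      have h2 := hhigh _ h1 i i.2
      rw [mulVec_mulVec, hMiM, one_mulVec, hyx] at h2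
      exact h2

end RationalClosure

/-! ### Periodic sets -/

section Periodic

variable {d : ℕ} {Λ : Set (Fin d → ℝ)}

lemma IsStandardPeriodic.nonempty (hΛ : IsStandardPeriodic Λ) : Λ.Nonempty := by
  obtain ⟨T, ⟨t, ht⟩, rfl⟩ := hΛ
  exact ⟨t, t, ht, 0, by ext; simp⟩

lemma IsStandardPeriodic.add_mem (hΛ : IsStandardPeriodic Λ) {v : Fin d → ℝ} (hv : v ∈ Λ)
    (z : Fin d → ℤ) : v + (fun i => (z i : ℝ)) ∈ Λ := by
  obtain ⟨T, -, rfl⟩ := hΛ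
  obtain ⟨t, ht, y, rfl⟩ := hv
  exact ⟨t, ht, y + z, by ext; simp [add_assoc]⟩

lemma IsStandardPeriodic.sub_mem (hΛ : IsStandardPeriodic Λ) {v : Fin d → ℝ} (hv : v ∈ Λ)
    (z : Fin d → ℤ) : v - (fun i => (z i : ℝ)) ∈ Λ := by
  have := hΛ.add_mem hv (-z)
  convert this using 1
  ext i; simp [sub_eq_add_neg]

/-- Every unit cube contains a point of a standard periodic set. -/
lemma IsStandardPeriodic.exists_near (hΛ : IsStandardPeriodic Λ) (x : Fin d → ℝ) :
    ∃ v ∈ Λ, ∀ i, 0 ≤ (v - x) i ∧ (v - x) i ≤ 1 := by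
  obtain ⟨v, hv⟩ := hΛ.nonempty
  refine ⟨v - (fun i => ((⌊(v - x) i⌋ : ℤ) : ℝ)), hΛ.sub_mem hv (fun i => ⌊(v - x) i⌋),
    fun i => ?_⟩
  have h : (v - (fun i => ((⌊(v - x) i⌋ : ℤ) : ℝ)) - x) i = Int.fract ((v - x) i) := by
    simp only [Pi.sub_apply, Int.fract]; ring
  rw [h]
  exact ⟨Int.fract_nonneg _, (Int.fract_lt_one _).le⟩

lemma IsStandardPeriodic.finite_box (hΛ : IsStandardPeriodic Λ) (B : ℝ) :
    {v | v ∈ Λ ∧ ∀ i, |v i| ≤ B}.Finite := by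
  obtain ⟨T, -, rfl⟩ := hΛ
  have h1 : ∀ t ∈ T, {v : Fin d → ℝ | (∃ z : Fin d → ℤ, v = t + fun i => (z i : ℝ)) ∧
      ∀ i, |v i| ≤ B}.Finite := by
    intro t _
    refine ((Set.Finite.pi (t := fun i => Icc ⌊-B - t i⌋ ⌈B - t i⌉)
      (fun i => finite_Icc _ _)).image (fun z : Fin d → ℤ => t + fun i => (z i : ℝ))).subset ?_
    rintro v ⟨⟨z, rfl⟩, hv⟩
    refine ⟨z, fun i _ => ?_, rfl⟩
    have := abs_le.1 (hv i)
    simp only [Pi.add_apply] at this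
    refine ⟨?_, ?_⟩
    · have : (⌊-B - t i⌋ : ℝ) ≤ z i := (Int.floor_le _).trans (by linarith)
      exact_mod_cast this
    · have : (z i : ℝ) ≤ ⌈B - t i⌉ := le_trans (by linarith) (Int.le_ceil _)
      exact_mod_cast this
  refine (T.finite_toSet.biUnion h1).subset ?_
  rintro v ⟨⟨t, ht, z, hz⟩, hv⟩
  exact mem_iUnion₂.2 ⟨t, ht, ⟨z, hz⟩, hv⟩

lemma exists_bound_on_box {Q : Matrix (Fin d) (Fin d) ℝ} (x : Fin d → ℝ) (r : ℝ) :
    ∃ K, ∀ y : Fin d → ℝ, (∀ i, |y i| ≤ r) → qval Q (x + y) ≤ K := by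
  have hc : IsCompact (Set.pi univ fun _ : Fin d => Icc (-r) r) :=
    isCompact_univ_pi fun _ => isCompact_Icc
  have hcont : Continuous fun y => qval Q (x + y) := (continuous_qval Q).comp (by fun_prop)
  obtain ⟨K, hK⟩ := hc.bddAbove_image hcont.continuousOn
  exact ⟨K, fun y hy => hK ⟨y, fun i _ => abs_le.1 (hy i), rfl⟩⟩

/-- Simultaneous Diophantine approximation, without a rate. -/
lemma exists_int_near_multiple (u : Fin d → ℝ) {ε : ℝ} (hε : 0 < ε) :
    ∃ n : ℕ, 0 < n ∧ ∃ z : Fin d → ℤ, ‖(fun i => (z i : ℝ)) - (n : ℝ) • u‖ < ε := by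
  have hc : IsCompact (Set.pi univ fun _ : Fin d => Icc (0 : ℝ) 1) :=
    isCompact_univ_pi fun _ => isCompact_Icc
  obtain ⟨a, -, φ, hφ, hlim⟩ := hc.tendsto_subseq
    (x := fun n : ℕ => fun i => Int.fract ((n : ℝ) * u i))
    (fun n i _ => ⟨Int.fract_nonneg _, (Int.fract_lt_one _).le⟩)
  obtain ⟨N, hN⟩ := Metric.cauchySeq_iff.1 hlim.cauchySeq ε hε
  have h1 := hN (N + 1) (by omega) N le_rfl
  have hlt : φ N < φ (N + 1) := hφ (Nat.lt_succ_self N)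
  refine ⟨φ (N + 1) - φ N, by omega,
    fun i => ⌊(φ (N + 1) : ℝ) * u i⌋ - ⌊(φ N : ℝ) * u i⌋, ?_⟩
  rw [dist_eq_norm, ← norm_neg] at h1
  refine lt_of_eq_of_lt (congrArg norm ?_) h1
  ext i
  simp only [Function.comp, Pi.sub_apply, Pi.neg_apply, Pi.smul_apply, smul_eq_mul, Int.fract,
    Nat.cast_sub hlt.le, Int.cast_sub]
  ring

end Periodic

/-! ### Admissible affine functions -/

section Admissible

variable {d : ℕ} {Λ : Set (Fin d → ℝ)} {Q : Matrix (Fin d) (Fin d) ℝ}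

/-- `ℓ` is a lower bound of `Q[·]` on `Λ`. -/
def IsAdmissible (Λ : Set (Fin d → ℝ)) (Q : Matrix (Fin d) (Fin d) ℝ)
    (ℓ : (Fin d → ℝ) →ᵃ[ℝ] ℝ) : Prop := ∀ v ∈ Λ, ℓ v ≤ qval Q v

/-- The points of `Λ` at which `ℓ` agrees with `Q[·]`. -/
def contact (Λ : Set (Fin d → ℝ)) (Q : Matrix (Fin d) (Fin d) ℝ)
    (ℓ : (Fin d → ℝ) →ᵃ[ℝ] ℝ) : Set (Fin d → ℝ) := {v | v ∈ Λ ∧ ℓ v = qval Q v}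

/-- The cell cut out by `ℓ`: the projection of a face of the convex hull of the
lifted points `(v, Q[v])`, `v ∈ Λ`. -/
def cell (Λ : Set (Fin d → ℝ)) (Q : Matrix (Fin d) (Fin d) ℝ)
    (ℓ : (Fin d → ℝ) →ᵃ[ℝ] ℝ) : Set (Fin d → ℝ) := convexHull ℝ (contact Λ Q ℓ)

lemma le_of_mem_cell {ℓ ℓ' : (Fin d → ℝ) →ᵃ[ℝ] ℝ} (h' : IsAdmissible Λ Q ℓ') {x : Fin d → ℝ}
    (hx : x ∈ cell Λ Q ℓ) : ℓ' x ≤ ℓ x :=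
  affine_le_of_mem_convexHull (fun v hv => hv.2 ▸ h' v hv.1) hx

lemma mem_cell_of_eq {ℓ ℓ' : (Fin d → ℝ) →ᵃ[ℝ] ℝ} (h : IsAdmissible Λ Q ℓ) {x : Fin d → ℝ}
    (hx : x ∈ cell Λ Q ℓ') (he : ℓ x = ℓ' x) : x ∈ cell Λ Q ℓ := by
  refine convexHull_mono ?_ (mem_convexHull_of_affine_eq (ℓ := ℓ) (ℓ' := ℓ')
    (fun v (hv : v ∈ contact Λ Q ℓ') => hv.2 ▸ h v hv.1) hx he)
  rintro v ⟨hv, hv'⟩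
  exact ⟨hv.1, hv'.trans hv.2⟩

lemma mem_contact_of_mem_cell (hQ : Qᵀ = Q) (hpos : ∀ x, 0 ≤ qval Q x)
    {ℓ : (Fin d → ℝ) →ᵃ[ℝ] ℝ} (h : IsAdmissible Λ Q ℓ)
    (hc : ∃ c β, ∀ x, qval Q x - ℓ x = qval Q (x - c) - β) {v : Fin d → ℝ} (hv : v ∈ Λ)
    (hvc : v ∈ cell Λ Q ℓ) : v ∈ contact Λ Q ℓ := by
  obtain ⟨c, β, hcβ⟩ := hc
  have h1 : qval Q (v - c) ≤ β := by
    refine qval_le_of_mem_convexHull hQ hpos (fun w hw => ?_) hvc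
    have := hcβ w
    rw [hw.2] at this
    linarith
  have h2 := hcβ v
  exact ⟨hv, le_antisymm (h v hv) (by linarith)⟩

lemma linear_eq_zero_of_integralKernel (hΛ : IsStandardPeriodic Λ) (hQ : Qᵀ = Q)
    {ℓ : (Fin d → ℝ) →ᵃ[ℝ] ℝ} (h : IsAdmissible Λ Q ℓ) {u : Fin d → ℝ}
    (hu : u ∈ integralKernel Q) : ℓ.linear u = 0 := by
  obtain ⟨v, hv⟩ := hΛ.nonempty
  obtain ⟨hu0, z, rfl⟩ := hu
  have key : ∀ n : ℤ, (n : ℝ) * ℓ.linear (fun i => (z i : ℝ)) ≤ qval Q v - ℓ v := by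
    intro n
    have h1 := h _ (hΛ.add_mem hv (n • z))
    have h2 : (fun i => (((n • z) i : ℤ) : ℝ)) = (n : ℝ) • fun i => (z i : ℝ) := by
      ext i; simp
    rw [h2, affine_add_apply, map_smul, smul_eq_mul,
      qval_add_of_mulVec hQ (by rw [mulVec_smul, hu0, smul_zero])] at h1
    linarith
  by_contra hne
  rcases lt_or_gt_of_ne hne with h1 | h1
  · obtain ⟨n, hn⟩ := exists_nat_gt ((qval Q v - ℓ v) / -ℓ.linear (fun i => (z i : ℝ)))
    rw [div_lt_iff₀ (by linarith)] at hn
    have := key (-n)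
    push_cast at this
    linarith
  · obtain ⟨n, hn⟩ := exists_nat_gt ((qval Q v - ℓ v) / ℓ.linear (fun i => (z i : ℝ)))
    rw [div_lt_iff₀ h1] at hn
    have := key n
    push_cast at this
    linarith

lemma linear_eq_zero_of_ker (hΛ : IsStandardPeriodic Λ) (hQ : Q ∈ rationalClosure d)
    {ℓ : (Fin d → ℝ) →ᵃ[ℝ] ℝ} (h : IsAdmissible Λ Q ℓ) {u : Fin d → ℝ}
    (hu : Q *ᵥ u = 0) : ℓ.linear u = 0 := by
  have hQ' := isRationalForm_of_mem hQ
  have : Submodule.span ℝ (integralKernel Q) ≤ LinearMap.ker ℓ.linear :=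
    Submodule.span_le.2 fun u hu => linear_eq_zero_of_integralKernel hΛ hQ'.symm h hu
  exact this (hQ'.ker_le u hu)

lemma linear_apply_eq_dotProduct (φ : (Fin d → ℝ) →ₗ[ℝ] ℝ) (x : Fin d → ℝ) :
    φ x = (fun i => φ (Pi.single i 1)) ⬝ᵥ x := by
  conv_lhs => rw [pi_eq_sum_univ' x]
  rw [map_sum]
  exact Finset.sum_congr rfl fun i _ => by
    rw [map_smul, smul_eq_mul, mul_comm]

/-- The affine function `x ↦ p ⬝ x + b`. -/
def affineOfDot (p : Fin d → ℝ) (b : ℝ) : (Fin d → ℝ) →ᵃ[ℝ] ℝ where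
  toFun x := p ⬝ᵥ x + b
  linear := { toFun := fun x => p ⬝ᵥ x
              map_add' := dotProduct_add p
              map_smul' := fun c x => dotProduct_smul c p x }
  map_vadd' x v := by
    simp only [vadd_eq_add, LinearMap.coe_mk, AddHom.coe_mk, dotProduct_add]; ring

lemma affineOfDot_apply (p : Fin d → ℝ) (b : ℝ) (x : Fin d → ℝ) :
    affineOfDot p b x = p ⬝ᵥ x + b := rfl

lemma exists_eq_affineOfDot (ℓ : (Fin d → ℝ) →ᵃ[ℝ] ℝ) : ∃ p b, ℓ = affineOfDot p b := by
  refine ⟨fun i => ℓ.linear (Pi.single i 1), ℓ 0, ?_⟩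
  ext x
  rw [affine_apply, linear_apply_eq_dotProduct, affineOfDot_apply]

/-- An affine function that is constant along the kernel of `Q` differs from `Q[·]` by a
translate of `Q[·]`, up to a constant. -/
lemma exists_center (hQ : Qᵀ = Q) {ℓ : (Fin d → ℝ) →ᵃ[ℝ] ℝ}
    (h : ∀ u, Q *ᵥ u = 0 → ℓ.linear u = 0) :
    ∃ c β, ∀ x, qval Q x - ℓ x = qval Q (x - c) - β := by
  have h1 : ℓ.linear ∈ LinearMap.range (Matrix.mulVecLin Q).dualMap := by
    rw [LinearMap.range_dualMap_eq_dualAnnihilator_ker, Submodule.mem_dualAnnihilator]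
    exact fun u hu => h u hu
  obtain ⟨φ, hφ⟩ := h1
  set p : Fin d → ℝ := fun i => φ (Pi.single i 1) with hp
  have h2 : ∀ x, ℓ.linear x = p ⬝ᵥ (Q *ᵥ x) := by
    intro x
    rw [← hφ, LinearMap.dualMap_apply, mulVecLin_apply, linear_apply_eq_dotProduct]
  refine ⟨(1 / 2 : ℝ) • p, qval Q ((1 / 2 : ℝ) • p) + ℓ 0, fun x => ?_⟩
  rw [affine_apply, h2, qval_sub hQ, mulVec_smul, dotProduct_smul, smul_eq_mul,
    dotProduct_mulVec_symm hQ p x]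
  ring

lemma IsAdmissible.exists_center (hΛ : IsStandardPeriodic Λ) (hQ : Q ∈ rationalClosure d)
    {ℓ : (Fin d → ℝ) →ᵃ[ℝ] ℝ} (h : IsAdmissible Λ Q ℓ) :
    ∃ c β, ∀ x, qval Q x - ℓ x = qval Q (x - c) - β :=
  Secondary.exists_center (isRationalForm_of_mem hQ).symm
    fun _ hu => linear_eq_zero_of_ker hΛ hQ h hu

/-- The Delone polyhedra of `Q` are the nonempty cells cut out by admissible affine functions. -/
theorem isDelonePolyhedron_iff (hΛ : IsStandardPeriodic Λ) (hQ : Q ∈ rationalClosure d)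
    {P : Set (Fin d → ℝ)} : IsDelonePolyhedron Λ Q P ↔
      P.Nonempty ∧ ∃ ℓ, IsAdmissible Λ Q ℓ ∧ P = cell Λ Q ℓ := by
  have hQ' := isRationalForm_of_mem hQ
  constructor
  · rintro ⟨hne, c, r, hr, rfl⟩
    have hval : ∀ v, affineOfDot ((2 : ℝ) • (Q *ᵥ c)) (r ^ 2 - qval Q c) v =
        qval Q v - (qval Q (c - v) - r ^ 2) := by
      intro v
      rw [affineOfDot_apply, smul_dotProduct, smul_eq_mul, dotProduct_comm, qval_sub hQ'.symm,
        dotProduct_mulVec_symm hQ'.symm]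
      ring
    refine ⟨hne, affineOfDot ((2 : ℝ) • (Q *ᵥ c)) (r ^ 2 - qval Q c), ?_, ?_⟩
    · intro v hv
      rw [hval]
      linarith [hr v hv]
    · rw [cell, contact]
      congr 1
      ext v
      refine and_congr_right fun hv => ?_
      rw [hval]
      constructor <;> intro h <;> linarith
  · rintro ⟨hne, ℓ, hℓ, rfl⟩
    obtain ⟨c, β, hc⟩ := hℓ.exists_center hΛ hQ
    have hβ : 0 ≤ β := by
      obtain ⟨v, hv⟩ := convexHull_nonempty_iff.1 hne
      have h1 := hc v
      rw [hv.2] at h1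
      linarith [hQ'.nonneg (v - c)]
    have hswap : ∀ v, qval Q (c - v) = qval Q (v - c) := fun v => by
      rw [← neg_sub, qval_neg]
    refine ⟨hne, c, Real.sqrt β, fun v hv => ?_, ?_⟩
    · rw [Real.sq_sqrt hβ, hswap]
      linarith [hc v, hℓ v hv]
    · rw [cell, contact]
      congr 1
      ext v
      refine and_congr_right fun hv => ?_
      rw [Real.sq_sqrt hβ, hswap]
      have := hc v
      constructor <;> intro h <;> linarith

/-- A symmetric matrix admitting one full-dimensional cell belongs to the rational closure.
Nonnegativity on integral vectors comes from comparing `ℓ` and `Q[·]` at `v ± z`. If `u` is in the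
kernel and `z` is an integral vector close to a multiple of `u`, the same comparison
shows that the difference lies in the kernel, hence so does `z`. -/
theorem mem_rationalClosure_of_cell (hΛ : IsStandardPeriodic Λ) (hQ : Qᵀ = Q)
    {ℓ : (Fin d → ℝ) →ᵃ[ℝ] ℝ} (h : IsAdmissible Λ Q ℓ)
    (hint : (interior (cell Λ Q ℓ)).Nonempty) : Q ∈ rationalClosure d := by
  have hz : ∀ (z : Fin d → ℤ), ∀ v ∈ contact Λ Q ℓ, ℓ.linear (fun i => (z i : ℝ)) ≤
      2 * (v ⬝ᵥ (Q *ᵥ fun i => (z i : ℝ))) + qval Q (fun i => (z i : ℝ)) := by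
    rintro z v ⟨hv, hve⟩
    have h1 := h _ (hΛ.add_mem hv z)
    rw [affine_add_apply, qval_add hQ, hve] at h1
    linarith
  have hneg : ∀ z : Fin d → ℤ, (fun i => (((-z) i : ℤ) : ℝ)) = -fun i => (z i : ℝ) := by
    intro z; ext i; simp
  have hne : (contact Λ Q ℓ).Nonempty :=
    convexHull_nonempty_iff.1 (hint.mono interior_subset)
  have hposz : ∀ z : Fin d → ℤ, 0 ≤ qval Q (fun i => (z i : ℝ)) := by
    intro z
    obtain ⟨v, hv⟩ := hne
    have h1 := hz z v hv
    have h2 := hz (-z) v hv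
    rw [hneg, map_neg, mulVec_neg, dotProduct_neg, qval_neg] at h2
    linarith
  have hpos : ∀ x, 0 ≤ qval Q x := by
    intro x
    have hcl : IsClosed {x | 0 ≤ qval Q x} := isClosed_le continuous_const (continuous_qval Q)
    refine hcl.closure_subset (Metric.mem_closure_iff.2 fun ε hε => ?_)
    obtain ⟨n, hn⟩ := exists_nat_gt (1 / ε)
    have hn0 : (0 : ℝ) < n := lt_trans (by positivity) hn
    refine ⟨(1 / (n : ℝ)) • fun i => ((⌊n * x i⌋ : ℤ) : ℝ), ?_, ?_⟩
    · change 0 ≤ qval Q _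
      rw [qval_smul]
      exact mul_nonneg (sq_nonneg _) (hposz fun i => ⌊n * x i⌋)
    · refine (dist_pi_lt_iff hε).2 fun i => ?_
      rw [Real.dist_eq]
      have e : x i - ((1 / (n : ℝ)) • fun i => ((⌊n * x i⌋ : ℤ) : ℝ)) i =
          Int.fract (n * x i) / n := by
        simp only [Pi.smul_apply, smul_eq_mul, Int.fract]
        field_simp
      rw [e, abs_of_nonneg (div_nonneg (Int.fract_nonneg _) hn0.le), div_lt_iff₀ hn0]
      rw [div_lt_iff₀ hε] at hn
      linarith [Int.fract_lt_one (n * x i)]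
  refine mem_rationalClosure_of_isRationalForm ⟨hQ, hpos, fun u hu => ?_⟩
  obtain ⟨x0, hx0⟩ := hint
  obtain ⟨ρ, hρ, hball⟩ := Metric.mem_nhds_iff.1 (mem_interior_iff_mem_nhds.1 hx0)
  have hzP : ∀ (z : Fin d → ℤ), ∀ x ∈ cell Λ Q ℓ, ℓ.linear (fun i => (z i : ℝ)) ≤
      2 * (x ⬝ᵥ (Q *ᵥ fun i => (z i : ℝ))) + qval Q (fun i => (z i : ℝ)) := by
    intro z x hx
    refine convexHull_min (t := {x | ℓ.linear (fun i => (z i : ℝ)) ≤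
      2 * (x ⬝ᵥ (Q *ᵥ fun i => (z i : ℝ))) + qval Q (fun i => (z i : ℝ))}) (hz z) ?_ hx
    intro y hy w hw a b ha hb hab
    simp only [mem_ofPred_eq] at hy hw ⊢
    rw [add_dotProduct, smul_dotProduct, smul_dotProduct, smul_eq_mul, smul_eq_mul]
    have hb' : b = 1 - a := by linarith
    subst hb'
    nlinarith [mul_le_mul_of_nonneg_left hy ha, mul_le_mul_of_nonneg_left hw hb]
  have key : ∀ ε > 0, ε ≤ ρ → ∃ y ∈ Submodule.span ℝ (integralKernel Q), dist u y < ε := by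
    intro ε hε hερ
    obtain ⟨n, hn, z, hnz⟩ := exists_int_near_multiple u hε
    set e : Fin d → ℝ := (fun i => (z i : ℝ)) - (n : ℝ) • u with he
    have hQe : Q *ᵥ (fun i => (z i : ℝ)) = Q *ᵥ e := by
      rw [he, mulVec_sub, mulVec_smul, hu, smul_zero, sub_zero]
    have hqe : qval Q (fun i => (z i : ℝ)) = qval Q e := by
      have h1 : (fun i => (z i : ℝ)) = e + (n : ℝ) • u := by rw [he]; abel
      rw [h1, qval_add_of_mulVec hQ (by rw [mulVec_smul, hu, smul_zero])]
    have h1 := hzP z (x0 - e) (hball (by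
      rw [Metric.mem_ball, dist_eq_norm, sub_sub_cancel_left, norm_neg]; linarith))
    have h2 := hzP (-z) (x0 + e) (hball (by
      rw [Metric.mem_ball, dist_eq_norm, add_sub_cancel_left]; linarith))
    rw [hneg, map_neg, mulVec_neg, dotProduct_neg, qval_neg, hQe, hqe, add_dotProduct] at h2
    rw [hQe, hqe, sub_dotProduct] at h1
    have h3 : qval Q e = e ⬝ᵥ (Q *ᵥ e) := rfl
    have h4 : qval Q e = 0 := le_antisymm (by linarith) (hpos e)
    have h5 := mulVec_eq_zero_of_qval_eq_zero hQ hpos h4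
    have hn0 : (1 : ℝ) ≤ n := by exact_mod_cast hn
    refine ⟨(1 / (n : ℝ)) • fun i => (z i : ℝ), Submodule.smul_mem _ _
      (Submodule.subset_span ⟨hQe.trans h5, z, rfl⟩), ?_⟩
    have h6 : u - (1 / (n : ℝ)) • (fun i => (z i : ℝ)) = -((1 / (n : ℝ)) • e) := by
      rw [he, smul_sub, smul_smul, one_div, inv_mul_cancel₀ (by positivity), one_smul]; abel
    rw [dist_eq_norm, h6, norm_neg, norm_smul, Real.norm_of_nonneg (by positivity)]
    calc 1 / (n : ℝ) * ‖e‖ ≤ 1 * ‖e‖ := by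
          gcongr
          rw [div_le_one (by positivity)]; exact hn0
      _ < ε := by rw [one_mul]; exact hnz
  have hclosed : IsClosed (Submodule.span ℝ (integralKernel Q) : Set (Fin d → ℝ)) :=
    Submodule.closed_of_finiteDimensional _
  refine hclosed.closure_subset (Metric.mem_closure_iff.2 fun ε hε => ?_)
  obtain ⟨y, hy, hyd⟩ := key (min ε ρ) (lt_min hε hρ) (min_le_right _ _)
  exact ⟨y, hy, hyd.trans_le (min_le_left _ _)⟩

end Admissible

/-! ### Delone subdivisions -/

section Delone

variable {d : ℕ} {Λ : Set (Fin d → ℝ)} {Q : Matrix (Fin d) (Fin d) ℝ}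

/-- Finitely many representatives modulo integral kernel vectors suffice to describe the points
of `Λ` in a region `Q[v - c] ≤ R`. -/
lemma exists_finite_representatives (hΛ : IsStandardPeriodic Λ) (hQ : Q ∈ rationalClosure d)
    (c : Fin d → ℝ) (R : ℝ) : ∃ T : Set (Fin d → ℝ), T.Finite ∧
      ∀ v ∈ Λ, qval Q (v - c) ≤ R → ∃ u ∈ integralKernel Q, v - u ∈ T ∧ v - u ∈ Λ := by
  obtain ⟨B, hB⟩ := exists_bounded_representative hQ c R
  refine ⟨_, hΛ.finite_box B, fun v hv hvR => ?_⟩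
  obtain ⟨u, hu, huB⟩ := hB v hvR
  have h1 : v - u ∈ Λ := by
    obtain ⟨-, z, rfl⟩ := hu
    exact hΛ.sub_mem hv z
  exact ⟨u, hu, ⟨h1, huB⟩, h1⟩

lemma contact_sub_mem (hΛ : IsStandardPeriodic Λ) (hQ : Q ∈ rationalClosure d)
    {ℓ : (Fin d → ℝ) →ᵃ[ℝ] ℝ} (h : IsAdmissible Λ Q ℓ) {v u : Fin d → ℝ} (hv : v ∈ contact Λ Q ℓ)
    (hu : u ∈ integralKernel Q) : v - u ∈ contact Λ Q ℓ := by
  have hQ' := isRationalForm_of_mem hQ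
  have h1 := linear_eq_zero_of_integralKernel hΛ hQ'.symm h hu
  obtain ⟨hu0, z, rfl⟩ := hu
  refine ⟨hΛ.sub_mem hv.1 z, ?_⟩
  rw [sub_eq_add_neg, affine_add_apply, map_neg, h1, neg_zero, add_zero, hv.2,
    qval_add_of_mulVec hQ'.symm (by rw [mulVec_neg, hu0, neg_zero])]

lemma contact_add_mem (hΛ : IsStandardPeriodic Λ) (hQ : Q ∈ rationalClosure d)
    {ℓ : (Fin d → ℝ) →ᵃ[ℝ] ℝ} (h : IsAdmissible Λ Q ℓ) {v u : Fin d → ℝ} (hv : v ∈ contact Λ Q ℓ)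
    (hu : u ∈ integralKernel Q) : v + u ∈ contact Λ Q ℓ := by
  have : -u ∈ integralKernel Q := by
    obtain ⟨hu0, z, rfl⟩ := hu
    exact ⟨by rw [mulVec_neg, hu0, neg_zero], -z, by ext; simp⟩
  simpa using contact_sub_mem hΛ hQ h hv this

/-- Cells are invariant under translation by kernel vectors. -/
lemma cell_add_mem (hΛ : IsStandardPeriodic Λ) (hQ : Q ∈ rationalClosure d)
    {ℓ : (Fin d → ℝ) →ᵃ[ℝ] ℝ} (h : IsAdmissible Λ Q ℓ) {x w : Fin d → ℝ} (hx : x ∈ cell Λ Q ℓ)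
    (hw : Q *ᵥ w = 0) : x + w ∈ cell Λ Q ℓ := by
  have hQ' := isRationalForm_of_mem hQ
  have hconv : Convex ℝ (cell Λ Q ℓ) := convex_convexHull ℝ _
  -- Integral translations first; the real ones follow by convexity.
  have hint : ∀ u ∈ integralKernel Q, ∀ x ∈ cell Λ Q ℓ, x + u ∈ cell Λ Q ℓ := by
    intro u hu x hx
    refine convexHull_min (t := {x | x + u ∈ cell Λ Q ℓ})
      (fun v hv => subset_convexHull ℝ _ (contact_add_mem hΛ hQ h hv hu)) ?_ hx
    exact hconv.translate_preimage_left u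
  have hmul : ∀ u ∈ integralKernel Q, ∀ n : ℤ, (n : ℝ) • u ∈ integralKernel Q := by
    rintro u ⟨hu0, z, rfl⟩ n
    exact ⟨by rw [mulVec_smul, hu0, smul_zero], n • z, by ext; simp⟩
  let K : Submodule ℝ (Fin d → ℝ) :=
    { carrier := {w | ∀ s : ℝ, ∀ x ∈ cell Λ Q ℓ, x + s • w ∈ cell Λ Q ℓ}
      zero_mem' := fun s x hx => by simpa using hx
      add_mem' := fun {a b} ha hb s x hx => by
        rw [smul_add, ← add_assoc]; exact hb s _ (ha s x hx)
      smul_mem' := fun c a ha s x hx => by rw [smul_smul]; exact ha _ x hx }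
  have hK : Submodule.span ℝ (integralKernel Q) ≤ K := by
    refine Submodule.span_le.2 fun u hu s x hx => ?_
    have h1 := hint _ (hmul u hu ⌊s⌋) x hx
    have h2 := hint _ (hmul u hu (⌊s⌋ + 1)) x hx
    have h3 := hconv h1 h2 (a := 1 - Int.fract s) (b := Int.fract s)
      (by linarith [Int.fract_lt_one s]) (Int.fract_nonneg s) (by ring)
    convert h3 using 1
    have h4 : s = ⌊s⌋ + Int.fract s := (Int.floor_add_fract s).symm
    nth_rewrite 1 [h4]
    push_cast
    module
  simpa using hK (hQ'.ker_le w hw) 1 x hx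

lemma exists_finite_hull (hΛ : IsStandardPeriodic Λ) (hQ : Q ∈ rationalClosure d)
    {ℓ : (Fin d → ℝ) →ᵃ[ℝ] ℝ} (h : IsAdmissible Λ Q ℓ) :
    ∃ T : Set (Fin d → ℝ), T.Finite ∧ T ⊆ contact Λ Q ℓ ∧
      ∀ x ∈ cell Λ Q ℓ, ∃ y ∈ convexHull ℝ T, Q *ᵥ (x - y) = 0 := by
  obtain ⟨c, β, hc⟩ := h.exists_center hΛ hQ
  obtain ⟨T, hT, hrep⟩ := exists_finite_representatives hΛ hQ c β
  refine ⟨T ∩ contact Λ Q ℓ, hT.inter_of_left _, inter_subset_right, fun x hx => ?_⟩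
  refine convexHull_min (t := {x | ∃ y ∈ convexHull ℝ (T ∩ contact Λ Q ℓ), Q *ᵥ (x - y) = 0})
    (fun v hv => ?_) ?_ hx
  · have h1 := hc v
    rw [hv.2] at h1
    obtain ⟨u, hu, hvT, -⟩ := hrep v hv.1 (by linarith)
    refine ⟨v - u, subset_convexHull ℝ _ ⟨hvT, contact_sub_mem hΛ hQ h hv hu⟩, ?_⟩
    rw [sub_sub_cancel]; exact hu.1
  · rintro x ⟨y, hy, hxy⟩ x' ⟨y', hy', hxy'⟩ a b ha hb hab
    refine ⟨a • y + b • y', convex_convexHull ℝ _ hy hy' ha hb hab, ?_⟩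
    have : a • x + b • x' - (a • y + b • y') = a • (x - y) + b • (x' - y') := by module
    rw [this, mulVec_add, mulVec_smul, mulVec_smul, hxy, hxy']
    simp

open scoped Pointwise in
lemma isClosed_cell (hΛ : IsStandardPeriodic Λ) (hQ : Q ∈ rationalClosure d)
    {ℓ : (Fin d → ℝ) →ᵃ[ℝ] ℝ} (h : IsAdmissible Λ Q ℓ) : IsClosed (cell Λ Q ℓ) := by
  obtain ⟨T, hT, hTS, hx⟩ := exists_finite_hull hΛ hQ h
  have hker : IsClosed ({w | Q *ᵥ w = 0} : Set (Fin d → ℝ)) :=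
    isClosed_eq (by fun_prop) continuous_const
  have heq : cell Λ Q ℓ = {w | Q *ᵥ w = 0} + convexHull ℝ T := by
    ext x
    constructor
    · intro hxc
      obtain ⟨y, hy, hxy⟩ := hx x hxc
      exact ⟨x - y, hxy, y, hy, by simp⟩
    · rintro ⟨w, hw, y, hy, rfl⟩
      simp only []
      rw [add_comm]
      exact cell_add_mem hΛ hQ h (convexHull_mono hTS hy) hw
  rw [heq]
  exact hker.add_right_of_isCompact (hT.isCompact_convexHull (𝕜 := ℝ))

/-- Perturbation: if `a ≤ 0` on the contact points of an admissible function `ℓ`, then `ℓ + δ a` is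
admissible for small `δ > 0`. This holds since, away from the contact points, the gap `Q[·] - ℓ` is
bounded below by discreteness and dominates `a` at infinity. -/
theorem exists_perturbation (hΛ : IsStandardPeriodic Λ) (hQ : Q ∈ rationalClosure d)
    {ℓ : (Fin d → ℝ) →ᵃ[ℝ] ℝ} (h : IsAdmissible Λ Q ℓ) {a : (Fin d → ℝ) →ᵃ[ℝ] ℝ}
    (hker : ∀ u, Q *ᵥ u = 0 → a.linear u = 0) (ha : ∀ v ∈ contact Λ Q ℓ, a v ≤ 0) :
    ∃ δ > (0 : ℝ), IsAdmissible Λ Q (ℓ + δ • a) ∧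
      contact Λ Q (ℓ + δ • a) = {v | v ∈ contact Λ Q ℓ ∧ a v = 0} := by
  have hQ' := isRationalForm_of_mem hQ
  obtain ⟨c, β, hc⟩ := h.exists_center hΛ hQ
  obtain ⟨c', β', hc'⟩ := exists_center hQ'.symm hker
  have hsymmc : ∀ u v, Q *ᵥ u = 0 → qval Q (v - u) = qval Q v := by
    intro u v hu
    rw [sub_eq_add_neg, qval_add_of_mulVec hQ'.symm (by rw [mulVec_neg, hu, neg_zero])]
  obtain ⟨T, hT, hrep⟩ := exists_finite_representatives hΛ hQ c (β + 1)
  -- A lower bound for the gap off the contact set.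
  obtain ⟨g, hg, hgap⟩ : ∃ g > 0, ∀ v ∈ Λ, v ∉ contact Λ Q ℓ → g ≤ qval Q v - ℓ v := by
    have hfin : ((fun v => qval Q (v - c) - β) '' T ∩ Ioi 0).Finite := (hT.image _).inter_of_left _
    have hmin : ∃ g > 0, ∀ s ∈ (fun v => qval Q (v - c) - β) '' T ∩ Ioi 0, g ≤ s := by
      rcases ((fun v => qval Q (v - c) - β) '' T ∩ Ioi 0).eq_empty_or_nonempty with he | hne
      · exact ⟨1, one_pos, by simp [he]⟩
      · obtain ⟨s, hs, hsm⟩ := exists_min_image _ id hfin hne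
        exact ⟨s, hs.2, hsm⟩
    obtain ⟨g, hg, hgm⟩ := hmin
    refine ⟨min g 1, by positivity, fun v hv hvc => ?_⟩
    have hpos : 0 < qval Q v - ℓ v := by
      refine lt_of_le_of_ne (sub_nonneg.2 (h v hv)) fun h0 => hvc ⟨hv, ?_⟩
      linarith
    rw [hc] at hpos ⊢
    by_cases hle : qval Q (v - c) ≤ β + 1
    · obtain ⟨u, hu, hvT, -⟩ := hrep v hv hle
      refine (min_le_left _ _).trans (hgm _ ⟨⟨v - u, hvT, ?_⟩, hpos⟩)
      change qval Q (v - u - c) - β = _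
      rw [sub_right_comm, hsymmc _ _ hu.1]
    · exact (min_le_right _ _).trans (by linarith)
  -- An upper bound for `a` in terms of the gap.
  obtain ⟨K, hK0, hK⟩ : ∃ K ≥ 0, ∀ v, a v ≤ K + (qval Q v - ℓ v) := by
    refine ⟨|a c + qval Q c' + β|, abs_nonneg _, fun v => ?_⟩
    have h1 : ∀ x, a x = 2 * (x ⬝ᵥ (Q *ᵥ c')) - qval Q c' + β' := by
      intro x
      have := hc' x
      rw [qval_sub hQ'.symm] at this
      linarith
    have h2 := hQ'.nonneg ((v - c) - c')
    rw [qval_sub hQ'.symm, sub_dotProduct] at h2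
    have h3 := h1 v
    have h4 := h1 c
    have h5 := le_abs_self (a c + qval Q c' + β)
    linarith [hc v]
  have hden : 0 < 2 * (K / g + 1) := by positivity
  refine ⟨(1 / (2 * (K / g + 1)) : ℝ), by positivity, ?_⟩
  have happ : ∀ v, (ℓ + (1 / (2 * (K / g + 1)) : ℝ) • a) v = ℓ v + 1 / (2 * (K / g + 1)) * a v :=
    fun v => rfl
  have hlt : ∀ v ∈ Λ, v ∉ contact Λ Q ℓ → ℓ v + 1 / (2 * (K / g + 1)) * a v < qval Q v := by
    intro v hv hvc
    have h1 := hgap v hv hvc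
    have h2 : K ≤ K / g * (qval Q v - ℓ v) := by
      rw [div_mul_eq_mul_div, le_div_iff₀ hg]
      exact mul_le_mul_of_nonneg_left h1 hK0
    have h3 : a v ≤ (K / g + 1) * (qval Q v - ℓ v) := by linarith [hK v]
    have h4 : 1 / (2 * (K / g + 1)) * a v ≤ (qval Q v - ℓ v) / 2 := by
      calc 1 / (2 * (K / g + 1)) * a v
          ≤ 1 / (2 * (K / g + 1)) * ((K / g + 1) * (qval Q v - ℓ v)) := by gcongr
        _ = (qval Q v - ℓ v) / 2 := by
          have : K / g + 1 ≠ 0 := by positivity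
          field_simp
    linarith
  refine ⟨fun v hv => ?_, ?_⟩
  · rw [happ]
    by_cases hvc : v ∈ contact Λ Q ℓ
    · have := mul_nonpos_of_nonneg_of_nonpos (by positivity : 0 ≤ 1 / (2 * (K / g + 1)))
        (ha v hvc)
      rw [hvc.2]; linarith
    · exact (hlt v hv hvc).le
  · ext v
    constructor
    · rintro ⟨hv, hve⟩
      rw [happ] at hve
      have hvc : v ∈ contact Λ Q ℓ := by
        by_contra hvc
        exact (hlt v hv hvc).ne hve
      refine ⟨hvc, ?_⟩
      rw [hvc.2] at hve
      have h1 : 1 / (2 * (K / g + 1)) * a v = 0 := by linarith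
      exact (mul_eq_zero.1 h1).resolve_left (by positivity)
    · rintro ⟨hvc, hav⟩
      refine ⟨hvc.1, ?_⟩
      rw [happ, hav, mul_zero, add_zero]; exact hvc.2

end Delone

section Delone

variable {d : ℕ} {Λ : Set (Fin d → ℝ)} {Q : Matrix (Fin d) (Fin d) ℝ}

/-- A functional that is bounded above on a nonempty cell is constant along the kernel. -/
lemma linear_eq_zero_of_bddAbove_cell (hΛ : IsStandardPeriodic Λ) (hQ : Q ∈ rationalClosure d)
    {ℓ : (Fin d → ℝ) →ᵃ[ℝ] ℝ} (h : IsAdmissible Λ Q ℓ) {x : Fin d → ℝ} (hx : x ∈ cell Λ Q ℓ)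
    {l : (Fin d → ℝ) →ₗ[ℝ] ℝ} {m : ℝ} (hl : ∀ y ∈ cell Λ Q ℓ, l y ≤ m) {u : Fin d → ℝ}
    (hu : Q *ᵥ u = 0) : l u = 0 := by
  by_contra hne
  have h1 := hl _ (cell_add_mem hΛ hQ h hx (w := ((m - l x + 1) / l u) • u)
    (by rw [mulVec_smul, hu, smul_zero]))
  rw [map_add, map_smul, smul_eq_mul, div_mul_cancel₀ _ hne] at h1
  linarith

/-- The cells cover the space: an admissible function with maximal value at `x` cuts out a cell
containing `x`, since otherwise it could be increased at `x` by a perturbation. -/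
theorem exists_cell_mem (hΛ : IsStandardPeriodic Λ) (hQ : Q ∈ rationalClosure d)
    (x : Fin d → ℝ) : ∃ ℓ, IsAdmissible Λ Q ℓ ∧ x ∈ cell Λ Q ℓ := by
  have hQ' := isRationalForm_of_mem hQ
  let A : Set ((Fin d → ℝ) × ℝ) := {q | (∀ v ∈ Λ, q.1 ⬝ᵥ v + q.2 ≤ qval Q v) ∧ 0 ≤ q.1 ⬝ᵥ x + q.2}
  have hval : Continuous fun q : (Fin d → ℝ) × ℝ => q.1 ⬝ᵥ x + q.2 := by fun_prop
  have hAclosed : IsClosed A := by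
    have h1 : IsClosed (⋂ v ∈ Λ, {q : (Fin d → ℝ) × ℝ | q.1 ⬝ᵥ v + q.2 ≤ qval Q v}) :=
      isClosed_iInter fun v => isClosed_iInter fun _ => isClosed_le (by fun_prop) continuous_const
    have h2 : IsClosed {q : (Fin d → ℝ) × ℝ | 0 ≤ q.1 ⬝ᵥ x + q.2} :=
      isClosed_le continuous_const hval
    convert h1.inter h2 using 1
    ext q
    simp [A]
  obtain ⟨v1, hv1, hv1x⟩ := hΛ.exists_near x
  obtain ⟨K, hK⟩ := exists_bound_on_box (Q := Q) x 2
  have hp : ∀ q ∈ A, ∀ i, |q.1 i| ≤ K := by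
    rintro ⟨p, b⟩ ⟨hq, hq0⟩ i
    simp only at hq hq0 ⊢
    -- A point of `Λ` in the orthant around `x` determined by the signs of `p`.
    set z : Fin d → ℤ := fun i => if 0 ≤ p i then 1 else -2 with hz
    set y : Fin d → ℝ := v1 - x + fun i => (z i : ℝ) with hy
    have hyi : ∀ i, |p i| ≤ p i * y i ∧ |y i| ≤ 2 := by
      intro i
      have h1 := hv1x i
      simp only [Pi.sub_apply] at h1
      by_cases hpi : 0 ≤ p i
      · have : y i = v1 i - x i + 1 := by simp [hy, hz, hpi]
        rw [this, abs_of_nonneg hpi, abs_le]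
        exact ⟨by nlinarith, by linarith, by linarith⟩
      · have : y i = v1 i - x i + -2 := by simp [hy, hz, hpi]
        rw [this, abs_of_neg (not_le.1 hpi), abs_le]
        exact ⟨by nlinarith, by linarith, by linarith⟩
    have h1 := hq _ (hΛ.add_mem hv1 z)
    have h2 : v1 + (fun i => (z i : ℝ)) = x + y := by rw [hy]; abel
    rw [h2, dotProduct_add] at h1
    have h3 := hK y fun i => (hyi i).2
    have h4 : ∑ i, |p i| ≤ p ⬝ᵥ y := Finset.sum_le_sum fun i _ => (hyi i).1
    have h5 : |p i| ≤ ∑ i, |p i| :=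
      Finset.single_le_sum (f := fun i => |p i|) (fun i _ => abs_nonneg _) (Finset.mem_univ i)
    linarith
  have hdot : ∀ q ∈ A, ∀ w : Fin d → ℝ, |q.1 ⬝ᵥ w| ≤ ∑ i, K * |w i| := by
    intro q hq w
    refine (Finset.abs_sum_le_sum_abs _ _).trans (Finset.sum_le_sum fun i _ => ?_)
    rw [abs_mul]
    exact mul_le_mul_of_nonneg_right (hp q hq i) (abs_nonneg _)
  have hAcpt : IsCompact A := by
    have hbox : IsCompact ((Set.pi univ fun _ : Fin d => Icc (-K) K) ×ˢ
        Icc (-∑ i, K * |x i|) (qval Q v1 + ∑ i, K * |v1 i|)) :=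
      (isCompact_univ_pi fun _ => isCompact_Icc).prod isCompact_Icc
    refine hbox.of_isClosed_subset hAclosed ?_
    intro q hq
    refine ⟨fun i _ => abs_le.1 (hp q hq i), ?_, ?_⟩
    · have h1 := (abs_le.1 (hdot q hq x)).2
      have h2 := hq.2
      linarith
    · have h1 := (abs_le.1 (hdot q hq v1)).1
      have h2 := hq.1 v1 hv1
      linarith
  obtain ⟨⟨p, b⟩, hpb, hmax⟩ := hAcpt.exists_isMaxOn
    ⟨(0, 0), fun v _ => by simpa using hQ'.nonneg v, by simp⟩ hval.continuousOn
  have hℓ : IsAdmissible Λ Q (affineOfDot p b) := hpb.1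
  refine ⟨affineOfDot p b, hℓ, ?_⟩
  by_contra hx
  obtain ⟨a, hker, ha, hax⟩ : ∃ a : (Fin d → ℝ) →ᵃ[ℝ] ℝ, (∀ u, Q *ᵥ u = 0 → a.linear u = 0) ∧
      (∀ v ∈ contact Λ Q (affineOfDot p b), a v ≤ 0) ∧ 0 < a x := by
    rcases (contact Λ Q (affineOfDot p b)).eq_empty_or_nonempty with he | ⟨s, hs⟩
    · exact ⟨AffineMap.const ℝ _ 1, by simp, by simp [he], by simp⟩
    · obtain ⟨f, r, hfr, hrx⟩ := geometric_hahn_banach_closed_point (convex_convexHull ℝ _)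
        (isClosed_cell hΛ hQ hℓ) hx
      refine ⟨f.toLinearMap.toAffineMap - AffineMap.const ℝ _ r, fun u hu => ?_, fun v hv => ?_, ?_⟩
      · have := linear_eq_zero_of_bddAbove_cell hΛ hQ hℓ (subset_convexHull ℝ _ hs)
          (l := f.toLinearMap) (fun y hy => (hfr y hy).le) hu
        simpa using this
      · simpa using (hfr v (subset_convexHull ℝ _ hv)).le
      · simpa using hrx
  obtain ⟨δ, hδ, hadm, -⟩ := exists_perturbation hΛ hQ hℓ hker ha
  obtain ⟨p', b', hpb'⟩ := exists_eq_affineOfDot (affineOfDot p b + δ • a)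
  have h1 : p' ⬝ᵥ x + b' = p ⬝ᵥ x + b + δ * a x := by
    rw [← affineOfDot_apply, ← hpb']; rfl
  have h2 : 0 < δ * a x := mul_pos hδ hax
  have h3 : (p', b') ∈ A := by
    refine ⟨fun v hv => ?_, ?_⟩
    · have := hadm v hv
      rw [hpb'] at this
      exact this
    · have := hpb.2
      simp only at this ⊢
      linarith
  have h4 : p' ⬝ᵥ x + b' ≤ p ⬝ᵥ x + b := hmax h3
  linarith

lemma isExposed_of_affine {P : Set (Fin d → ℝ)} {a : (Fin d → ℝ) →ᵃ[ℝ] ℝ}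
    (ha : ∀ x ∈ P, a x ≤ 0) : IsExposed ℝ P {x | x ∈ P ∧ a x = 0} := by
  rintro ⟨x, hx, hax⟩
  refine ⟨LinearMap.toContinuousLinearMap a.linear, ?_⟩
  ext y
  refine and_congr_right fun hy => ?_
  simp only [LinearMap.coe_toContinuousLinearMap']
  have hval : ∀ z, a.linear z = a z - a 0 := fun z => by rw [affine_apply a z]; ring
  constructor
  · intro hay z hz
    rw [hval, hval, hay]; linarith [ha z hz]
  · intro hmax
    have := hmax x hx
    rw [hval, hval, hax] at this
    exact le_antisymm (ha y hy) (by linarith)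

lemma isExposed_cell_inter {ℓ ℓ' : (Fin d → ℝ) →ᵃ[ℝ] ℝ} (h : IsAdmissible Λ Q ℓ)
    (h' : IsAdmissible Λ Q ℓ') : IsExposed ℝ (cell Λ Q ℓ) (cell Λ Q ℓ ∩ cell Λ Q ℓ') := by
  have heq : cell Λ Q ℓ ∩ cell Λ Q ℓ' = {x | x ∈ cell Λ Q ℓ ∧ (ℓ' - ℓ) x = 0} := by
    ext x
    refine and_congr_right fun hx => ?_
    change _ ↔ ℓ' x - ℓ x = 0
    rw [sub_eq_zero]
    exact ⟨fun hx' => le_antisymm (le_of_mem_cell h' hx) (le_of_mem_cell h hx'),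
      fun he => mem_cell_of_eq h' hx he⟩
  rw [heq]
  refine isExposed_of_affine fun x hx => ?_
  change ℓ' x - ℓ x ≤ 0
  linarith [le_of_mem_cell h' hx]

/-- Faces of cells are cells. -/
lemma exists_cell_of_isExposed (hΛ : IsStandardPeriodic Λ) (hQ : Q ∈ rationalClosure d)
    {ℓ : (Fin d → ℝ) →ᵃ[ℝ] ℝ} (h : IsAdmissible Λ Q ℓ) {F : Set (Fin d → ℝ)} (hne : F.Nonempty)
    (hF : IsExposed ℝ (cell Λ Q ℓ) F) : ∃ ℓ', IsAdmissible Λ Q ℓ' ∧ F = cell Λ Q ℓ' := by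
  obtain ⟨l, rfl⟩ := hF hne
  obtain ⟨f, hf, hfmax⟩ := hne
  set a : (Fin d → ℝ) →ᵃ[ℝ] ℝ := l.toLinearMap.toAffineMap - AffineMap.const ℝ _ (l f) with hadef
  have haval : ∀ x, a x = l x - l f := fun x => by simp [hadef]
  have hker : ∀ u, Q *ᵥ u = 0 → a.linear u = 0 := fun u hu => by
    have := linear_eq_zero_of_bddAbove_cell hΛ hQ h hf (l := l.toLinearMap) hfmax hu
    simpa [hadef] using this
  obtain ⟨δ, hδ, hadm, hcon⟩ := exists_perturbation hΛ hQ h hker (fun v hv => by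
    rw [haval]; linarith [hfmax v (subset_convexHull ℝ _ hv)])
  refine ⟨_, hadm, ?_⟩
  rw [show cell Λ Q (ℓ + δ • a) = convexHull ℝ (contact Λ Q (ℓ + δ • a)) from rfl, hcon]
  ext x
  constructor
  · rintro ⟨hx, hxmax⟩
    have h1 : l x = l f := le_antisymm (hfmax x hx) (hxmax f hf)
    have h2 := mem_convexHull_of_affine_eq (ℓ := a) (ℓ' := 0) (S := contact Λ Q ℓ)
      (fun v hv => by
        rw [haval]
        have := hfmax v (subset_convexHull ℝ _ hv)
        simpa using this) hx (by rw [haval, h1]; simp)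
    simpa using h2
  · intro hx
    have h1 : a x = 0 := by
      have h2 : ∀ v ∈ {v | v ∈ contact Λ Q ℓ ∧ a v = 0}, a v ≤ (0 : (Fin d → ℝ) →ᵃ[ℝ] ℝ) v :=
        fun v hv => by rw [hv.2]; simp
      have h3 : ∀ v ∈ {v | v ∈ contact Λ Q ℓ ∧ a v = 0}, (0 : (Fin d → ℝ) →ᵃ[ℝ] ℝ) v ≤ a v :=
        fun v hv => by rw [hv.2]; simp
      have h4 := affine_le_of_mem_convexHull h2 hx
      have h5 := affine_le_of_mem_convexHull h3 hx
      exact le_antisymm (by simpa using h4) (by simpa using h5)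
    rw [haval, sub_eq_zero] at h1
    exact ⟨convexHull_mono (fun v hv => hv.1) hx, fun y hy => h1 ▸ hfmax y hy⟩

/-- Delone subdivisions are locally finite: the empty ellipsoids have bounded size,
modulo the kernel of the form, so that
a cell near `x` is determined by which of finitely many points it contains. -/
lemma locallyFinite_del (hΛ : IsStandardPeriodic Λ) (hQ : Q ∈ rationalClosure d) :
    LocallyFinite (fun P : Del Λ Q => (P : Set (Fin d → ℝ))) := by
  have hQ' := isRationalForm_of_mem hQ
  obtain ⟨M, hM⟩ := exists_bound_on_box (Q := Q) 0 1
  simp only [zero_add] at hM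
  intro x0
  refine ⟨Metric.ball x0 1, Metric.ball_mem_nhds _ one_pos, ?_⟩
  obtain ⟨T, hT, hrep⟩ := exists_finite_representatives hΛ hQ x0 (10 * M)
  have hfin : {P : Set (Fin d → ℝ) | P ∈ Del Λ Q ∧ (P ∩ Metric.ball x0 1).Nonempty}.Finite := by
    refine (hT.finite_subsets.image fun S => convexHull ℝ
      {v | ∃ u ∈ integralKernel Q, v - u ∈ S}).subset ?_
    rintro P ⟨hP, y, hyP, hyx⟩
    obtain ⟨-, ℓ, hℓ, rfl⟩ := (isDelonePolyhedron_iff hΛ hQ).1 hP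
    refine ⟨contact Λ Q ℓ ∩ T, inter_subset_right, ?_⟩
    simp only [cell]
    congr 1
    ext v
    constructor
    · rintro ⟨u, hu, hvu, -⟩
      simpa using contact_add_mem hΛ hQ hℓ hvu hu
    · intro hv
      obtain ⟨c, β, hc⟩ := hℓ.exists_center hΛ hQ
      have hβ : β ≤ M := by
        obtain ⟨w, hw, hwc⟩ := hΛ.exists_near c
        have h1 := hM (w - c) fun i => abs_le.2 ⟨by linarith [(hwc i).1], (hwc i).2⟩
        linarith [hc w, hℓ w hw]
      have hcon : ∀ w ∈ contact Λ Q ℓ, qval Q (w - c) ≤ M := by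
        intro w hw
        have := hc w
        rw [hw.2] at this
        linarith
      have h1 := hcon v hv
      have h2 := qval_le_of_mem_convexHull hQ'.symm hQ'.nonneg hcon hyP
      have h3 : qval Q (y - x0) ≤ M := hM _ fun i => by
        have := (norm_le_pi_norm (y - x0) i).trans (mem_ball_iff_norm.1 hyx).le
        simpa using this
      have h4 : qval Q (v - x0) ≤ 10 * M := by
        have e1 : v - x0 = (v - c) + (c - x0) := by abel
        have e2 : c - x0 = -(y - c) + (y - x0) := by abel
        have h5 := qval_add_le hQ'.symm hQ'.nonneg (v - c) (c - x0)
        have h6 := qval_add_le hQ'.symm hQ'.nonneg (-(y - c)) (y - x0)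
        rw [← e1] at h5
        rw [← e2, qval_neg] at h6
        linarith
      obtain ⟨u, hu, hvT, -⟩ := hrep v hv.1 h4
      exact ⟨u, hu, contact_sub_mem hΛ hQ hℓ hv hu, hvT⟩
  exact (hfin.preimage Subtype.val_injective.injOn).subset fun P hP => ⟨P.2, hP⟩

lemma isPolyhedron_of_affine {ι : Type*} [Finite ι] (a : ι → ((Fin d → ℝ) →ᵃ[ℝ] ℝ)) :
    IsPolyhedron {x | ∀ i, a i x ≤ 0} := by
  obtain ⟨n, ⟨e⟩⟩ := Finite.exists_equiv_fin ι
  refine ⟨n, fun i => LinearMap.toContinuousLinearMap (a (e.symm i)).linear,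
    fun i => -(a (e.symm i) 0), ?_⟩
  ext x
  simp only [mem_ofPred_eq, LinearMap.coe_toContinuousLinearMap']
  rw [← e.symm.forall_congr_right (q := fun i => a i x ≤ 0)]
  refine forall_congr' fun i => ?_
  rw [affine_apply (a (e.symm i)) x]
  constructor <;> intro h <;> linarith

/-- A cell is cut out by the finitely many cells that meet a compact piece of it. -/
lemma isPolyhedron_cell (hΛ : IsStandardPeriodic Λ) (hQ : Q ∈ rationalClosure d)
    {ℓ : (Fin d → ℝ) →ᵃ[ℝ] ℝ} (h : IsAdmissible Λ Q ℓ) (hne : (cell Λ Q ℓ).Nonempty) :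
    IsPolyhedron (cell Λ Q ℓ) := by
  obtain ⟨T, hT, hTS, hTx⟩ := exists_finite_hull hΛ hQ h
  have hlf := locallyFinite_del hΛ hQ
  have hclosed : ∀ P ∈ Del Λ Q, IsClosed P := by
    intro P hP
    obtain ⟨-, ℓ', hℓ', rfl⟩ := (isDelonePolyhedron_iff hΛ hQ).1 hP
    exact isClosed_cell hΛ hQ hℓ'
  have hfin := hlf.finite_nonempty_inter_compact (hT.isCompact_convexHull (𝕜 := ℝ))
  have hℓP : ∀ P : Del Λ Q, ∃ ℓ', IsAdmissible Λ Q ℓ' ∧ (P : Set (Fin d → ℝ)) = cell Λ Q ℓ' :=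
    fun P => ((isDelonePolyhedron_iff hΛ hQ).1 P.2).2
  choose ℓ' hℓ' hP using hℓP
  have := hfin.to_subtype
  have hpoly := isPolyhedron_of_affine (fun P : {P : Del Λ Q |
    ((P : Set (Fin d → ℝ)) ∩ convexHull ℝ T).Nonempty} => ℓ' P - ℓ)
  convert hpoly using 1
  refine Subset.antisymm (fun x hx P => ?_) fun x hx => ?_
  · change ℓ' P x - ℓ x ≤ 0
    linarith [le_of_mem_cell (hℓ' P) hx]
  by_contra hxc
  -- Follow a segment from the cell to `x` and use a cell met just after leaving.
  obtain ⟨p, hp⟩ := hne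
  set γ : ℝ → (Fin d → ℝ) := fun t => p + t • (x - p) with hγ
  have hγc : Continuous γ := by fun_prop
  have hcpt : IsCompact (Icc (0 : ℝ) 1 ∩ γ ⁻¹' cell Λ Q ℓ) := isCompact_Icc.inter_right
    ((isClosed_cell hΛ hQ h).preimage hγc)
  obtain ⟨t0, ⟨ht0, hγt0⟩, hgr⟩ := hcpt.exists_isGreatest ⟨0, by simp, by simpa [hγ] using hp⟩
  have ht0lt : t0 < 1 := lt_of_le_of_ne ht0.2 fun he => hxc (by
    rw [he] at hγt0; simpa [hγ] using hγt0)
  have hU := hlf.iInter_compl_mem_nhds (fun P => hclosed P P.2) (γ t0)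
  obtain ⟨ε, hε, hsub⟩ := Metric.mem_nhds_iff.1 (hγc.continuousAt (x := t0) hU)
  set δ := min (ε / 2) ((1 - t0) / 2) with hδ
  have hδ0 : 0 < δ := by
    have : 0 < 1 - t0 := by linarith
    positivity
  have hδ2 : δ ≤ (1 - t0) / 2 := min_le_right _ _
  have hδ3 : δ < ε := (min_le_left _ _).trans_lt (by linarith)
  obtain ⟨ℓ₁, hℓ₁, hmem⟩ := exists_cell_mem hΛ hQ (γ (t0 + δ))
  let P : Del Λ Q := ⟨cell Λ Q ℓ₁, (isDelonePolyhedron_iff hΛ hQ).2 ⟨⟨_, hmem⟩, ℓ₁, hℓ₁, rfl⟩⟩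
  have hmemP : γ (t0 + δ) ∈ (P : Set (Fin d → ℝ)) := hmem
  have hyP : γ t0 ∈ (P : Set (Fin d → ℝ)) := by
    by_contra hcon
    refine (mem_iInter₂.1 (hsub (?_ : t0 + δ ∈ Metric.ball t0 ε)) P hcon) hmemP
    rw [Metric.mem_ball, Real.dist_eq, add_sub_cancel_left, abs_of_pos hδ0]; exact hδ3
  have hPT : ((P : Set (Fin d → ℝ)) ∩ convexHull ℝ T).Nonempty := by
    obtain ⟨y, hyT, hy0⟩ := hTx _ hγt0
    refine ⟨y, ?_, hyT⟩
    rw [hP] at hyP ⊢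
    have := cell_add_mem hΛ hQ (hℓ' P) hyP (w := y - γ t0) (by
      rw [← neg_sub, mulVec_neg, hy0, neg_zero])
    simpa using this
  have h1 : ℓ' P x - ℓ x ≤ 0 := hx ⟨P, hPT⟩
  have h2 : ℓ' P p ≤ ℓ p := le_of_mem_cell (hℓ' P) hp
  have h3 : ℓ (γ (t0 + δ)) < ℓ' P (γ (t0 + δ)) := by
    rw [hP] at hmemP
    refine lt_of_le_of_ne (le_of_mem_cell h hmemP) fun he => ?_
    have := hgr ⟨⟨by linarith [ht0.1], by linarith⟩, mem_cell_of_eq h hmemP he⟩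
    linarith
  simp only [hγ] at h3
  rw [affine_smul_add_smul, affine_smul_add_smul] at h3
  have hT0 : 0 ≤ t0 + δ := by linarith [ht0.1]
  have hT1 : 0 ≤ 1 - (t0 + δ) := by linarith
  nlinarith [mul_le_mul_of_nonneg_left h1 hT0, mul_le_mul_of_nonneg_left h2 hT1]

theorem isSubdivisionWithVertices_del (hΛ : IsStandardPeriodic Λ) (hQ : Q ∈ rationalClosure d) :
    IsSubdivisionWithVertices Λ (Del Λ Q) where
  isPolyhedron P hP := by
    obtain ⟨hne, ℓ, hℓ, rfl⟩ := (isDelonePolyhedron_iff hΛ hQ).1 hP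
    exact isPolyhedron_cell hΛ hQ hℓ hne
  nonempty P hP := hP.1
  face_mem P hP F hne hF := by
    obtain ⟨-, ℓ, hℓ, rfl⟩ := (isDelonePolyhedron_iff hΛ hQ).1 hP
    exact (isDelonePolyhedron_iff hΛ hQ).2 ⟨hne, exists_cell_of_isExposed hΛ hQ hℓ hne hF⟩
  inter_face P hP P' hP' _ := by
    obtain ⟨-, ℓ, hℓ, rfl⟩ := (isDelonePolyhedron_iff hΛ hQ).1 hP
    obtain ⟨-, ℓ', hℓ', rfl⟩ := (isDelonePolyhedron_iff hΛ hQ).1 hP'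
    exact ⟨isExposed_cell_inter hℓ hℓ', by
      rw [inter_comm]; exact isExposed_cell_inter hℓ' hℓ⟩
  sUnion_eq := by
    refine eq_univ_of_forall fun x => ?_
    obtain ⟨ℓ, hℓ, hx⟩ := exists_cell_mem hΛ hQ x
    exact ⟨_, (isDelonePolyhedron_iff hΛ hQ).2 ⟨⟨x, hx⟩, ℓ, hℓ, rfl⟩, hx⟩
  locallyFinite := locallyFinite_del hΛ hQ
  eq_convexHull P hP := by
    obtain ⟨-, ℓ, hℓ, rfl⟩ := (isDelonePolyhedron_iff hΛ hQ).1 hP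
    exact Subset.antisymm (convexHull_mono fun v hv => ⟨hv.1, subset_convexHull ℝ _ hv⟩)
      (convexHull_min inter_subset_right (convex_convexHull ℝ _))

end Delone

/-! ### The linear description of a secondary cone -/

section Description

variable {d : ℕ} {Λ : Set (Fin d → ℝ)} {Q : Matrix (Fin d) (Fin d) ℝ}
  {𝒟 ℰ : Set (Set (Fin d → ℝ))}

lemma exists_top_superset (h𝒟 : IsPolyhedralSubdivision univ 𝒟)
    (hlf : LocallyFinite (fun P : 𝒟 => (P : Set (Fin d → ℝ)))) {F : Set (Fin d → ℝ)}
    (hF : F ∈ 𝒟) : ∃ P ∈ 𝒟, dim P = d ∧ F ⊆ P := by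
  obtain ⟨x, hx, hrel⟩ := exists_relint (h𝒟.isPolyhedron F hF).convex (h𝒟.nonempty F hF)
  obtain ⟨P, hP, hPd, hxP⟩ := exists_top_cell h𝒟 hlf x
  exact ⟨P, hP, hPd, subset_of_relint_mem h𝒟 hF hP hx hrel hxP⟩

/-- A subdivision is determined by its full-dimensional cells. -/
lemma subdivision_eq (h𝒟 : IsPolyhedralSubdivision univ 𝒟)
    (hlf : LocallyFinite (fun P : 𝒟 => (P : Set (Fin d → ℝ))))
    (hℰ : IsPolyhedralSubdivision univ ℰ) (h : ∀ P ∈ 𝒟, dim P = d → P ∈ ℰ) : ℰ = 𝒟 := by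
  refine Subset.antisymm (fun F hF => ?_) fun F hF => ?_
  · obtain ⟨x, hx, hrel⟩ := exists_relint (hℰ.isPolyhedron F hF).convex (hℰ.nonempty F hF)
    obtain ⟨P, hP, hPd, hxP⟩ := exists_top_cell h𝒟 hlf x
    have hPℰ := h P hP hPd
    exact h𝒟.face_mem P hP F ⟨x, hx⟩
      (isExposed_of_subset hℰ hF hPℰ (subset_of_relint_mem hℰ hF hPℰ hx hrel hxP))
  · obtain ⟨P, hP, hPd, hFP⟩ := exists_top_superset h𝒟 hlf hF
    exact hℰ.face_mem P (h P hP hPd) F (h𝒟.nonempty F hF) (isExposed_of_subset h𝒟 hF hP hFP)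

lemma del_eq_of_contact (hΛ : IsStandardPeriodic Λ) (h𝒟 : IsSubdivisionWithVertices Λ 𝒟)
    (hQ : Q ∈ rationalClosure d) (h : ∀ P ∈ 𝒟, dim P = d →
      ∃ ℓ, IsAdmissible Λ Q ℓ ∧ contact Λ Q ℓ = Λ ∩ P) : Del Λ Q = 𝒟 := by
  refine subdivision_eq h𝒟.toIsPolyhedralSubdivision h𝒟.locallyFinite
    (isSubdivisionWithVertices_del hΛ hQ).toIsPolyhedralSubdivision fun P hP hPd => ?_
  obtain ⟨ℓ, hℓ, hc⟩ := h P hP hPd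
  refine (isDelonePolyhedron_iff hΛ hQ).2
    ⟨h𝒟.toIsPolyhedralSubdivision.nonempty P hP, ℓ, hℓ, ?_⟩
  rw [cell, hc]
  exact h𝒟.eq_convexHull P hP

lemma exists_contact_of_mem_del (hΛ : IsStandardPeriodic Λ) (hQ : Q ∈ rationalClosure d)
    {P : Set (Fin d → ℝ)} (hP : P ∈ Del Λ Q) :
    ∃ ℓ, IsAdmissible Λ Q ℓ ∧ P = cell Λ Q ℓ ∧ contact Λ Q ℓ = Λ ∩ P := by
  have hQ' := isRationalForm_of_mem hQ
  obtain ⟨-, ℓ, hℓ, rfl⟩ := (isDelonePolyhedron_iff hΛ hQ).1 hP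
  refine ⟨ℓ, hℓ, rfl, Subset.antisymm (fun v hv => ⟨hv.1, subset_convexHull ℝ _ hv⟩)
    fun v hv => ?_⟩
  exact mem_contact_of_mem_cell hQ'.symm hQ'.nonneg hℓ (hℓ.exists_center hΛ hQ) hv.1 hv.2

lemma affine_ext_of_independent {V : Finset (Fin d → ℝ)} {S : Set (Fin d → ℝ)}
    (hV : IsIndependentIn (d + 1) V S) {ℓ ℓ' : (Fin d → ℝ) →ᵃ[ℝ] ℝ} (h : ∀ v ∈ S, ℓ v = ℓ' v) :
    ℓ = ℓ' :=
  AffineMap.ext_on (affineSpan_eq_top_of_card hV.2.1 hV.2.2) fun v hv => h v (hV.1 hv)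

/-- Signs of an affine function that vanishes on the common facet of two cells and is positive
somewhere on the second one. -/
lemma pos_of_facet (h𝒟 : IsPolyhedralSubdivision univ 𝒟) {F R R' : Set (Fin d → ℝ)}
    (hF : F ∈ 𝒟) (hR : R ∈ 𝒟) (hR' : R' ∈ 𝒟) (hFd : dim F + 1 = d) (hne : R ≠ R')
    (h : F ⊆ R) (h' : F ⊆ R') {a : (Fin d → ℝ) →ᵃ[ℝ] ℝ} (ha : ∀ x ∈ F, a x = 0)
    {p : Fin d → ℝ} (hp : p ∈ R') (hpF : p ∉ F) (hap : 0 < a p) :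
    (∀ x ∈ R', x ∉ F → 0 < a x) ∧ ∀ x ∈ R, x ∉ F → a x < 0 := by
  obtain ⟨f, hf⟩ := h𝒟.nonempty F hF
  have hane : a.linear ≠ 0 := linear_ne_zero (x := p) (y := f) (by rw [ha f hf]; exact hap.ne')
  refine ⟨fun x hx hxF => ?_, fun x hx hxF => ?_⟩
  · have := mul_pos_of_facet h𝒟 hF hR' hFd h' ha hane hp hpF hx hxF
    exact (mul_pos_iff_of_pos_left hap).1 this
  · have := mul_neg_of_facet h𝒟 hF hR hR' hFd hne h h' ha hane hx hxF hp hpF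
    nlinarith

lemma nonneg_of_facet (h𝒟 : IsPolyhedralSubdivision univ 𝒟) {F R' : Set (Fin d → ℝ)}
    (hF : F ∈ 𝒟) (hR' : R' ∈ 𝒟) (hFd : dim F + 1 = d)
    (h' : F ⊆ R') {a : (Fin d → ℝ) →ᵃ[ℝ] ℝ} (ha : ∀ x ∈ F, a x = 0)
    {p : Fin d → ℝ} (hp : p ∈ R') (hpF : p ∉ F) (hap : 0 ≤ a p) :
    ∀ x ∈ R', 0 ≤ a x := by
  obtain ⟨f, hf⟩ := h𝒟.nonempty F hF
  intro x hx
  by_cases hxF : x ∈ F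
  · rw [ha x hxF]
  by_cases hane : a.linear = 0
  · have h1 := affine_add_apply a f (x - f)
    rw [add_sub_cancel, hane, ha f hf] at h1
    simp [h1]
  · have := mul_pos_of_facet h𝒟 hF hR' hFd h' ha hane hp hpF hx hxF
    exact (pos_of_mul_pos_right this hap).le

lemma eq_on_facet (h𝒟 : IsSubdivisionWithVertices Λ 𝒟) {F R R' : Set (Fin d → ℝ)}
    (hF : F ∈ 𝒟) (h : F ⊆ R) (h' : F ⊆ R') {ℓ ℓ' : (Fin d → ℝ) →ᵃ[ℝ] ℝ}
    (hℓ : ∀ v ∈ Λ ∩ R, ℓ v = qval Q v) (hℓ' : ∀ v ∈ Λ ∩ R', ℓ' v = qval Q v) :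
    ∀ x ∈ F, (ℓ' - ℓ) x = 0 := by
  intro x hx
  change ℓ' x - ℓ x = 0
  rw [h𝒟.eq_convexHull F hF] at hx
  have h1 : ∀ v ∈ Λ ∩ F, ℓ v = ℓ' v := fun v hv => by
    rw [hℓ v ⟨hv.1, h hv.2⟩, hℓ' v ⟨hv.1, h' hv.2⟩]
  have h2 := affine_le_of_mem_convexHull (fun v hv => (h1 v hv).le) hx
  have h3 := affine_le_of_mem_convexHull (fun v hv => (h1 v hv).ge) hx
  linarith

lemma Choice.isIndependentIn_insert [DecidableEq (Fin d → ℝ)] (χ : Choice Λ 𝒟)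
    (h𝒟 : IsPolyhedralSubdivision univ 𝒟) {F : Set (Fin d → ℝ)} (hF : F ∈ 𝒟)
    (hFd : dim F + 1 = d) :
    IsIndependentIn (d + 1) (insert (χ.w F) (χ.facetV F)) (Λ ∩ χ.left F) := by
  obtain ⟨hL, -, -, -, hFLR⟩ := χ.adjacent F hF hFd
  have hFL : F ⊆ χ.left F := fun x hx => by rw [hFLR] at hx; exact hx.1
  have hw := χ.w_spec F hF hFd
  obtain ⟨a, ha, haL⟩ := exists_supporting h𝒟 hF hL hFL
  exact (χ.facetV_spec F hF hFd).insert_of_affine (by omega)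
    (inter_subset_inter_right _ hFL) ha hw.1 (haL _ hw.1.2 hw.2).ne

/-- The description of the secondary cone by linear equalities and strict inequalities. -/
theorem secondaryCone_eq (hΛ : IsStandardPeriodic Λ) (h𝒟 : IsSubdivisionWithVertices Λ 𝒟)
    (χ : Choice Λ 𝒟) : secondaryCone Λ 𝒟 =
      {Q | Q ∈ rationalClosure d ∧ χ.Equalities Q ∧ χ.Inequalities Q} := by
  classical
  have h𝒟' := h𝒟.toIsPolyhedralSubdivision
  ext Q
  constructor
  · rintro ⟨hQ, rfl⟩
    refine ⟨hQ, fun P hP hPd w hw => ?_, fun F hF hFd => ?_⟩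
    · obtain ⟨ℓ, hℓ, -, hc⟩ := exists_contact_of_mem_del hΛ hQ hP
      obtain ⟨hV, hcard, hind⟩ := χ.cellV_spec P hP hPd
      rw [pairing_eq_sub hcard hind (ℓ := ℓ) fun v hv => by
        have := hV hv; rw [← hc] at this; exact this.2]
      rw [← hc] at hw
      rw [hw.2, sub_self]
    · obtain ⟨hL, hR, hLd, hRd, hFLR⟩ := χ.adjacent F hF hFd
      obtain ⟨ℓ, hℓ, -, hc⟩ := exists_contact_of_mem_del hΛ hQ hL
      obtain ⟨hV, hcard, hind⟩ := χ.isIndependentIn_insert h𝒟' hF hFd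
      have h1 := pairing_eq_sub hcard hind (Q := Q) (ℓ := ℓ) (fun v hv => by
        have := hV hv; rw [← hc] at this; exact this.2) (χ.w' F)
      have hw' := χ.w'_spec F hF hFd
      have h2 : ℓ (χ.w' F) < qval Q (χ.w' F) := by
        refine lt_of_le_of_ne (hℓ _ hw'.1.1) fun he => hw'.2 ?_
        have h3 : χ.w' F ∈ contact Λ Q ℓ := ⟨hw'.1.1, he⟩
        rw [hc] at h3
        exact hFLR.ge ⟨h3.2, hw'.1.2⟩
      convert sub_pos.2 h2
  · rintro ⟨hQ, heq, hineq⟩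
    have hℓ : ∀ P, ∃ ℓ : (Fin d → ℝ) →ᵃ[ℝ] ℝ, P ∈ 𝒟 → dim P = d →
        ∀ v ∈ Λ ∩ P, ℓ v = qval Q v := by
      intro P
      by_cases hP : P ∈ 𝒟 ∧ dim P = d
      · obtain ⟨hV, hcard, hind⟩ := χ.cellV_spec P hP.1 hP.2
        obtain ⟨ℓ, hℓ⟩ := exists_affine_interpolation hcard hind (qval Q)
        refine ⟨ℓ, fun _ _ v hv => ?_⟩
        have := heq P hP.1 hP.2 v hv
        rw [pairing_eq_sub hcard hind hℓ] at this
        linarith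
      · exact ⟨0, fun h h' => absurd ⟨h, h'⟩ hP⟩
    choose ℓ hℓ using hℓ
    have hsign : ∀ R ∈ 𝒟, ∀ R' ∈ 𝒟, dim R = d → dim R' = d → (R ∩ R').Nonempty →
        dim (R ∩ R') + 1 = d → ∀ x ∈ R', x ∉ R ∩ R' → ℓ R x < ℓ R' x := by
      intro R hR R' hR' hRd hRd' hn hFd x hx hxF
      set F := R ∩ R' with hFdef
      have hF : F ∈ 𝒟 := h𝒟'.face_mem R hR _ hn (h𝒟'.inter_face R hR R' hR' hn).1
      have hne : R ≠ R' := by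
        rintro rfl
        rw [hFdef, inter_self] at hFd; omega
      obtain ⟨hL, hR2, hLd, hR2d, hFLR⟩ := χ.adjacent F hF hFd
      have hFL : F ⊆ χ.left F := fun x hx => by rw [hFLR] at hx; exact hx.1
      have hFR : F ⊆ χ.right F := fun x hx => by rw [hFLR] at hx; exact hx.2
      have hLRne : χ.left F ≠ χ.right F := by
        intro he
        have : F = χ.left F := hFLR.trans (by rw [← he, inter_self])
        rw [← this] at hLd; omega
      have hw' := χ.w'_spec F hF hFd
      obtain ⟨hV, hcard, hind⟩ := χ.isIndependentIn_insert h𝒟' hF hFd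
      have h1 := pairing_eq_sub hcard hind (Q := Q) (ℓ := ℓ (χ.left F))
        (fun v hv => hℓ _ hL hLd v (hV hv)) (χ.w' F)
      have h2 : 0 < pairing (NForm (insert (χ.w F) (χ.facetV F)) (χ.w' F)) Q := by
        convert hineq F hF hFd
      rw [h1, ← hℓ _ hR2 hR2d _ hw'.1] at h2
      have ha := eq_on_facet h𝒟 hF hFL hFR (hℓ _ hL hLd) (hℓ _ hR2 hR2d)
      obtain ⟨h3, h4⟩ := pos_of_facet h𝒟' hF hL hR2 hFd hLRne hFL hFR ha hw'.1.2 hw'.2 h2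
      rcases eq_or_eq_of_facet_subset h𝒟' hF hL hR2 hR hFd hLd hR2d hRd hFLR inter_subset_left
        with e1 | e1 <;>
      rcases eq_or_eq_of_facet_subset h𝒟' hF hL hR2 hR' hFd hLd hR2d hRd' hFLR inter_subset_right
        with e2 | e2
      · exact absurd (e1.trans e2.symm) hne
      · have := h3 x (e2 ▸ hx) hxF
        rw [e1, e2]
        exact sub_pos.1 this
      · have := h4 x (e2 ▸ hx) hxF
        rw [e1, e2]
        exact sub_neg.1 this
      · exact absurd (e1.trans e2.symm) hne
    have hadj : ∀ R ∈ 𝒟, ∀ R' ∈ 𝒟, dim R = d → dim R' = d → (R ∩ R').Nonempty →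
        dim (R ∩ R') + 1 = d → ∀ x ∈ R', ℓ R x ≤ ℓ R' x := by
      intro R hR R' hR' hRd hRd' hn hFd x hx
      by_cases hxF : x ∈ R ∩ R'
      · have hF : R ∩ R' ∈ 𝒟 := h𝒟'.face_mem R hR _ hn (h𝒟'.inter_face R hR R' hR' hn).1
        exact (sub_eq_zero.1 (eq_on_facet h𝒟 hF inter_subset_left inter_subset_right
          (hℓ R hR hRd) (hℓ R' hR' hRd') x hxF)).ge
      · exact (hsign R hR R' hR' hRd hRd' hn hFd x hx hxF).le
    have hstrict : ∀ R ∈ 𝒟, ∀ R' ∈ 𝒟, dim R = d → dim R' = d → (R ∩ R').Nonempty →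
        dim (R ∩ R') + 1 = d → ∀ x ∈ R', x ∉ R → ℓ R x < ℓ R' x :=
      fun R hR R' hR' hRd hRd' hn hFd x hx hxR =>
        hsign R hR R' hR' hRd hRd' hn hFd x hx fun h => hxR h.1
    refine ⟨hQ, del_eq_of_contact hΛ h𝒟 hQ fun P hP hPd => ⟨ℓ P, fun v hv => ?_, ?_⟩⟩
    · obtain ⟨P', hP', hPd', hvP'⟩ := exists_top_cell h𝒟' h𝒟.locallyFinite v
      rw [← hℓ P' hP' hPd' v ⟨hv, hvP'⟩]
      exact affine_le_of_local h𝒟' h𝒟.locallyFinite ℓ hadj hP hPd hP' hPd' hvP'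
    · refine Subset.antisymm (fun v hv => ⟨hv.1, ?_⟩) fun v hv => ⟨hv.1, hℓ P hP hPd v hv⟩
      by_contra hvP
      obtain ⟨P', hP', hPd', hvP'⟩ := exists_top_cell h𝒟' h𝒟.locallyFinite v
      have := affine_lt_of_local h𝒟' h𝒟.locallyFinite ℓ hadj hstrict hP hPd hP' hPd' hvP' hvP
      rw [hv.2, hℓ P' hP' hPd' v ⟨hv.1, hvP'⟩] at this
      exact lt_irrefl _ this

end Description

/-! ### The closed cone of forms whose Delone subdivision coarsens a given one -/

section SupportCone

variable {d : ℕ} {Λ : Set (Fin d → ℝ)} {Q Q' : Matrix (Fin d) (Fin d) ℝ}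
  {𝒟 ℰ ℱ : Set (Set (Fin d → ℝ))}

/-- The forms `Q` for which the function `Q[·]` on `Λ` is interpolated, on the vertices of each
full-dimensional polyhedron of `𝒟`, by an affine function that is at most `Q[·]` on `Λ`. This will
turn out to be the closure of the secondary cone of `𝒟`, if the latter is nonempty. -/
def supportCone (Λ : Set (Fin d → ℝ)) (𝒟 : Set (Set (Fin d → ℝ))) :
    Set (Matrix (Fin d) (Fin d) ℝ) :=
  {Q | Qᵀ = Q ∧ ∀ P ∈ 𝒟, dim P = d → ∃ ℓ, IsAdmissible Λ Q ℓ ∧ ∀ v ∈ Λ ∩ P, ℓ v = qval Q v}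

lemma add_mem_supportCone (hQ : Q ∈ supportCone Λ 𝒟) (hQ' : Q' ∈ supportCone Λ 𝒟) :
    Q + Q' ∈ supportCone Λ 𝒟 := by
  refine ⟨by rw [transpose_add, hQ.1, hQ'.1], fun P hP hPd => ?_⟩
  obtain ⟨ℓ, hℓ, h⟩ := hQ.2 P hP hPd
  obtain ⟨ℓ', hℓ', h'⟩ := hQ'.2 P hP hPd
  refine ⟨ℓ + ℓ', fun v hv => ?_, fun v hv => ?_⟩ <;> rw [qval_matrix_add]
  · exact add_le_add (hℓ v hv) (hℓ' v hv)
  · exact congrArg₂ (· + ·) (h v hv) (h' v hv)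

lemma smul_mem_supportCone {s : ℝ} (hs : 0 ≤ s) (hQ : Q ∈ supportCone Λ 𝒟) :
    s • Q ∈ supportCone Λ 𝒟 := by
  refine ⟨by rw [transpose_smul, hQ.1], fun P hP hPd => ?_⟩
  obtain ⟨ℓ, hℓ, h⟩ := hQ.2 P hP hPd
  refine ⟨s • ℓ, fun v hv => ?_, fun v hv => ?_⟩ <;> rw [qval_matrix_smul]
  · exact mul_le_mul_of_nonneg_left (hℓ v hv) hs
  · exact congrArg (s * ·) (h v hv)

lemma zero_mem_supportCone : (0 : Matrix (Fin d) (Fin d) ℝ) ∈ supportCone Λ 𝒟 := by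
  refine ⟨transpose_zero, fun P _ _ => ⟨0, fun v _ => ?_, fun v _ => ?_⟩⟩ <;> simp [qval]

lemma convex_supportCone : Convex ℝ (supportCone Λ 𝒟) := fun _ hQ _ hQ' _ _ ha hb _ =>
  add_mem_supportCone (smul_mem_supportCone ha hQ) (smul_mem_supportCone hb hQ')

lemma supportCone_subset_rationalClosure (hΛ : IsStandardPeriodic Λ)
    (h𝒟 : IsSubdivisionWithVertices Λ 𝒟) : supportCone Λ 𝒟 ⊆ rationalClosure d := by
  rintro Q ⟨hQ, h⟩
  have h𝒟' := h𝒟.toIsPolyhedralSubdivision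
  obtain ⟨P, hP, hPd, -⟩ := exists_top_cell h𝒟' h𝒟.locallyFinite 0
  obtain ⟨ℓ, hℓ, hv⟩ := h P hP hPd
  refine mem_rationalClosure_of_cell hΛ hQ hℓ ((interior_nonempty_of_dim
    (h𝒟'.isPolyhedron P hP).convex (h𝒟'.nonempty P hP) hPd).mono (interior_mono ?_))
  rw [h𝒟.eq_convexHull P hP]
  exact convexHull_mono fun v h => ⟨h.1, hv v h⟩

lemma isCoarsening_trans (h : IsCoarsening 𝒟 ℰ) (h' : IsCoarsening ℰ ℱ) : IsCoarsening 𝒟 ℱ := by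
  intro P hP
  obtain ⟨P', hP', hPP'⟩ := h' P hP
  obtain ⟨R, hR, hPR⟩ := h P' hP'
  exact ⟨R, hR, hPP'.trans hPR⟩

/-- The support cone consists of the forms whose Delone subdivisions are coarsenings of `𝒟`. -/
theorem mem_supportCone_iff (hΛ : IsStandardPeriodic Λ) (h𝒟 : IsSubdivisionWithVertices Λ 𝒟) :
    Q ∈ supportCone Λ 𝒟 ↔ Q ∈ rationalClosure d ∧ IsCoarsening (Del Λ Q) 𝒟 := by
  refine ⟨fun h => ?_, fun ⟨hQ, h⟩ => ⟨(isRationalForm_of_mem hQ).symm, fun P hP hPd => ?_⟩⟩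
  · have hQ := supportCone_subset_rationalClosure hΛ h𝒟 h
    refine ⟨hQ, fun F hF => ?_⟩
    obtain ⟨P, hP, hPd, hFP⟩ :=
      exists_top_superset h𝒟.toIsPolyhedralSubdivision h𝒟.locallyFinite hF
    obtain ⟨ℓ, hℓ, hv⟩ := h.2 P hP hPd
    have hsub : P ⊆ cell Λ Q ℓ := by
      rw [h𝒟.eq_convexHull P hP]
      exact convexHull_mono fun v h => ⟨h.1, hv v h⟩
    exact ⟨cell Λ Q ℓ, (isDelonePolyhedron_iff hΛ hQ).2
      ⟨(h𝒟.nonempty P hP).mono hsub, ℓ, hℓ, rfl⟩, hFP.trans hsub⟩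
  · obtain ⟨R, hR, hPR⟩ := h P hP
    obtain ⟨ℓ, hℓ, -, hc⟩ := exists_contact_of_mem_del hΛ hQ hR
    refine ⟨ℓ, hℓ, fun v hv => ?_⟩
    have hv' : v ∈ contact Λ Q ℓ := hc.ge ⟨hv.1, hPR hv.2⟩
    exact hv'.2

lemma secondaryCone_subset_supportCone (hΛ : IsStandardPeriodic Λ)
    (h𝒟 : IsSubdivisionWithVertices Λ 𝒟) : secondaryCone Λ 𝒟 ⊆ supportCone Λ 𝒟 :=
  fun Q hQ => (mem_supportCone_iff hΛ h𝒟).2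
    ⟨hQ.1, fun P hP => ⟨P, by rw [hQ.2]; exact hP, Subset.rfl⟩⟩

/-- Adding a positive multiple of a form in the secondary cone moves the support cone into
the secondary cone. -/
lemma add_smul_mem_secondaryCone (hΛ : IsStandardPeriodic Λ)
    (h𝒟 : IsSubdivisionWithVertices Λ 𝒟) (hQ : Q ∈ supportCone Λ 𝒟)
    (hQ' : Q' ∈ secondaryCone Λ 𝒟) {s : ℝ} (hs : 0 < s) : Q + s • Q' ∈ secondaryCone Λ 𝒟 := by
  have hmem : Q + s • Q' ∈ rationalClosure d := supportCone_subset_rationalClosure hΛ h𝒟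
    (add_mem_supportCone hQ
      (smul_mem_supportCone hs.le (secondaryCone_subset_supportCone hΛ h𝒟 hQ')))
  refine ⟨hmem, del_eq_of_contact hΛ h𝒟 hmem fun P hP hPd => ?_⟩
  obtain ⟨ℓ, hℓ, hv⟩ := hQ.2 P hP hPd
  obtain ⟨ℓ', hℓ', -, hc⟩ := exists_contact_of_mem_del hΛ hQ'.1 (hQ'.2.symm ▸ hP)
  have happ : ∀ v, (ℓ + s • ℓ') v = ℓ v + s * ℓ' v := fun v => rfl
  refine ⟨ℓ + s • ℓ', fun v h => ?_, Subset.antisymm (fun v h => ?_) fun v h => ⟨h.1, ?_⟩⟩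
  · rw [happ, qval_matrix_add, qval_matrix_smul]
    exact add_le_add (hℓ v h) (mul_le_mul_of_nonneg_left (hℓ' v h) hs.le)
  · have h1 := h.2
    rw [happ, qval_matrix_add, qval_matrix_smul] at h1
    rw [← hc]
    refine ⟨h.1, le_antisymm (hℓ' v h.1) ?_⟩
    have h2 := hℓ v h.1
    exact le_of_mul_le_mul_left (by linarith) hs
  · rw [← hc] at h
    rw [happ, qval_matrix_add, qval_matrix_smul, h.2, hv v (hc ▸ h)]

end SupportCone

/-! ### Polyhedrality of the support cone -/

section Finiteness

open scoped Pointwise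

variable {d : ℕ} {Λ : Set (Fin d → ℝ)} {Q Q' : Matrix (Fin d) (Fin d) ℝ}
  {𝒟 : Set (Set (Fin d → ℝ))}

/-- The affine function whose difference to `Q[·]` is the translate by `-z` of the difference
of `ℓ` to `Q[·]`. -/
def translate (Q : Matrix (Fin d) (Fin d) ℝ) (z : Fin d → ℝ) (ℓ : (Fin d → ℝ) →ᵃ[ℝ] ℝ) :
    (Fin d → ℝ) →ᵃ[ℝ] ℝ := ℓ - affineOfDot ((2 : ℝ) • (Q *ᵥ z)) (qval Q z - ℓ.linear z)

lemma translate_apply (hQ : Qᵀ = Q) (z : Fin d → ℝ) (ℓ : (Fin d → ℝ) →ᵃ[ℝ] ℝ) (x : Fin d → ℝ) :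
    translate Q z ℓ x - qval Q x = ℓ (x + z) - qval Q (x + z) := by
  have : translate Q z ℓ x =
    ℓ x - affineOfDot ((2 : ℝ) • (Q *ᵥ z)) (qval Q z - ℓ.linear z) x := rfl
  rw [this, affineOfDot_apply, affine_add_apply, qval_add hQ, smul_dotProduct, smul_eq_mul,
    dotProduct_comm]
  ring

/-- Delone subdivisions are invariant under translation by integral vectors. -/
lemma vadd_mem_del (hΛ : IsStandardPeriodic Λ) (hQ : Q ∈ rationalClosure d) (z : Fin d → ℤ)
    {P : Set (Fin d → ℝ)} (hP : P ∈ Del Λ Q) : (-fun i => (z i : ℝ)) +ᵥ P ∈ Del Λ Q := by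
  have hQ' := (isRationalForm_of_mem hQ).symm
  obtain ⟨hne, ℓ, hℓ, rfl⟩ := (isDelonePolyhedron_iff hΛ hQ).1 hP
  refine (isDelonePolyhedron_iff hΛ hQ).2 ⟨hne.vadd_set, translate Q (fun i => (z i : ℝ)) ℓ,
    fun v hv => ?_, ?_⟩
  · have h1 := translate_apply hQ' (fun i => (z i : ℝ)) ℓ v
    have h2 := hℓ _ (hΛ.add_mem hv z)
    linarith
  · rw [cell, cell, ← convexHull_vadd]
    congr 1
    ext v
    rw [mem_vadd_set_iff_neg_vadd_mem, neg_neg, vadd_eq_add, add_comm]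
    have h1 := translate_apply hQ' (fun i => (z i : ℝ)) ℓ v
    constructor
    · rintro ⟨h2, h3⟩
      refine ⟨?_, by linarith⟩
      have := hΛ.sub_mem h2 z
      rwa [add_sub_cancel_right] at this
    · rintro ⟨h2, h3⟩
      exact ⟨hΛ.add_mem h2 z, by linarith⟩

lemma dim_vadd (z : Fin d → ℝ) (P : Set (Fin d → ℝ)) : dim (z +ᵥ P) = dim P := by
  rw [dim, dim, vectorSpan_vadd]

/-- The linear functional `⟨N, ·⟩`. -/
def pairingLinear (N : Matrix (Fin d) (Fin d) ℝ) : Matrix (Fin d) (Fin d) ℝ →ₗ[ℝ] ℝ where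
  toFun Q := pairing N Q
  map_add' Q Q' := by simp [pairing, mul_add]
  map_smul' s Q := by simp [pairing]

/-- The support cone of a periodic subdivision is cut out of a linear subspace by finitely many
inequalities, which express that the interpolating function of a cell is below `Q[·]` at
a vertex of an adjacent cell: by local convexity and periodicity, it suffices to consider the
pairs of adjacent cells whose common facet meets the unit cube. -/
theorem exists_description (h𝒟 : IsSubdivisionWithVertices Λ 𝒟)
    (hΛ : IsStandardPeriodic Λ)
    (hper : ∀ z : Fin d → ℤ, ∀ P ∈ 𝒟, (-fun i => (z i : ℝ)) +ᵥ P ∈ 𝒟) :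
    ∃ (L : Submodule ℝ (Matrix (Fin d) (Fin d) ℝ)) (Φ : Set (Matrix (Fin d) (Fin d) ℝ →ₗ[ℝ] ℝ)),
      Φ.Finite ∧ supportCone Λ 𝒟 = {Q | Q ∈ L ∧ ∀ f ∈ Φ, 0 ≤ f Q} ∧
      ∀ f ∈ Φ, ∃ P ∈ 𝒟, dim P = d ∧ ∃ w ∈ Λ, ∀ (Q : Matrix (Fin d) (Fin d) ℝ)
        (ℓ : (Fin d → ℝ) →ᵃ[ℝ] ℝ), (∀ v ∈ Λ ∩ P, ℓ v = qval Q v) → f Q = qval Q w - ℓ w := by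
  have h𝒟' := h𝒟.toIsPolyhedralSubdivision
  have hV : ∀ P : Set (Fin d → ℝ), ∃ V, P ∈ 𝒟 → dim P = d → IsIndependentIn (d + 1) V (Λ ∩ P) := by
    intro P
    by_cases h : P ∈ 𝒟 ∧ dim P = d
    · obtain ⟨V, hV⟩ := exists_isIndependentIn (h𝒟.eq_convexHull P h.1) (h𝒟'.nonempty P h.1)
      rw [h.2] at hV
      exact ⟨V, fun _ _ => hV⟩
    · exact ⟨∅, fun h1 h2 => absurd ⟨h1, h2⟩ h⟩
  choose V hV using hV
  have hw : ∀ P P' : Set (Fin d → ℝ), ∃ w, P ∈ 𝒟 → P' ∈ 𝒟 → dim P' = d →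
      dim (P ∩ P') + 1 = d → w ∈ (Λ ∩ P') \ (P ∩ P') := by
    intro P P'
    by_cases h : P ∈ 𝒟 ∧ P' ∈ 𝒟 ∧ dim P' = d ∧ dim (P ∩ P') + 1 = d
    · obtain ⟨w, hw⟩ := exists_vertex_notMem (h𝒟.eq_convexHull P' h.2.1)
        ((h𝒟'.isPolyhedron P h.1).convex.inter (h𝒟'.isPolyhedron P' h.2.1).convex) h.2.2.2 h.2.2.1
      exact ⟨w, fun _ _ _ _ => hw⟩
    · exact ⟨0, fun h1 h2 h3 h4 => absurd ⟨h1, h2, h3, h4⟩ h⟩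
  choose w hw using hw
  -- The evaluation of the inequalities and equalities in terms of interpolating functions.
  have hval : ∀ P ∈ 𝒟, dim P = d → ∀ (Q : Matrix (Fin d) (Fin d) ℝ) (ℓ : (Fin d → ℝ) →ᵃ[ℝ] ℝ),
      (∀ v ∈ Λ ∩ P, ℓ v = qval Q v) → ∀ u, pairingLinear (NForm (V P) u) Q = qval Q u - ℓ u :=
    fun P hP hPd Q ℓ h u => pairing_eq_sub (hV P hP hPd).2.1 (hV P hP hPd).2.2
      (fun v hv => h v ((hV P hP hPd).1 hv)) u
  let A : Set (Set (Fin d → ℝ)) := {P | P ∈ 𝒟 ∧ (P ∩ Icc 0 1).Nonempty}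
  have hA : A.Finite := by
    have := (h𝒟.locallyFinite.finite_nonempty_inter_compact
      (isCompact_Icc (a := (0 : Fin d → ℝ)) (b := 1))).image (fun P : 𝒟 => (P : Set (Fin d → ℝ)))
    refine this.subset fun P hP => ⟨⟨P, hP.1⟩, hP.2, rfl⟩
  let L : Submodule ℝ (Matrix (Fin d) (Fin d) ℝ) :=
    { carrier := {Q | Qᵀ = Q ∧ ∀ P ∈ 𝒟, dim P = d → ∀ u ∈ Λ ∩ P,
        pairingLinear (NForm (V P) u) Q = 0}
      zero_mem' := ⟨transpose_zero, fun P _ _ u _ => map_zero _⟩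
      add_mem' := fun {Q Q'} h h' => ⟨by rw [transpose_add, h.1, h'.1], fun P hP hPd u hu => by
        rw [map_add, h.2 P hP hPd u hu, h'.2 P hP hPd u hu, add_zero]⟩
      smul_mem' := fun s Q h => ⟨by rw [transpose_smul, h.1], fun P hP hPd u hu => by
        rw [map_smul, h.2 P hP hPd u hu, smul_zero]⟩ }
  let Φ : Set (Matrix (Fin d) (Fin d) ℝ →ₗ[ℝ] ℝ) :=
    {f | ∃ P ∈ A, ∃ P' ∈ A, dim P = d ∧ dim P' = d ∧ dim (P ∩ P') + 1 = d ∧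
      f = pairingLinear (NForm (V P) (w P P'))}
  refine ⟨L, Φ, ?_, ?_, ?_⟩
  · refine (hA.image2 (fun P P' => pairingLinear (NForm (V P) (w P P'))) hA).subset ?_
    rintro f ⟨P, hP, P', hP', -, -, -, rfl⟩
    exact mem_image2_of_mem hP hP'
  · ext Q
    constructor
    · rintro ⟨hQ, h⟩
      refine ⟨⟨hQ, fun P hP hPd u hu => ?_⟩, ?_⟩
      · obtain ⟨ℓ, -, hℓ⟩ := h P hP hPd
        rw [hval P hP hPd Q ℓ hℓ, hℓ u hu, sub_self]
      · rintro f ⟨P, hP, P', hP', hPd, hPd', hFd, rfl⟩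
        obtain ⟨ℓ, hadm, hℓ⟩ := h P hP.1 hPd
        rw [hval P hP.1 hPd Q ℓ hℓ]
        exact sub_nonneg.2 (hadm _ (hw P P' hP.1 hP'.1 hPd' hFd).1.1)
    · rintro ⟨⟨hQ, hL⟩, hΦ⟩
      refine ⟨hQ, ?_⟩
      have hℓ : ∀ P, ∃ ℓ : (Fin d → ℝ) →ᵃ[ℝ] ℝ, P ∈ 𝒟 → dim P = d →
          ∀ v ∈ Λ ∩ P, ℓ v = qval Q v := by
        intro P
        by_cases hP : P ∈ 𝒟 ∧ dim P = d
        · obtain ⟨hVP, hcard, hind⟩ := hV P hP.1 hP.2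
          obtain ⟨ℓ, hℓ⟩ := exists_affine_interpolation hcard hind (qval Q)
          refine ⟨ℓ, fun _ _ v hv => ?_⟩
          have : pairing (NForm (V P) v) Q = 0 := hL P hP.1 hP.2 v hv
          rw [pairing_eq_sub hcard hind hℓ] at this
          linarith
        · exact ⟨0, fun h h' => absurd ⟨h, h'⟩ hP⟩
      choose ℓ hℓ using hℓ
      have hadj : ∀ R ∈ 𝒟, ∀ R' ∈ 𝒟, dim R = d → dim R' = d → (R ∩ R').Nonempty →
          dim (R ∩ R') + 1 = d → ∀ x ∈ R', ℓ R x ≤ ℓ R' x := by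
        intro R hR R' hR' hRd hRd' ⟨p, hp⟩ hFd x hx
        set z : Fin d → ℤ := fun i => ⌊p i⌋ with hz
        set ζ : Fin d → ℝ := fun i => (z i : ℝ) with hζ
        have htrans : ∀ {S : Set (Fin d → ℝ)} {y}, y ∈ S → y - ζ ∈ -ζ +ᵥ S := fun {S y} hy => by
          rw [mem_vadd_set_iff_neg_vadd_mem, neg_neg, vadd_eq_add, add_sub_cancel]; exact hy
        have hcube : p - ζ ∈ Icc (0 : Fin d → ℝ) 1 := by
          refine ⟨fun i => ?_, fun i => ?_⟩
          · exact Int.fract_nonneg (p i)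
          · exact (Int.fract_lt_one (p i)).le
        have hS : -ζ +ᵥ R ∈ A := ⟨hper z R hR, p - ζ, htrans hp.1, hcube⟩
        have hS' : -ζ +ᵥ R' ∈ A := ⟨hper z R' hR', p - ζ, htrans hp.2, hcube⟩
        have hSd : dim (-ζ +ᵥ R) = d := by rw [dim_vadd, hRd]
        have hSd' : dim (-ζ +ᵥ R') = d := by rw [dim_vadd, hRd']
        have hG : dim ((-ζ +ᵥ R) ∩ (-ζ +ᵥ R')) + 1 = d := by
          rw [← vadd_set_inter, dim_vadd, hFd]
        -- The interpolating functions of the translated cells are the translated ones.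
        have hℓz : ∀ T ∈ 𝒟, dim T = d → ℓ (-ζ +ᵥ T) = translate Q ζ (ℓ T) := by
          intro T hT hTd
          have hTd' : dim (-ζ +ᵥ T) = d := by rw [dim_vadd, hTd]
          refine affine_ext_of_independent (hV _ (hper z T hT) hTd') fun v hv => ?_
          rw [hℓ _ (hper z T hT) hTd' v hv]
          have hv' : v + ζ ∈ T := by
            have := hv.2
            rwa [mem_vadd_set_iff_neg_vadd_mem, neg_neg, vadd_eq_add, add_comm] at this
          have h1 := hℓ T hT hTd (v + ζ) ⟨hΛ.add_mem hv.1 z, hv'⟩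
          have h2 := translate_apply hQ ζ (ℓ T) v
          linarith
        have hww := hw _ _ hS.1 hS'.1 hSd' hG
        have h1 : 0 ≤ pairingLinear (NForm (V (-ζ +ᵥ R)) (w (-ζ +ᵥ R) (-ζ +ᵥ R'))) Q :=
          hΦ _ ⟨_, hS, _, hS', hSd, hSd', hG, rfl⟩
        rw [hval _ hS.1 hSd Q _ (hℓ _ hS.1 hSd), ← hℓ _ hS'.1 hSd' _ hww.1] at h1
        have hn : ((-ζ +ᵥ R) ∩ (-ζ +ᵥ R')).Nonempty := ⟨p - ζ, htrans hp.1, htrans hp.2⟩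
        have hF : (-ζ +ᵥ R) ∩ (-ζ +ᵥ R') ∈ 𝒟 :=
          h𝒟'.face_mem _ hS.1 _ hn (h𝒟'.inter_face _ hS.1 _ hS'.1 hn).1
        have h2 := nonneg_of_facet h𝒟' hF hS'.1 hG inter_subset_right
          (eq_on_facet h𝒟 hF inter_subset_left inter_subset_right (hℓ _ hS.1 hSd)
            (hℓ _ hS'.1 hSd')) hww.1.2 hww.2 h1 (x - ζ) (htrans hx)
        have h3 : 0 ≤ ℓ (-ζ +ᵥ R') (x - ζ) - ℓ (-ζ +ᵥ R) (x - ζ) := h2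
        rw [hℓz R hR hRd, hℓz R' hR' hRd'] at h3
        have h4 := translate_apply hQ ζ (ℓ R) (x - ζ)
        have h5 := translate_apply hQ ζ (ℓ R') (x - ζ)
        rw [sub_add_cancel] at h4 h5
        linarith
      refine fun P hP hPd => ⟨ℓ P, fun v hv => ?_, hℓ P hP hPd⟩
      obtain ⟨P', hP', hPd', hvP'⟩ := exists_top_cell h𝒟' h𝒟.locallyFinite v
      rw [← hℓ P' hP' hPd' v ⟨hv, hvP'⟩]
      exact affine_le_of_local h𝒟' h𝒟.locallyFinite ℓ hadj hP hPd hP' hPd' hvP'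
  · rintro f ⟨P, hP, P', hP', hPd, hPd', hFd, rfl⟩
    exact ⟨P, hP.1, hPd, _, (hw P P' hP.1 hP'.1 hPd' hFd).1.1,
      fun Q ℓ h => hval P hP.1 hPd Q ℓ h _⟩

end Finiteness

/-! ### Faces of the support cones -/

section Faces

lemma isPolyhedralCone_of_finite {E : Type*} [AddCommGroup E] [Module ℝ E] [TopologicalSpace E]
    [IsTopologicalAddGroup E] [ContinuousSMul ℝ E] [T2Space E] [FiniteDimensional ℝ E]
    (L : Submodule ℝ E) {Φ : Set (E →ₗ[ℝ] ℝ)} (hΦ : Φ.Finite) :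
    IsPolyhedralCone {x | x ∈ L ∧ ∀ f ∈ Φ, 0 ≤ f x} := by
  let b := Module.finBasis ℝ (E ⧸ L)
  let T : Set (E →ₗ[ℝ] ℝ) := range fun i => b.coord i ∘ₗ L.mkQ
  have hT : ∀ x, x ∈ L ↔ ∀ g ∈ T, g x = 0 := fun x => by
    rw [forall_mem_range, ← Submodule.Quotient.mk_eq_zero, ← b.forall_coord_eq_zero_iff]
    rfl
  have hfin : (Φ ∪ (T ∪ Neg.neg '' T)).Finite :=
    hΦ.union ((finite_range _).union ((finite_range _).image _))
  obtain ⟨n, ψ, hψ⟩ := hfin.fin_embedding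
  refine ⟨n, fun i => LinearMap.toContinuousLinearMap (ψ i), ?_⟩
  have h1 : {x | ∀ i, 0 ≤ LinearMap.toContinuousLinearMap (ψ i) x} =
      {x | ∀ f ∈ range ψ, 0 ≤ f x} := by
    ext x
    simp only [mem_ofPred_eq, forall_mem_range, LinearMap.coe_toContinuousLinearMap']
  rw [h1, hψ]
  ext x
  constructor
  · rintro ⟨hx, hf⟩ f (h | h | ⟨g, hg, rfl⟩)
    · exact hf f h
    · exact ((hT x).1 hx f h).ge
    · rw [LinearMap.neg_apply, (hT x).1 hx g hg, neg_zero]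
  · intro h
    refine ⟨(hT x).2 fun g hg => le_antisymm ?_ (h g (Or.inr (Or.inl hg))),
      fun f hf => h f (Or.inl hf)⟩
    have := h (-g) (Or.inr (Or.inr ⟨g, hg, rfl⟩))
    rwa [LinearMap.neg_apply, neg_nonneg] at this

lemma exists_sub_smul_mem {E : Type*} [AddCommGroup E] [Module ℝ E] (L : Submodule ℝ E)
    {Φ : Set (E →ₗ[ℝ] ℝ)} (hΦ : Φ.Finite) {x y : E} (hx : x ∈ L ∧ ∀ f ∈ Φ, 0 ≤ f x)
    (hy : y ∈ L ∧ ∀ f ∈ Φ, 0 ≤ f y) (h : ∀ f ∈ Φ, f x = 0 → f y = 0) :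
    ∃ ε > (0 : ℝ), x - ε • y ∈ {x | x ∈ L ∧ ∀ f ∈ Φ, 0 ≤ f x} := by
  have hev : ∀ᶠ ε in 𝓝[>] (0 : ℝ), ∀ f ∈ Φ, 0 ≤ f (x - ε • y) := by
    rw [Filter.eventually_all_finite hΦ]
    intro f hf
    have hlin : ∀ ε : ℝ, f (x - ε • y) = f x - ε * f y := fun ε => by
      rw [map_sub, map_smul, smul_eq_mul]
    simp only [hlin]
    rcases (hx.2 f hf).eq_or_lt with h0 | h0
    · rw [← h0, h f hf h0.symm]
      simp
    · have hc : Continuous fun ε : ℝ => f x - ε * f y := by fun_prop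
      have h3 : 0 < f x - 0 * f y := by simpa using h0
      exact ((hc.tendsto 0).eventually (lt_mem_nhds h3)).filter_mono nhdsWithin_le_nhds
        |>.mono fun ε h => h.le
  obtain ⟨ε, hε, hε0⟩ := (hev.and self_mem_nhdsWithin).exists
  exact ⟨ε, hε0, L.sub_mem hx.1 (L.smul_mem ε hy.1), hε⟩

/-- In a cone `C`, every point of a subset `B` can be subtracted, in a small multiple, from
a relative interior point of `B`. -/
lemma exists_sub_smul_mem_of_relint {E : Type*} [AddCommGroup E] [Module ℝ E] {B C : Set E}
    (hBC : B ⊆ C) (hC : ∀ x ∈ C, ∀ s : ℝ, 0 ≤ s → s • x ∈ C) {x y : E} (hx : x ∈ B)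
    (hrel : ∀ h ∈ vectorSpan ℝ B, ∃ ε > 0, ∀ s : ℝ, |s| ≤ ε → x + s • h ∈ B) (hy : y ∈ B) :
    ∃ ε > (0 : ℝ), x - ε • y ∈ C := by
  obtain ⟨ε, hε, h⟩ := hrel (x - y) (vsub_mem_vectorSpan ℝ hx hy)
  have h1 := hC _ (hBC (h ε (abs_of_pos hε).le)) (1 + ε)⁻¹ (by positivity)
  refine ⟨ε / (1 + ε), by positivity, ?_⟩
  convert h1 using 1
  have h2 : x + ε • (x - y) = (1 + ε) • x - ε • y := by module
  rw [h2, smul_sub, smul_smul, smul_smul, inv_mul_cancel₀ (by positivity), one_smul,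
    div_eq_inv_mul]

variable {E : Type*} [AddCommGroup E] [Module ℝ E] [TopologicalSpace E]

lemma IsPolyhedralCone.isPolyhedron {C : Set E} (h : IsPolyhedralCone C) : IsPolyhedron C := by
  obtain ⟨n, f, rfl⟩ := h
  refine ⟨n, fun i => -f i, 0, ?_⟩
  ext x
  simp

variable {d : ℕ} {Λ : Set (Fin d → ℝ)} {Q Q' : Matrix (Fin d) (Fin d) ℝ}
  {𝒟 ℰ : Set (Set (Fin d → ℝ))}

lemma isSubdivisionWithVertices (hΛ : IsStandardPeriodic Λ) (h𝒟 : 𝒟 ∈ deloneSubdivisions Λ) :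
    IsSubdivisionWithVertices Λ 𝒟 := by
  obtain ⟨Q, hQ, rfl⟩ := h𝒟
  exact isSubdivisionWithVertices_del hΛ hQ

lemma exists_description_del (hΛ : IsStandardPeriodic Λ) (h𝒟 : 𝒟 ∈ deloneSubdivisions Λ) :
    ∃ (L : Submodule ℝ (Matrix (Fin d) (Fin d) ℝ)) (Φ : Set (Matrix (Fin d) (Fin d) ℝ →ₗ[ℝ] ℝ)),
      Φ.Finite ∧ supportCone Λ 𝒟 = {Q | Q ∈ L ∧ ∀ f ∈ Φ, 0 ≤ f Q} ∧
      ∀ f ∈ Φ, ∃ P ∈ 𝒟, dim P = d ∧ ∃ w ∈ Λ, ∀ (Q : Matrix (Fin d) (Fin d) ℝ)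
        (ℓ : (Fin d → ℝ) →ᵃ[ℝ] ℝ), (∀ v ∈ Λ ∩ P, ℓ v = qval Q v) → f Q = qval Q w - ℓ w := by
  obtain ⟨Q, hQ, rfl⟩ := h𝒟
  exact exists_description (isSubdivisionWithVertices_del hΛ hQ) hΛ
    fun z P hP => vadd_mem_del hΛ hQ z hP

lemma isPolyhedralCone_supportCone (hΛ : IsStandardPeriodic Λ)
    (h𝒟 : 𝒟 ∈ deloneSubdivisions Λ) : IsPolyhedralCone (supportCone Λ 𝒟) := by
  obtain ⟨L, Φ, hΦ, h, -⟩ := exists_description_del hΛ h𝒟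
  rw [h]
  exact isPolyhedralCone_of_finite L hΦ

theorem closure_secondaryCone (hΛ : IsStandardPeriodic Λ) (h𝒟 : 𝒟 ∈ deloneSubdivisions Λ) :
    closure (secondaryCone Λ 𝒟) = supportCone Λ 𝒟 := by
  have hcl := (isPolyhedralCone_supportCone hΛ h𝒟).isPolyhedron.isClosed
  obtain ⟨Q₀, hQ₀, rfl⟩ := h𝒟
  have hs := isSubdivisionWithVertices_del hΛ hQ₀
  refine Subset.antisymm (closure_minimal (secondaryCone_subset_supportCone hΛ hs) hcl)
    fun Q hQ => ?_
  have hlim : Filter.Tendsto (fun t : ℝ => Q + t • Q₀) (𝓝[>] 0) (𝓝 Q) := by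
    have : Continuous fun t : ℝ => Q + t • Q₀ := by fun_prop
    have h := (this.tendsto 0).mono_left (nhdsWithin_le_nhds (s := Ioi 0))
    simpa using h
  refine mem_closure_of_tendsto hlim ?_
  filter_upwards [self_mem_nhdsWithin] with t ht
  exact add_smul_mem_secondaryCone hΛ hs hQ ⟨hQ₀, rfl⟩ ht

/-- The smallest face of the support cone of `𝒟` that contains `Q` is the support cone of
`Del(Q)`. -/
theorem mem_supportCone_del_iff (hΛ : IsStandardPeriodic Λ) (h𝒟 : 𝒟 ∈ deloneSubdivisions Λ)
    (hQ : Q ∈ supportCone Λ 𝒟) : Q' ∈ supportCone Λ (Del Λ Q) ↔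
      Q' ∈ supportCone Λ 𝒟 ∧ ∃ ε > (0 : ℝ), Q - ε • Q' ∈ supportCone Λ 𝒟 := by
  obtain ⟨L, Φ, hΦ, hdesc, hval⟩ := exists_description_del hΛ h𝒟
  obtain ⟨Q₀, hQ₀, rfl⟩ := h𝒟
  have hs := isSubdivisionWithVertices_del hΛ hQ₀
  obtain ⟨hQr, hcoarse⟩ := (mem_supportCone_iff hΛ hs).1 hQ
  have hs' := isSubdivisionWithVertices_del hΛ hQr
  constructor
  · intro hQ'
    have h1 := (mem_supportCone_iff hΛ hs').1 hQ'
    have h2 : Q' ∈ supportCone Λ (Del Λ Q₀) :=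
      (mem_supportCone_iff hΛ hs).2 ⟨h1.1, isCoarsening_trans h1.2 hcoarse⟩
    -- An inequality that is an equality for `Q` concerns a point in the cell of `Del(Q)`.
    have hzero : ∀ f ∈ Φ, f Q = 0 → f Q' = 0 := by
      intro f hf h0
      obtain ⟨P, hP, hPd, w, hw, hfv⟩ := hval f hf
      obtain ⟨R, hR, hPR⟩ := hcoarse P hP
      obtain ⟨ℓ, -, -, hc⟩ := exists_contact_of_mem_del hΛ hQr hR
      have hℓ : ∀ v ∈ Λ ∩ R, ℓ v = qval Q v := fun v hv => by
        rw [← hc] at hv; exact hv.2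
      have hRd : dim R = d := le_antisymm (dim_le R) (hPd.ge.trans (dim_mono hPR))
      rw [hfv Q ℓ fun v hv => hℓ v ⟨hv.1, hPR hv.2⟩] at h0
      have hwR : w ∈ Λ ∩ R := by
        rw [← hc]; exact ⟨hw, by linarith⟩
      obtain ⟨ℓ', -, hℓ'⟩ := hQ'.2 R hR hRd
      rw [hfv Q' ℓ' fun v hv => hℓ' v ⟨hv.1, hPR hv.2⟩, hℓ' w hwR, sub_self]
    refine ⟨h2, ?_⟩
    rw [hdesc] at hQ h2 ⊢
    exact exists_sub_smul_mem L hΦ hQ h2 hzero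
  · rintro ⟨hQ', ε, hε, hd⟩
    refine ⟨hQ'.1, fun R hR hRd => ?_⟩
    have hs0 := hs.toIsPolyhedralSubdivision
    have hs1 := hs'.toIsPolyhedralSubdivision
    obtain ⟨x, hx⟩ := interior_nonempty_of_dim (hs1.isPolyhedron R hR).convex
      (hs1.nonempty R hR) hRd
    obtain ⟨P, hP, hPd, hxP⟩ := exists_top_cell hs0 hs.locallyFinite x
    have hPR : P ⊆ R := by
      obtain ⟨R', hR', hPR'⟩ := hcoarse P hP
      rwa [subset_of_interior_mem hs1 hR hR' hx (hPR' hxP)]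
    obtain ⟨V, hV⟩ := exists_isIndependentIn (hs.eq_convexHull P hP) (hs0.nonempty P hP)
    rw [hPd] at hV
    obtain ⟨ℓ, -, -, hc⟩ := exists_contact_of_mem_del hΛ hQr hR
    obtain ⟨ℓ', hadm', hℓ'⟩ := hQ'.2 P hP hPd
    obtain ⟨ℓ'', hadm'', hℓ''⟩ := hd.2 P hP hPd
    have hq : ∀ v, qval (Q - ε • Q') v = qval Q v - ε * qval Q' v := fun v => by
      rw [sub_eq_add_neg, ← neg_smul, qval_matrix_add, qval_matrix_smul]; ring
    have heq : ℓ = ℓ'' + ε • ℓ' := by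
      refine affine_ext_of_independent hV fun v hv => ?_
      have h1 : v ∈ contact Λ Q ℓ := hc.ge ⟨hv.1, hPR hv.2⟩
      change ℓ v = ℓ'' v + ε * ℓ' v
      rw [h1.2, hℓ' v hv, hℓ'' v hv, hq]; ring
    refine ⟨ℓ', hadm', fun v hv => ?_⟩
    have h1 : v ∈ contact Λ Q ℓ := hc.ge hv
    have h2 : ℓ'' v + ε * ℓ' v = qval Q v := by
      rw [← h1.2, heq]; rfl
    have h3 := hadm'' v hv.1
    rw [hq] at h3
    refine le_antisymm (hadm' v hv.1) (le_of_mul_le_mul_left (a := ε) ?_ hε)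
    linarith

/-- The support cones of the Delone subdivisions of forms in a support cone are faces of it. -/
theorem isExposed_supportCone_del (hΛ : IsStandardPeriodic Λ) (h𝒟 : 𝒟 ∈ deloneSubdivisions Λ)
    (hQ : Q ∈ supportCone Λ 𝒟) :
    IsExposed ℝ (supportCone Λ 𝒟) (supportCone Λ (Del Λ Q)) := by
  classical
  have hiff := fun Q' => mem_supportCone_del_iff (Q' := Q') hΛ h𝒟 hQ
  obtain ⟨L, Φ, hΦ, hdesc, -⟩ := exists_description_del hΛ h𝒟
  rw [hdesc] at hQ hiff ⊢
  -- The face is exposed by minus the sum of the inequalities that are equalities for `Q`.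
  have hfin : {f | f ∈ Φ ∧ f Q = 0}.Finite := hΦ.subset fun f hf => hf.1
  let l : Matrix (Fin d) (Fin d) ℝ →ₗ[ℝ] ℝ := -∑ f ∈ hfin.toFinset, f
  have hl : ∀ Q', l Q' = -∑ f ∈ hfin.toFinset, f Q' := fun Q' => by simp [l]
  have hlQ : l Q = 0 := by
    rw [hl, Finset.sum_eq_zero fun f hf => ((hfin.mem_toFinset).1 hf).2, neg_zero]
  have hle : ∀ Q', (Q' ∈ L ∧ ∀ f ∈ Φ, 0 ≤ f Q') → l Q' ≤ 0 := fun Q' h => by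
    rw [hl, neg_nonpos]
    exact Finset.sum_nonneg fun f hf => h.2 f ((hfin.mem_toFinset).1 hf).1
  refine fun _ => ⟨LinearMap.toContinuousLinearMap l, ?_⟩
  ext Q'
  rw [hiff]
  constructor
  · rintro ⟨h, ε, hε, hd⟩
    refine ⟨h, fun Q'' h'' => (hle Q'' h'').trans ?_⟩
    have h1 := hle _ hd
    rw [map_sub, map_smul, hlQ, smul_eq_mul] at h1
    change 0 ≤ l Q'
    exact le_of_mul_le_mul_left (by linarith) hε
  · rintro ⟨h, hmax⟩
    have h0 : 0 ≤ l Q' := hlQ.ge.trans (hmax Q hQ)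
    have h1 : ∀ f ∈ Φ, f Q = 0 → f Q' = 0 := by
      intro f hf hfQ
      rw [hl, neg_nonneg] at h0
      have h2 := (Finset.sum_eq_zero_iff_of_nonneg fun f hf =>
        h.2 f ((hfin.mem_toFinset).1 hf).1).1 (le_antisymm h0 (Finset.sum_nonneg fun f hf =>
          h.2 f ((hfin.mem_toFinset).1 hf).1))
      exact h2 f ((hfin.mem_toFinset).2 ⟨hf, hfQ⟩)
    exact ⟨h, exists_sub_smul_mem L hΦ hQ h h1⟩

/-- Every nonempty face of a support cone is the support cone of the Delone subdivision of any
of its relative interior points. -/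
theorem exists_eq_of_isExposed (hΛ : IsStandardPeriodic Λ) (h𝒟 : 𝒟 ∈ deloneSubdivisions Λ)
    {B : Set (Matrix (Fin d) (Fin d) ℝ)} (hne : B.Nonempty)
    (hB : IsExposed ℝ (supportCone Λ 𝒟) B) :
    ∃ ℰ ∈ deloneSubdivisions Λ, supportCone Λ ℰ = B := by
  obtain ⟨Q, hQB, hrel⟩ := exists_relint (hB.convex convex_supportCone) hne
  have hQ := hB.subset hQB
  have hQr := supportCone_subset_rationalClosure hΛ (isSubdivisionWithVertices hΛ h𝒟) hQ
  refine ⟨Del Λ Q, ⟨Q, hQr, rfl⟩, Subset.antisymm (fun Q' h => ?_) fun Q' h => ?_⟩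
  · obtain ⟨hQ', ε, hε, hd⟩ := (mem_supportCone_del_iff hΛ h𝒟 hQ).1 h
    obtain ⟨l, rfl⟩ := hB hne
    -- A linear functional that is bounded above on a cone is nonpositive there.
    have h0 : 0 ≤ l Q := by simpa using hQB.2 0 zero_mem_supportCone
    have h2 := hQB.2 _ (add_mem_supportCone hQ hQ)
    have h3 := hQB.2 _ hd
    rw [map_add] at h2
    rw [map_sub, map_smul, smul_eq_mul] at h3
    have h4 : 0 ≤ l Q' := le_of_mul_le_mul_left (by linarith) hε
    exact ⟨hQ', fun Q'' h'' => (hQB.2 Q'' h'').trans (by linarith)⟩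
  · exact (mem_supportCone_del_iff hΛ h𝒟 hQ).2 ⟨hB.subset h,
      exists_sub_smul_mem_of_relint hB.subset (fun _ hx _ hs => smul_mem_supportCone hs hx)
        hQB hrel h⟩

/-- The intersection of two support cones is the support cone of the Delone subdivision of any of
its relative interior points. -/
theorem exists_eq_inter (hΛ : IsStandardPeriodic Λ) (h𝒟 : 𝒟 ∈ deloneSubdivisions Λ)
    (hℰ : ℰ ∈ deloneSubdivisions Λ) : ∃ Q ∈ supportCone Λ 𝒟 ∩ supportCone Λ ℰ,
      supportCone Λ (Del Λ Q) = supportCone Λ 𝒟 ∩ supportCone Λ ℰ := by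
  obtain ⟨Q, hQ, hrel⟩ := exists_relint
    (convex_supportCone.inter convex_supportCone : Convex ℝ (supportCone Λ 𝒟 ∩ supportCone Λ ℰ))
    ⟨0, zero_mem_supportCone, zero_mem_supportCone⟩
  refine ⟨Q, hQ, Subset.antisymm (fun Q' h => ⟨?_, ?_⟩) fun Q' h => ?_⟩
  · exact ((mem_supportCone_del_iff hΛ h𝒟 hQ.1).1 h).1
  · exact ((mem_supportCone_del_iff hΛ hℰ hQ.2).1 h).1
  · exact (mem_supportCone_del_iff hΛ h𝒟 hQ.1).2 ⟨h.1,
      exists_sub_smul_mem_of_relint inter_subset_left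
        (fun _ hx _ hs => smul_mem_supportCone hs hx) hQ hrel h⟩

lemma isCoarsening_iff_supportCone_subset (hΛ : IsStandardPeriodic Λ)
    (h𝒟 : 𝒟 ∈ deloneSubdivisions Λ) (hℰ : ℰ ∈ deloneSubdivisions Λ) :
    IsCoarsening 𝒟 ℰ ↔ supportCone Λ 𝒟 ⊆ supportCone Λ ℰ := by
  have hs := isSubdivisionWithVertices hΛ h𝒟
  have hs' := isSubdivisionWithVertices hΛ hℰ
  refine ⟨fun h Q hQ => ?_, fun h => ?_⟩
  · have h1 := (mem_supportCone_iff hΛ hs).1 hQ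
    exact (mem_supportCone_iff hΛ hs').2 ⟨h1.1, isCoarsening_trans h1.2 h⟩
  · obtain ⟨Q, hQ, rfl⟩ := h𝒟
    exact ((mem_supportCone_iff hΛ hs').1
      (h (secondaryCone_subset_supportCone hΛ hs ⟨hQ, rfl⟩))).2

/-- If two support cones agree, then a form in one secondary cone plus a form in the other one lies
in both of them. -/
lemma supportCone_injOn (hΛ : IsStandardPeriodic Λ) :
    InjOn (supportCone Λ) (deloneSubdivisions Λ) := by
  intro 𝒟 h𝒟 ℰ hℰ h
  have hs := isSubdivisionWithVertices hΛ h𝒟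
  have hs' := isSubdivisionWithVertices hΛ hℰ
  obtain ⟨Q, hQ, rfl⟩ := h𝒟
  obtain ⟨R, hR, rfl⟩ := hℰ
  have hQ1 : Q ∈ secondaryCone Λ (Del Λ Q) := ⟨hQ, rfl⟩
  have hR1 : R ∈ secondaryCone Λ (Del Λ R) := ⟨hR, rfl⟩
  have h1 := add_smul_mem_secondaryCone hΛ hs
    (h ▸ secondaryCone_subset_supportCone hΛ hs' hR1) hQ1 one_pos
  have h2 := add_smul_mem_secondaryCone hΛ hs'
    (h ▸ secondaryCone_subset_supportCone hΛ hs hQ1) hR1 one_pos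
  rw [one_smul] at h1 h2
  rw [add_comm] at h2
  exact h1.2.symm.trans h2.2

/-- The support cones of the Delone subdivisions subdivide the rational closure. -/
theorem isPolyhedralSubdivision_supportCone (hΛ : IsStandardPeriodic Λ) :
    IsPolyhedralSubdivision (rationalClosure d)
      {C | ∃ 𝒟 ∈ deloneSubdivisions Λ, supportCone Λ 𝒟 = C} where
  isPolyhedron := by
    rintro _ ⟨𝒟, h𝒟, rfl⟩
    exact (isPolyhedralCone_supportCone hΛ h𝒟).isPolyhedron
  nonempty := by
    rintro _ ⟨𝒟, h𝒟, rfl⟩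
    exact ⟨0, zero_mem_supportCone⟩
  face_mem := by
    rintro _ ⟨𝒟, h𝒟, rfl⟩ B hne hB
    exact exists_eq_of_isExposed hΛ h𝒟 hne hB
  inter_face := by
    rintro _ ⟨𝒟, h𝒟, rfl⟩ _ ⟨ℰ, hℰ, rfl⟩ -
    obtain ⟨Q, hQ, h⟩ := exists_eq_inter hΛ h𝒟 hℰ
    rw [← h]
    exact ⟨isExposed_supportCone_del hΛ h𝒟 hQ.1, isExposed_supportCone_del hΛ hℰ hQ.2⟩
  sUnion_eq := by
    refine Subset.antisymm (sUnion_subset ?_) fun Q hQ => ?_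
    · rintro _ ⟨𝒟, h𝒟, rfl⟩
      exact supportCone_subset_rationalClosure hΛ (isSubdivisionWithVertices hΛ h𝒟)
    · exact ⟨_, ⟨Del Λ Q, ⟨Q, hQ, rfl⟩, rfl⟩, secondaryCone_subset_supportCone hΛ
        (isSubdivisionWithVertices_del hΛ hQ) ⟨hQ, rfl⟩⟩

end Faces

end Secondary

theorem theorem3p1 (d : ℕ) (Λ : Set (Fin d → ℝ)) (hΛ : Secondary.IsStandardPeriodic Λ) :
    -- part I
    (∀ 𝒟 : Set (Set (Fin d → ℝ)), Secondary.IsSubdivisionWithVertices Λ 𝒟 →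
      ((Secondary.secondaryCone Λ 𝒟).Nonempty →
        Secondary.IsPolyhedralCone (closure (Secondary.secondaryCone Λ 𝒟))) ∧
      closure (Secondary.secondaryCone Λ 𝒟) ⊆ Secondary.rationalClosure d ∧
      Nonempty (Secondary.Choice Λ 𝒟) ∧
      ∀ χ : Secondary.Choice Λ 𝒟,
        Secondary.secondaryCone Λ 𝒟 =
          {Q | Q ∈ Secondary.rationalClosure d ∧ χ.Equalities Q ∧ χ.Inequalities Q}) ∧
    -- part II, the isomorphism of posets
    (∀ 𝒟 ∈ Secondary.deloneSubdivisions Λ, Secondary.IsSubdivisionWithVertices Λ 𝒟) ∧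
    Set.BijOn (fun 𝒟 => closure (Secondary.secondaryCone Λ 𝒟))
      (Secondary.deloneSubdivisions Λ)
      {C | ∃ 𝒟 ∈ Secondary.deloneSubdivisions Λ, closure (Secondary.secondaryCone Λ 𝒟) = C} ∧
    (∀ 𝒟 ∈ Secondary.deloneSubdivisions Λ, ∀ 𝒟' ∈ Secondary.deloneSubdivisions Λ,
      (Secondary.IsCoarsening 𝒟 𝒟' ↔
        closure (Secondary.secondaryCone Λ 𝒟) ⊆ closure (Secondary.secondaryCone Λ 𝒟'))) ∧
    -- part II, the polyhedral subdivision of the rational closure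
    Secondary.IsPolyhedralSubdivision (Secondary.rationalClosure d)
      {C | ∃ 𝒟 ∈ Secondary.deloneSubdivisions Λ,
        closure (Secondary.secondaryCone Λ 𝒟) = C} := by
  have hcl : ∀ 𝒟 ∈ Secondary.deloneSubdivisions Λ,
      closure (Secondary.secondaryCone Λ 𝒟) = Secondary.supportCone Λ 𝒟 :=
    fun 𝒟 h𝒟 => Secondary.closure_secondaryCone hΛ h𝒟
  have hset : {C | ∃ 𝒟 ∈ Secondary.deloneSubdivisions Λ,
      closure (Secondary.secondaryCone Λ 𝒟) = C} =
      {C | ∃ 𝒟 ∈ Secondary.deloneSubdivisions Λ, Secondary.supportCone Λ 𝒟 = C} := by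
    ext C
    exact exists_congr fun 𝒟 => and_congr_right fun h𝒟 => by rw [hcl 𝒟 h𝒟]
  refine ⟨fun 𝒟 h𝒟 => ⟨?_, ?_, Secondary.nonempty_choice h𝒟, Secondary.secondaryCone_eq hΛ h𝒟⟩,
    fun 𝒟 h𝒟 => Secondary.isSubdivisionWithVertices hΛ h𝒟, ⟨?_, ?_, ?_⟩, ?_, ?_⟩
  · rintro ⟨Q, hQ⟩
    have hD : 𝒟 ∈ Secondary.deloneSubdivisions Λ := ⟨Q, hQ⟩
    rw [hcl 𝒟 hD]
    exact Secondary.isPolyhedralCone_supportCone hΛ hD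
  · rcases (Secondary.secondaryCone Λ 𝒟).eq_empty_or_nonempty with he | ⟨Q, hQ⟩
    · rw [he, closure_empty]
      exact Set.empty_subset _
    · rw [hcl 𝒟 ⟨Q, hQ⟩]
      exact Secondary.supportCone_subset_rationalClosure hΛ h𝒟
  · exact fun 𝒟 h𝒟 => ⟨𝒟, h𝒟, rfl⟩
  · intro 𝒟 h𝒟 ℰ hℰ h
    refine Secondary.supportCone_injOn hΛ h𝒟 hℰ ?_
    rw [← hcl 𝒟 h𝒟, ← hcl ℰ hℰ]
    exact h
  · rintro C ⟨𝒟, h𝒟, rfl⟩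
    exact ⟨𝒟, h𝒟, rfl⟩
  · intro 𝒟 h𝒟 ℰ hℰ
    rw [hcl 𝒟 h𝒟, hcl ℰ hℰ]
    exact Secondary.isCoarsening_iff_supportCone_subset hΛ h𝒟 hℰ
  · rw [hset]
    exact Secondary.isPolyhedralSubdivision_supportCone hΛ
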